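/- Let $k\ge 1$, $N\ge k$, and let $f_1,\dots,f_N$ be real affine forms on $\mathbb R^k$ whose zero sets $H_j=\{f_j=0\}$ are hyperplanes in generic position: they are distinct, any $k$ of them meet in exactly one point, and no $k+1$ of them have a common point. Let $l_j=f_j-f_j(0)$ and let $\alpha_1,\dots,\alpha_N>0$. A vertex is a subset $X\subset\{1,\dots,N\}$ with $k$ elements, also viewed as the point $\bigcap_{j\in X}H_j$; $\mathcal X$ is the set of vertices and $\alpha_X=\sum_{j\in X}\alpha_j$. Let $f_0$ be a linear form on $\mathbb R^k$ that takes distinct values at distinct vertices and is nonconstant on each line $L_U=\bigcap_{j\in U}H_j$, $|U|=k-1$; let $e_U$ be the vector directing $L_U$ with $f_0(e_U)=1$. For a vertex $X'$ let $\omega_{X'}=\frac{df_{j_1}}{f_{j_1}}\wedge\dots\wedge\frac{df_{j_k}}{f_{j_k}}$, where $X'=\{j_1,\dots,j_k\}$ is ordered so that $df_{j_1}\wedge\dots\wedge df_{j_k}$ is positively oriented (so $\omega_{X'}=|\det(l_{j_1},\dots,l_{j_k})|\,\frac{dz_1\wedge\dots\wedge dz_k}{f_{j_1}\cdots f_{j_k}}$,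 also when $k=1$), and $\Omega_{X'}=\big(\prod_{j=1}^N|f_j|^{\alpha_j}\big)\,\omega_{X'}$. For a vertex $X$ and $|\rho|=1$, $\rho\notin\mathbb R$, let $\mathcal C_X^\rho=\{X+\rho\sum_{j\in X}a_je_{X\setminus\{j\}}: a_j>0\}\subset\mathbb C^k$, oriented as the image of $\mathcal C^+_X=\mathcal C_X^1\subset\mathbb R^k$ under $x\mapsto X+\rho(x-X)$, and $$I^\rho_{X,X'}(\lambda)=\int_{\mathcal C^\rho_X}e^{-\lambda f_0}\,\Omega_{X'},$$ where on $\mathcal C^\rho_X$ the form $\Omega_{X'}$ is the analytic extension of its real branch on $\Delta_X$, the connected component of $\mathbb R^k\setminus\bigcup_jH_j$ that has $X$ in its boundary and on which $f_0>f_0(X)$; the extension is made through the cones with $\operatorname{Im}\rho<0$, respectively with $\operatorname{Im}\rho>0$. Let $I^{+}_{X,X'}(\lambda)$ (respectively $I^-_{X,X'}(\lambda)$) be the common value of $I^\rho_{X,X'}(\lambda)$ over all $\rho$ with $|\rho|=1$, $\operatorname{Im}\rho<0$ (respectively $\operatorname{Im}\rho>0$) and $\operatorname{Re}(\rho\lambda)>0$;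 it is defined for $\lambda\in\mathbb C\setminus i\mathbb R_{\mp}$, where $\mathbb R_\pm$ denote the closed half-axes. Put $I^\pm_X=(I^\pm_{X,X'})_{X'\in\mathcal X}$. Let $\mathcal A$ be the diagonal matrix with $\mathcal A_{X,X}=f_0(X)$, and let $\mathcal B_{X,X}=\alpha_X$; $\mathcal B_{X,Y}=\operatorname{sgn}\big(l_j(e_U)l_r(e_U)\big)\alpha_r$ if $U=X\cap Y$ has $k-1$ elements, $X\setminus Y=\{j\}$ and $Y\setminus X=\{r\}$; and $\mathcal B_{X,Y}=0$ if $|X\cap Y|<k-1$. For $0<\varepsilon<\frac\pi2$ let $S_\pm=\{\lambda\ne0:\ \varepsilon-\frac\pi2<\pm\arg\lambda<\frac{3\pi}2-\varepsilon\}$. Then, for every vertex $X$ and for each choice of the sign $\pm$: (a) the integrals $I^\rho_{X,X'}(\lambda)$ with $\pm\operatorname{Im}\rho<0$ and $\operatorname{Re}(\rho\lambda)>0$ converge absolutely and do not depend on $\rho$; (b) $I^\pm_X$ is a solution of $I'=-(\mathcal A+\frac1\lambda\mathcal B)I$ on $\mathbb C\setminus i\mathbb R_\mp$; (c) for every $\varepsilon\in(0,\frac\pi2)$,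 uniformly in $S_\pm$, $$I^\pm_X(\lambda)\ \sim_{|\lambda|\to\infty}\ s_X\,D_{X,X}\,e^{-\lambda f_0(X)}\,\lambda^{-\alpha_X}\,v_X,$$ that is, the difference of the two sides is $o\big(|e^{-\lambda f_0(X)}\lambda^{-\alpha_X}|\big)$ uniformly. Here $(v_X)_{X\in\mathcal X}$ is the standard basis of $\mathbb R^{\mathcal X}$, $\lambda^{-\alpha_X}$ is taken with $-\frac\pi2<\pm\arg\lambda<\frac{3\pi}2$, and $$D_{X,X}=\Big(\prod_{j\in X}\Gamma(\alpha_j)\Big)\prod_{j\in X}|l_j(e_{X\setminus\{j\}})|^{\alpha_j}\prod_{j\notin X}|f_j(X)|^{\alpha_j},\qquad s_X=\prod_{j\in X}\operatorname{sgn}\,l_j(e_{X\setminus\{j\}})\in\{1,-1\};$$ $s_X$ is the sign of $\omega_X$ on $\mathcal C_X^+$, so that $s_X=1$ if all $f_j$, $j\in X$, are positive on $\mathcal C_X^+$. -/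

import Mathlib

open Filter Topology MeasureTheory Asymptotics

noncomputable section

/-- A real generic arrangement of `N ≥ k` affine hyperplanes `H_j = ker f_j` in `ℝ^k` (`k ≥ 1`),
with a linear form `f₀` in general position with respect to it. -/
structure GenericArrangement (k N : ℕ) where
  /-- the affine forms `f_1, …, f_N` -/
  f : Fin N → ((Fin k → ℝ) →ᵃ[ℝ] ℝ)
  /-- the linear form `f₀` -/
  f0 : (Fin k → ℝ) →ₗ[ℝ] ℝ
  one_le : 1 ≤ k
  le_card : k ≤ N
  /-- the hyperplanes are distinct -/
  distinct : ∀ i j, i ≠ j → {x | f i x = 0} ≠ {x | f j x = 0}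
  /-- any `k` hyperplanes meet in exactly one point -/
  inter_point : ∀ U : Finset (Fin N), U.card = k → ∃! x, ∀ j ∈ U, f j x = 0
  /-- no `k + 1` hyperplanes have a common point -/
  inter_empty : ∀ U : Finset (Fin N), U.card = k + 1 → ¬ ∃ x, ∀ j ∈ U, f j x = 0
  /-- `f₀` takes distinct values at distinct vertices -/
  f0_vertex : ∀ X Y : Finset (Fin N), X.card = k → Y.card = k → X ≠ Y →
    ∀ x y, (∀ j ∈ X, f j x = 0) → (∀ j ∈ Y, f j y = 0) → f0 x ≠ f0 y
  /-- `f₀` is not constant on any line that is an intersection of `k - 1` hyperplanes -/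
  f0_edge : ∀ U : Finset (Fin N), U.card + 1 = k →
    ∃ x y, (∀ j ∈ U, f j x = 0) ∧ (∀ j ∈ U, f j y = 0) ∧ f0 x ≠ f0 y

/-- Vertices, as subsets of `{1, …, N}` with `k` elements. -/
abbrev ArrVertex (k N : ℕ) : Type := {X : Finset (Fin N) // X.card = k}

/-- The extension of a real affine form on `ℝ^k` to a complex affine form on `ℂ^k`. -/
def complexifyForm {k : ℕ} (g : (Fin k → ℝ) →ᵃ[ℝ] ℝ) (z : Fin k → ℂ) : ℂ :=
  (g (fun i => (z i).re) : ℂ) + Complex.I * (g.linear (fun i => (z i).im) : ℂ)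

namespace GenericArrangement

variable {k N : ℕ} (A : GenericArrangement k N)

/-- The linear form `l_j = f_j - f_j(0)`. -/
def l (j : Fin N) : (Fin k → ℝ) →ₗ[ℝ] ℝ := (A.f j).linear

/-- A vertex as a point of `ℝ^k`. -/
def point (X : ArrVertex k N) : Fin k → ℝ := (A.inter_point X.1 X.2).choose

/-- `α_U = ∑_{j ∈ U} α_j`. -/
def weight (α : Fin N → ℝ) (U : Finset (Fin N)) : ℝ := ∑ j ∈ U, α j

/-- The vector `e_U` directing the line `L_U = ⋂_{j ∈ U} H_j` (`U` having `k - 1` elements),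
normalized by `f₀(e_U) = 1`. -/
def edgeVec (U : Finset (Fin N)) : Fin k → ℝ :=
  Classical.epsilon fun e => (∀ j ∈ U, A.l j e = 0) ∧ A.f0 e = 1

theorem point_spec (X : ArrVertex k N) {j : Fin N} (hj : j ∈ X.1) : A.f j (A.point X) = 0 :=
  (A.inter_point X.1 X.2).choose_spec.1 j hj

theorem f_eq (j : Fin N) (x p : Fin k → ℝ) : A.f j x = A.f j p + A.l j (x - p) := by
  have := (A.f j).linearMap_vsub x p
  simp only [vsub_eq_sub] at this
  simp only [l, this]; ring

theorem eq_zero_of_l (X : ArrVertex k N) (v : Fin k → ℝ) (h : ∀ j ∈ X.1, A.l j v = 0) :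
    v = 0 := by
  have hu := (A.inter_point X.1 X.2).unique (y₁ := A.point X + v) (y₂ := A.point X)
    (fun j hj => by rw [A.f_eq j _ (A.point X), A.point_spec X hj]; simp [h j hj])
    (fun j hj => A.point_spec X hj)
  simpa using hu

/-- `e_U` exists and is unique. -/
theorem existsUnique_edgeVec (U : Finset (Fin N)) (hU : U.card + 1 = k) :
    ∃! e, (∀ j ∈ U, A.l j e = 0) ∧ A.f0 e = 1 := by
  obtain ⟨x, y, hx, hy, hxy⟩ := A.f0_edge U hU
  have hne : A.f0 x - A.f0 y ≠ 0 := sub_ne_zero.2 hxy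
  refine ⟨(A.f0 x - A.f0 y)⁻¹ • (x - y), ⟨fun j hj => ?_, ?_⟩, ?_⟩
  · have := A.f_eq j x y
    rw [hx j hj, hy j hj] at this
    rw [map_smul, show A.l j (x - y) = 0 by linarith, smul_zero]
  · rw [map_smul, map_sub, smul_eq_mul, inv_mul_cancel₀ hne]
  · suffices H : ∀ e e' : Fin k → ℝ, ((∀ j ∈ U, A.l j e = 0) ∧ A.f0 e = 1) →
        ((∀ j ∈ U, A.l j e' = 0) ∧ A.f0 e' = 1) → e = e' by
      intro e he
      refine H _ _ he ⟨fun j hj => ?_, ?_⟩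
      · have := A.f_eq j x y
        rw [hx j hj, hy j hj] at this
        rw [map_smul, show A.l j (x - y) = 0 by linarith, smul_zero]
      · rw [map_smul, map_sub, smul_eq_mul, inv_mul_cancel₀ hne]
    intro e e' he he'
    have hcard : U.card < (Finset.univ : Finset (Fin N)).card := by
      have := A.le_card
      simp only [Finset.card_univ, Fintype.card_fin]; omega
    obtain ⟨j, -, hj⟩ := Finset.exists_mem_notMem_of_card_lt_card hcard
    let X : ArrVertex k N := ⟨insert j U, by rw [Finset.card_insert_of_notMem hj, hU]⟩
    have key : A.l j e' • e - A.l j e • e' = 0 := by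
      apply A.eq_zero_of_l X
      intro i hi
      rcases Finset.mem_insert.1 hi with rfl | hi
      · simp only [map_sub, map_smul, smul_eq_mul]; ring
      · simp [he.1 i hi, he'.1 i hi]
    have h0 := congrArg A.f0 key
    simp only [map_sub, map_smul, he.2, he'.2, smul_eq_mul, mul_one, map_zero] at h0
    have hl : A.l j e = A.l j e' := by linarith
    have : e - e' = 0 := by
      apply A.eq_zero_of_l X
      intro i hi
      rcases Finset.mem_insert.1 hi with rfl | hi
      · simp [hl]
      · simp [he.1 i hi, he'.1 i hi]
    exact sub_eq_zero.1 this

theorem edgeVec_spec (U : Finset (Fin N)) (hU : U.card + 1 = k) :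
    (∀ j ∈ U, A.l j (A.edgeVec U) = 0) ∧ A.f0 (A.edgeVec U) = 1 :=
  Classical.epsilon_spec (A.existsUnique_edgeVec U hU).exists

/-- The open cone `C_X^+ = {X + ∑_{j ∈ X} a_j e_{X∖{j}} : a_j > 0}`. -/
def cone (X : ArrVertex k N) : Set (Fin k → ℝ) :=
  {x | ∃ a : Fin N → ℝ, (∀ j ∈ X.1, 0 < a j) ∧
    x = A.point X + ∑ j ∈ X.1, a j • A.edgeVec (X.1.erase j)}

/-- The map `x ↦ X + ρ (x - X)`; it sends `C_X^+` onto the cone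
`C_X^ρ = {X + ρ ∑_{j ∈ X} a_j e_{X∖{j}}} ⊂ ℂ^k`. -/
def rot (X : ArrVertex k N) (ρ : ℂ) (x : Fin k → ℝ) : Fin k → ℂ :=
  fun i => (A.point X i : ℂ) + ρ * ((x i - A.point X i : ℝ) : ℂ)

/-- The sign of `f_j` on `Δ_X`, the arrangement domain (connected component of the complement of
the hyperplanes) that has the vertex `X` in its boundary and on which `f₀ > f₀(X)`:
close to `X` this domain coincides with the cone `C_X^+`. -/
def domainSign (X : ArrVertex k N) (j : Fin N) : ℝ :=
  if j ∈ X.1 then Real.sign (A.l j (A.edgeVec (X.1.erase j))) else Real.sign (A.f j (A.point X))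

/-- The domain `Δ_X`, by the signs of the forms `f_j` on it. -/
def domain (X : ArrVertex k N) : Set (Fin k → ℝ) := {x | ∀ j, 0 < A.domainSign X j * A.f j x}

theorem l_edge_ne (X : ArrVertex k N) {j : Fin N} (hj : j ∈ X.1) :
    A.l j (A.edgeVec (X.1.erase j)) ≠ 0 := by
  intro h0
  have hs := A.edgeVec_spec (X.1.erase j) (by rw [Finset.card_erase_add_one hj, X.2])
  have : A.edgeVec (X.1.erase j) = 0 := by
    apply A.eq_zero_of_l X
    intro i hi
    by_cases hij : i = j
    · rw [hij, h0]
    · exact hs.1 i (Finset.mem_erase.2 ⟨hij, hi⟩)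
  rw [this] at hs
  simp at hs

theorem f_point_ne (X : ArrVertex k N) {j : Fin N} (hj : j ∉ X.1) : A.f j (A.point X) ≠ 0 := by
  intro h0
  refine A.inter_empty (insert j X.1) (by rw [Finset.card_insert_of_notMem hj, X.2])
    ⟨A.point X, fun i hi => ?_⟩
  rcases Finset.mem_insert.1 hi with rfl | hi
  · exact h0
  · exact A.point_spec X hi

theorem l_sum_edge (X : ArrVertex k N) (a : Fin N → ℝ) {i : Fin N} (hi : i ∈ X.1) :
    A.l i (∑ j ∈ X.1, a j • A.edgeVec (X.1.erase j)) =
      a i * A.l i (A.edgeVec (X.1.erase i)) := by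
  rw [map_sum, Finset.sum_eq_single i]
  · simp
  · intro j hj hji
    rw [map_smul, (A.edgeVec_spec (X.1.erase j) (by rw [Finset.card_erase_add_one hj, X.2])).1 i
      (Finset.mem_erase.2 ⟨hji.symm, hi⟩), smul_zero]
  · exact fun h => absurd hi h

theorem f0_sum_edge (X : ArrVertex k N) (a : Fin N → ℝ) :
    A.f0 (∑ j ∈ X.1, a j • A.edgeVec (X.1.erase j)) = ∑ j ∈ X.1, a j := by
  rw [map_sum]
  refine Finset.sum_congr rfl fun j hj => ?_
  rw [map_smul, (A.edgeVec_spec (X.1.erase j) (by rw [Finset.card_erase_add_one hj, X.2])).2]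
  simp

theorem sub_point_eq (X : ArrVertex k N) (x : Fin k → ℝ) :
    x - A.point X = ∑ j ∈ X.1,
      (A.f j x / A.l j (A.edgeVec (X.1.erase j))) • A.edgeVec (X.1.erase j) := by
  rw [← sub_eq_zero]
  apply A.eq_zero_of_l X
  intro i hi
  rw [map_sub, A.l_sum_edge X _ hi, div_mul_cancel₀ _ (A.l_edge_ne X hi),
    A.f_eq i x (A.point X), A.point_spec X hi]
  ring

theorem sign_mul_pos {a b : ℝ} : 0 < Real.sign a * b ↔ 0 < a * b := by
  rcases lt_trichotomy a 0 with h | h | h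
  · rw [Real.sign_of_neg h]
    constructor
    · intro hb; exact mul_pos_of_neg_of_neg h (by linarith)
    · intro hb; by_contra hc; nlinarith [mul_nonneg_of_nonpos_of_nonpos h.le (by linarith : -b ≤ 0)]
  · simp [h]
  · rw [Real.sign_of_pos h, one_mul]
    exact (mul_pos_iff_of_pos_left h).symm

theorem continuous_f (j : Fin N) : Continuous (A.f j) := (A.f j).continuous_of_finiteDimensional

/-- A component of the complement of the hyperplanes is given by the signs of the `f_j`. -/
theorem component_eq (x : Fin k → ℝ) (hx : ∀ j, A.f j x ≠ 0) :
    connectedComponentIn {y | ∀ j, A.f j y ≠ 0} x = {y | ∀ j, 0 < A.f j x * A.f j y} := by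
  apply Set.Subset.antisymm
  · intro y hy j
    by_contra hneg
    have hpre : IsPreconnected (connectedComponentIn {y | ∀ j, A.f j y ≠ 0} x) :=
      isPreconnected_connectedComponentIn
    have hxm := mem_connectedComponentIn (F := {y | ∀ j, A.f j y ≠ 0}) (x := x) hx
    have hc : ContinuousOn (fun y => A.f j x * A.f j y)
        (connectedComponentIn {y | ∀ j, A.f j y ≠ 0} x) :=
      (continuous_const.mul (A.continuous_f j)).continuousOn
    obtain ⟨z, hz, hz0⟩ := hpre.intermediate_value hy hxm hc
      (show (0 : ℝ) ∈ _ from ⟨not_lt.1 hneg, mul_self_nonneg _⟩)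
    have hz1 := connectedComponentIn_subset _ _ hz j
    exact (mul_ne_zero (hx j) hz1) hz0
  · have hconv : Convex ℝ {y | ∀ j, 0 < A.f j x * A.f j y} := by
      intro y hy z hz a b ha hb hab j
      have : A.f j (a • y + b • z) = a * A.f j y + b * A.f j z := by
        rw [Convex.combo_affine_apply hab]; simp
      rw [this]
      have h1 := hy j
      have h2 := hz j
      rcases ha.eq_or_lt with rfl | ha
      · have hb1 : b = 1 := by linarith
        subst hb1; linarith
      · have := mul_pos ha h1
        have := mul_nonneg hb h2.le
        nlinarith
    exact hconv.isPreconnected.subset_connectedComponentIn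
      (fun j => mul_self_pos.2 (hx j)) (fun y hy j => right_ne_zero_of_mul (hy j).ne')

/-- A point close to `X` in the direction `∑ a_j e_{X∖{j}}`: signs of the `f_j`. -/
theorem near_point (X : ArrVertex k N) (a : Fin N → ℝ) :
    ∀ᶠ t : ℝ in 𝓝[>] 0,
      (∀ j ∈ X.1, A.f j (A.point X + t • ∑ i ∈ X.1, a i • A.edgeVec (X.1.erase i)) =
        t * (a j * A.l j (A.edgeVec (X.1.erase j)))) ∧
      (∀ j ∉ X.1, 0 < A.f j (A.point X) *
        A.f j (A.point X + t • ∑ i ∈ X.1, a i • A.edgeVec (X.1.erase i))) := by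
  refine Filter.Eventually.and (Filter.Eventually.of_forall fun t j hj => ?_) ?_
  · rw [A.f_eq j _ (A.point X), A.point_spec X hj, add_sub_cancel_left, map_smul,
      A.l_sum_edge X a hj]
    simp
  · apply nhdsWithin_le_nhds
    refine Filter.eventually_all.2 fun j => ?_
    by_cases hj : j ∈ X.1
    · exact Filter.Eventually.of_forall fun t h => absurd hj h
    · have hc : Continuous fun t : ℝ => A.f j (A.point X) *
          A.f j (A.point X + t • ∑ i ∈ X.1, a i • A.edgeVec (X.1.erase i)) :=
        continuous_const.mul ((A.continuous_f j).comp (by fun_prop))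
      have := hc.continuousAt.eventually_mem (x := 0)
        (isOpen_Ioi.mem_nhds (show (0 : ℝ) < _ by
          simpa using A.f_point_ne X hj))
      exact this.mono fun t ht _ => ht

/-- `domain X` is the only arrangement domain `Δ` with `X` in its boundary on which
`f₀ > f₀(X)`. -/
theorem eq_domain_iff (X : ArrVertex k N) (Δ : Set (Fin k → ℝ)) :
    ((∃ x, (∀ j, A.f j x ≠ 0) ∧ Δ = connectedComponentIn {y | ∀ j, A.f j y ≠ 0} x) ∧
      A.point X ∈ closure Δ ∧ ∀ x ∈ Δ, A.f0 (A.point X) < A.f0 x) ↔ Δ = A.domain X := by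
  have hf0 : ∀ x, A.f0 x - A.f0 (A.point X) =
      ∑ j ∈ X.1, A.f j x / A.l j (A.edgeVec (X.1.erase j)) := fun x => by
    rw [← map_sub, A.sub_point_eq X x, A.f0_sum_edge]
  have hdom : ∀ x, x ∈ A.domain X ↔
      (∀ j ∈ X.1, 0 < A.l j (A.edgeVec (X.1.erase j)) * A.f j x) ∧
      ∀ j ∉ X.1, 0 < A.f j (A.point X) * A.f j x := by
    intro x
    constructor
    · intro h
      refine ⟨fun j hj => ?_, fun j hj => ?_⟩
      · have := h j
        rw [domainSign, if_pos hj, sign_mul_pos] at this; exact this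
      · have := h j
        rw [domainSign, if_neg hj, sign_mul_pos] at this; exact this
    · rintro ⟨h1, h2⟩ j
      rw [domainSign]
      split_ifs with hj
      · exact sign_mul_pos.2 (h1 j hj)
      · exact sign_mul_pos.2 (h2 j hj)
  have hcell : ∀ x ∈ A.domain X, (∀ j, A.f j x ≠ 0) ∧
      connectedComponentIn {y | ∀ j, A.f j y ≠ 0} x = A.domain X := by
    intro x hx
    have hne : ∀ j, A.f j x ≠ 0 := fun j => right_ne_zero_of_mul (hx j).ne'
    refine ⟨hne, ?_⟩
    rw [A.component_eq x hne]
    ext y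
    refine forall_congr' fun j => ?_
    have h1 : 0 < A.domainSign X j * A.f j x := hx j
    constructor
    · intro h2
      have h3 := mul_pos h1 h2
      have : 0 < (A.f j x) ^ 2 * (A.domainSign X j * A.f j y) := by nlinarith
      exact (mul_pos_iff_of_pos_left (by have := hne j; positivity)).1 this
    · intro h2
      have h3 := mul_pos h1 h2
      have : 0 < (A.domainSign X j) ^ 2 * (A.f j x * A.f j y) := by nlinarith
      have h0 : A.domainSign X j ≠ 0 := left_ne_zero_of_mul h1.ne'
      exact (mul_pos_iff_of_pos_left (by positivity)).1 this
  constructor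
  · rintro ⟨⟨x0, hx0, rfl⟩, hcl, hpos⟩
    suffices hmem : x0 ∈ A.domain X from (hcell x0 hmem).2
    rw [A.component_eq x0 hx0] at hcl hpos
    have hout : ∀ j ∉ X.1, 0 < A.f j (A.point X) * A.f j x0 := by
      intro j hj
      have hopen : IsOpen {y | 0 < A.f j (A.point X) * A.f j y} :=
        isOpen_Ioi.preimage (continuous_const.mul (A.continuous_f j))
      obtain ⟨y, hy1, hy2⟩ := mem_closure_iff.1 hcl _ hopen
        (mul_self_pos.2 (A.f_point_ne X hj))
      have h2 : 0 < A.f j x0 * A.f j y := hy2 j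
      have h1 : 0 < A.f j (A.point X) * A.f j y := hy1
      have : 0 < (A.f j y) ^ 2 * (A.f j (A.point X) * A.f j x0) := by
        have := mul_pos h1 h2; nlinarith
      exact (mul_pos_iff_of_pos_left (by
        have := right_ne_zero_of_mul h2.ne'; positivity)).1 this
    refine (hdom x0).2 ⟨fun j hj => ?_, hout⟩
    by_contra hneg
    set b : Fin N → ℝ := fun i => A.f i x0 / A.l i (A.edgeVec (X.1.erase i)) with hb
    have hbj : b j < 0 := by
      have hle := A.l_edge_ne X hj
      have h1 : A.l j (A.edgeVec (X.1.erase j)) * A.f j x0 < 0 :=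
        lt_of_le_of_ne (not_lt.1 hneg) (mul_ne_zero hle (hx0 j))
      have h2 : b j = (A.l j (A.edgeVec (X.1.erase j)) * A.f j x0) /
          (A.l j (A.edgeVec (X.1.erase j))) ^ 2 := by
        simp only [hb]; field_simp
      rw [h2]
      exact div_neg_of_neg_of_pos h1 (by positivity)
    obtain ⟨M, hM1, hM⟩ : ∃ M : ℝ, 1 ≤ M ∧ M * b j + ∑ i ∈ X.1.erase j, b i < 0 := by
      refine ⟨1 + |∑ i ∈ X.1.erase j, b i| / (- b j), ?_, ?_⟩
      · have : 0 ≤ |∑ i ∈ X.1.erase j, b i| / (- b j) :=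
          div_nonneg (abs_nonneg _) (by linarith)
        linarith
      · have h1 : (1 + |∑ i ∈ X.1.erase j, b i| / (- b j)) * b j =
            b j - |∑ i ∈ X.1.erase j, b i| := by
          have hb0 := hbj.ne
          rw [add_mul, one_mul, div_neg, neg_mul, div_mul_cancel₀ _ hb0]; ring
        have := le_abs_self (∑ i ∈ X.1.erase j, b i)
        rw [h1]; linarith
    set a : Fin N → ℝ := fun i => (if i = j then M else 1) * b i with ha
    obtain ⟨t, ⟨h1, h2⟩, ht⟩ :=
      ((A.near_point X a).and self_mem_nhdsWithin).exists
    have ht : 0 < t := ht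
    have hy : A.point X + t • ∑ i ∈ X.1, a i • A.edgeVec (X.1.erase i) ∈
        {y | ∀ j, 0 < A.f j x0 * A.f j y} := by
      intro i
      by_cases hi : i ∈ X.1
      · rw [h1 i hi]
        have hfi : a i * A.l i (A.edgeVec (X.1.erase i)) = (if i = j then M else 1) * A.f i x0 := by
          have := A.l_edge_ne X hi
          simp only [ha, hb]; field_simp
        rw [hfi]
        have hc : 0 < (if i = j then M else 1 : ℝ) := by split_ifs <;> linarith
        have hsq := mul_self_pos.2 (hx0 i)
        have := mul_pos (mul_pos ht hc) hsq
        nlinarith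
      · have h3 := mul_pos (hout i hi) (h2 i hi)
        have : 0 < (A.f i (A.point X)) ^ 2 * (A.f i x0 *
            A.f i (A.point X + t • ∑ i ∈ X.1, a i • A.edgeVec (X.1.erase i))) := by
          nlinarith
        exact (mul_pos_iff_of_pos_left (by have := A.f_point_ne X hi; positivity)).1 this
    have h3 := hpos _ hy
    rw [map_add, map_smul, A.f0_sum_edge, ← Finset.add_sum_erase _ _ hj] at h3
    have h4 : ∑ i ∈ X.1.erase j, a i = ∑ i ∈ X.1.erase j, b i :=
      Finset.sum_congr rfl fun i hi => by simp [ha, Finset.ne_of_mem_erase hi]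
    have h5 : a j = M * b j := by simp [ha]
    rw [h4, h5, smul_eq_mul] at h3
    have := mul_neg_of_pos_of_neg ht hM
    linarith
  · rintro rfl
    have hnear : ∀ᶠ t : ℝ in 𝓝[>] 0,
        A.point X + t • ∑ i ∈ X.1, (1 : ℝ) • A.edgeVec (X.1.erase i) ∈ A.domain X := by
      filter_upwards [A.near_point X (fun _ => 1), self_mem_nhdsWithin] with t h ht
      refine (hdom _).2 ⟨fun j hj => ?_, h.2⟩
      rw [h.1 j hj]
      have ht : 0 < t := ht
      have := mul_pos ht (mul_self_pos.2 (A.l_edge_ne X hj))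
      nlinarith
    refine ⟨?_, ?_, ?_⟩
    · obtain ⟨t, ht⟩ := hnear.exists
      exact ⟨_, (hcell _ ht).1, (hcell _ ht).2.symm⟩
    · refine mem_closure_of_tendsto (f := fun t : ℝ =>
        A.point X + t • ∑ i ∈ X.1, (1 : ℝ) • A.edgeVec (X.1.erase i)) ?_ hnear
      have hc : Continuous fun t : ℝ =>
          A.point X + t • ∑ i ∈ X.1, (1 : ℝ) • A.edgeVec (X.1.erase i) := by fun_prop
      have := (hc.tendsto 0).mono_left (nhdsWithin_le_nhds (s := Set.Ioi 0))
      simpa using this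
    · intro x hx
      have hne : X.1.Nonempty := by
        rw [← Finset.card_pos, X.2]; exact A.one_le
      have := hf0 x
      have hs : 0 < ∑ j ∈ X.1, A.f j x / A.l j (A.edgeVec (X.1.erase j)) := by
        refine Finset.sum_pos (fun j hj => ?_) hne
        have h1 := ((hdom x).1 hx).1 j hj
        have hle := A.l_edge_ne X hj
        have h2 : A.f j x / A.l j (A.edgeVec (X.1.erase j)) =
            (A.l j (A.edgeVec (X.1.erase j)) * A.f j x) /
              (A.l j (A.edgeVec (X.1.erase j))) ^ 2 := by field_simp
        rw [h2]; positivity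
      linarith

/-- The branch of `∏_j |f_j|^{α_j}` that is real positive on `Δ_X`: there
`|f_j| = domainSign X j * f_j`. The principal powers are analytic on the open set of all `z`
for which no `domainSign X j * f_j z` lies in `(-∞, 0]`; this set is star-shaped with respect to
each point of `Δ_X`, does not meet the complex hyperplanes, and contains `Δ_X` and all the cones
`C_X^ρ`, `ρ ∉ ℝ`. So on the cones this is the analytic extension of the real branch on `Δ_X`. -/
def branch (α : Fin N → ℝ) (X : ArrVertex k N) (z : Fin k → ℂ) : ℂ :=
  ∏ j, ((A.domainSign X j : ℂ) * complexifyForm (A.f j) z) ^ (α j : ℂ)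

/-- The open set of `ℂ^k` on which all `domainSign X j * f_j` avoid `(-∞, 0]`. -/
def branchDomain (X : ArrVertex k N) : Set (Fin k → ℂ) :=
  {z | ∀ j, (A.domainSign X j : ℂ) * complexifyForm (A.f j) z ∈ Complex.slitPlane}

theorem complexifyForm_ofReal (g : (Fin k → ℝ) →ᵃ[ℝ] ℝ) (x : Fin k → ℝ) :
    complexifyForm g (fun i => (x i : ℂ)) = (g x : ℂ) := by
  have : (fun i : Fin k => ((x i : ℂ)).im) = 0 := by ext; simp
  simp only [complexifyForm, this, map_zero]
  simp

theorem complexifyForm_eq (g : (Fin k → ℝ) →ᵃ[ℝ] ℝ) (z : Fin k → ℂ) :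
    complexifyForm g z = (g 0 : ℂ) + ∑ i, (g.linear (Pi.single i 1) : ℂ) * z i := by
  have h1 : ∀ v : Fin k → ℝ, g.linear v = ∑ i, g.linear (Pi.single i 1) * v i := by
    intro v
    conv_lhs => rw [← Finset.univ_sum_single v]
    rw [map_sum]
    refine Finset.sum_congr rfl fun i _ => ?_
    rw [mul_comm, ← smul_eq_mul, ← map_smul, ← Pi.single_smul]; simp
  have h2 : ∀ v : Fin k → ℝ, g v = g 0 + g.linear v := by
    intro v
    have := g.linearMap_vsub v 0
    simp only [vsub_eq_sub, sub_zero] at this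
    linarith
  rw [complexifyForm, h2, h1, h1]
  push_cast
  rw [add_assoc, Finset.mul_sum, ← Finset.sum_add_distrib]
  congr 1
  refine Finset.sum_congr rfl fun i _ => ?_
  conv_rhs => rw [← Complex.re_add_im (z i)]
  ring

theorem complexifyForm_rot (X : ArrVertex k N) (ρ : ℂ) (x : Fin k → ℝ) (j : Fin N) :
    complexifyForm (A.f j) (A.rot X ρ x) =
      (A.f j (A.point X) : ℂ) + ρ * (A.l j (x - A.point X) : ℂ) := by
  have h := complexifyForm_eq (A.f j) (A.rot X ρ x)
  have h1 := complexifyForm_eq (A.f j) (fun i => (A.point X i : ℂ))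
  have h2 := complexifyForm_eq (A.f j) (fun i => (x i : ℂ))
  rw [complexifyForm_ofReal] at h1 h2
  have h3 := congrArg (fun r : ℝ => (r : ℂ)) (A.f_eq j x (A.point X))
  push_cast at h3
  rw [h]
  have h4 : (A.l j (x - A.point X) : ℂ) = A.f j x - A.f j (A.point X) := by
    rw [h3]; ring
  rw [h4, h2, h1]
  simp only [rot]
  push_cast
  simp only [mul_add, mul_sub, Finset.sum_add_distrib, Finset.mul_sum, Finset.sum_sub_distrib]
  have : ∀ i, ((A.f j).linear (Pi.single i 1) : ℂ) * (ρ * (x i : ℂ)) =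
      ρ * (((A.f j).linear (Pi.single i 1) : ℂ) * (x i : ℂ)) := fun i => by ring
  have h' : ∀ i, ((A.f j).linear (Pi.single i 1) : ℂ) * (ρ * (A.point X i : ℂ)) =
      ρ * (((A.f j).linear (Pi.single i 1) : ℂ) * (A.point X i : ℂ)) := fun i => by ring
  simp only [this, h']
  ring

/-- `branch` is the analytic extension from `Δ_X` to the cones `C_X^ρ` of the real branch of
`∏_j |f_j|^{α_j}`: it is holomorphic on an open set which is star-shaped about the points of `Δ_X`,
does not meet the complex hyperplanes, contains `Δ_X` and the cones `C_X^ρ`, `ρ ∉ ℝ`, and it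
takes the real values on `Δ_X`. -/
theorem branch_spec (α : Fin N → ℝ) (X : ArrVertex k N) :
    IsOpen (A.branchDomain X) ∧
    (∀ x ∈ A.domain X, StarConvex ℝ (fun i => (x i : ℂ)) (A.branchDomain X)) ∧
    (∀ z ∈ A.branchDomain X, ∀ j, complexifyForm (A.f j) z ≠ 0) ∧
    (∀ x ∈ A.domain X, (fun i => (x i : ℂ)) ∈ A.branchDomain X) ∧
    (∀ ρ : ℂ, ρ.im ≠ 0 → ∀ x ∈ A.cone X, A.rot X ρ x ∈ A.branchDomain X) ∧
    DifferentiableOn ℂ (A.branch α X) (A.branchDomain X) ∧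
    (∀ x ∈ A.domain X, A.branch α X (fun i => (x i : ℂ)) =
      ((∏ j, |A.f j x| ^ α j : ℝ) : ℂ)) := by
  have hdiff : ∀ j, Differentiable ℂ (complexifyForm (A.f j)) := by
    intro j
    rw [show complexifyForm (A.f j) = fun z => _ from funext (complexifyForm_eq (A.f j))]
    fun_prop
  have hreal : ∀ x ∈ A.domain X, ∀ j,
      (A.domainSign X j : ℂ) * complexifyForm (A.f j) (fun i => (x i : ℂ)) =
        ((A.domainSign X j * A.f j x : ℝ) : ℂ) := by
    intro x _ j
    rw [complexifyForm_ofReal]; push_cast; rfl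
  have hsgn : ∀ j, |A.domainSign X j| = 1 := by
    have hs : ∀ a : ℝ, a ≠ 0 → |Real.sign a| = 1 := by
      intro a ha
      rcases lt_or_gt_of_ne ha with h | h
      · simp [Real.sign_of_neg h]
      · simp [Real.sign_of_pos h]
    intro j
    rw [domainSign]
    split_ifs with hj
    · exact hs _ (A.l_edge_ne X hj)
    · exact hs _ (A.f_point_ne X hj)
  have hmem : ∀ x ∈ A.domain X, (fun i => (x i : ℂ)) ∈ A.branchDomain X := by
    intro x hx j
    rw [hreal x hx j]
    exact Complex.ofReal_mem_slitPlane.2 (hx j)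
  refine ⟨?_, ?_, ?_, hmem, ?_, ?_, ?_⟩
  · rw [branchDomain, Set.ofPred_forall]
    exact isOpen_iInter_of_finite fun j => Complex.isOpen_slitPlane.preimage
      (continuous_const.mul (hdiff j).continuous)
  · intro x hx z hz a b ha hb hab j
    have h1 : (A.domainSign X j : ℂ) *
        complexifyForm (A.f j) (a • (fun i => (x i : ℂ)) + b • z) =
        a * ((A.domainSign X j : ℂ) * complexifyForm (A.f j) (fun i => (x i : ℂ))) +
        b * ((A.domainSign X j : ℂ) * complexifyForm (A.f j) z) := by
      have hab' : (a : ℂ) + b = 1 := by exact_mod_cast hab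
      simp only [complexifyForm_eq, Pi.add_apply, Pi.smul_apply, Complex.real_smul, mul_add,
        Finset.sum_add_distrib, Finset.mul_sum]
      have e1 : ∀ i, (A.domainSign X j : ℂ) *
          (((A.f j).linear (Pi.single i 1) : ℂ) * ((a : ℂ) * (x i : ℂ))) =
          (a : ℂ) * ((A.domainSign X j : ℂ) *
          (((A.f j).linear (Pi.single i 1) : ℂ) * (x i : ℂ))) := fun i => by ring
      have e2 : ∀ i, (A.domainSign X j : ℂ) *
          (((A.f j).linear (Pi.single i 1) : ℂ) * ((b : ℂ) * z i)) =
          (b : ℂ) * ((A.domainSign X j : ℂ) *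
          (((A.f j).linear (Pi.single i 1) : ℂ) * z i)) := fun i => by ring
      simp only [e1, e2]
      linear_combination (-((A.domainSign X j : ℂ) * ((A.f j 0 : ℝ) : ℂ))) * hab'
    rw [h1, hreal x hx j]
    have hp := hx j
    have hq := hz j
    rw [Complex.mem_slitPlane_iff] at hq ⊢
    rcases hb.eq_or_lt with rfl | hb
    · left
      have : a = 1 := by linarith
      subst this
      simpa using hp
    · rcases hq with hq | hq
      · left
        have e : ((a : ℂ) * ((A.domainSign X j * A.f j x : ℝ) : ℂ) +
            b * ((A.domainSign X j : ℂ) * complexifyForm (A.f j) z)).re =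
            a * (A.domainSign X j * A.f j x) +
            b * ((A.domainSign X j : ℂ) * complexifyForm (A.f j) z).re := by
          rw [Complex.add_re, Complex.re_ofReal_mul, Complex.re_ofReal_mul, Complex.ofReal_re]
        rw [e]
        have := mul_pos hb hq
        have := mul_nonneg ha hp.le
        linarith
      · right
        have e : ((a : ℂ) * ((A.domainSign X j * A.f j x : ℝ) : ℂ) +
            b * ((A.domainSign X j : ℂ) * complexifyForm (A.f j) z)).im =
            b * ((A.domainSign X j : ℂ) * complexifyForm (A.f j) z).im := by
          rw [Complex.add_im, Complex.im_ofReal_mul, Complex.im_ofReal_mul, Complex.ofReal_im]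
          ring
        rw [e]
        exact mul_ne_zero hb.ne' hq
  · intro z hz j h0
    have := hz j
    rw [h0, mul_zero] at this
    exact Complex.zero_notMem_slitPlane this
  · rintro ρ hρ x ⟨a, ha, rfl⟩ j
    rw [A.complexifyForm_rot, add_sub_cancel_left, Complex.mem_slitPlane_iff]
    by_cases hj : j ∈ X.1
    · right
      rw [A.point_spec X hj, A.l_sum_edge X a hj, domainSign, if_pos hj]
      have h0 : Real.sign (A.l j (A.edgeVec (X.1.erase j))) ≠ 0 := by
        rw [Ne, Real.sign_eq_zero_iff]; exact A.l_edge_ne X hj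
      rw [Complex.im_ofReal_mul, Complex.ofReal_zero, zero_add, Complex.im_mul_ofReal]
      exact mul_ne_zero h0 (mul_ne_zero hρ (mul_ne_zero (ha j hj).ne' (A.l_edge_ne X hj)))
    · set v := A.l j (∑ j ∈ X.1, a j • A.edgeVec (X.1.erase j))
      by_cases hv : v = 0
      · left
        rw [hv, domainSign, if_neg hj]
        simp only [Complex.ofReal_zero, mul_zero, add_zero]
        rw [Complex.re_ofReal_mul, Complex.ofReal_re]
        exact sign_mul_pos.2 (mul_self_pos.2 (A.f_point_ne X hj))
      · right
        rw [Complex.im_ofReal_mul, Complex.add_im, Complex.ofReal_im, zero_add,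
          Complex.im_mul_ofReal]
        refine mul_ne_zero ?_ (mul_ne_zero hρ hv)
        have := hsgn j
        intro h; rw [h] at this; simp at this
  · intro z hz
    refine DifferentiableAt.differentiableWithinAt ?_
    unfold branch
    have hd : ∀ j, DifferentiableAt ℂ (fun z : Fin k → ℂ =>
        ((A.domainSign X j : ℂ) * complexifyForm (A.f j) z) ^ (α j : ℂ)) z := fun j =>
      ((hdiff j z).const_mul (A.domainSign X j : ℂ)).cpow_const (hz j)
    exact (HasFDerivAt.finsetProd (fun j _ => (hd j).hasFDerivAt)).differentiableAt
  · intro x hx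
    unfold branch
    push_cast
    refine Finset.prod_congr rfl fun j _ => ?_
    rw [hreal x hx j, ← Complex.ofReal_cpow (hx j).le]
    congr 2
    have h1 : |A.domainSign X j * A.f j x| = |A.f j x| := by
      rw [abs_mul, hsgn j, one_mul]
    rw [← h1, abs_of_pos (hx j)]

/-- The coefficient of `ω_X = df_{j_1}/f_{j_1} ∧ ⋯ ∧ df_{j_k}/f_{j_k}` with respect to
`dz_1 ∧ ⋯ ∧ dz_k`. Since `j_1, …, j_k` are ordered so that `df_{j_1} ∧ ⋯ ∧ df_{j_k}` is positively
oriented, the determinant of the coefficients of the `df_j` enters by its absolute value. -/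
def omega (X : ArrVertex k N) (z : Fin k → ℂ) : ℂ :=
  ((|(Matrix.of fun a b : Fin k =>
      A.l (X.1.orderEmbOfFin X.2 a) (Pi.single b (1 : ℝ))).det| : ℝ) : ℂ) /
    ∏ j ∈ X.1, complexifyForm (A.f j) z

/-- The integrand of `∫_{C_X^ρ} e^{-λ f₀} Ω_{X'}`, `Ω_{X'} = (∏_j |f_j|^{α_j}) ω_{X'}`, pulled back
to `C_X^+` by `x ↦ X + ρ (x - X)`; the factor `ρ ^ k` is the Jacobian. -/
def integrand (α : Fin N → ℝ) (ρ : ℂ) (X X' : ArrVertex k N) (lam : ℂ) (x : Fin k → ℝ) : ℂ :=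
  Complex.exp (-lam * complexifyForm A.f0.toAffineMap (A.rot X ρ x)) *
    A.branch α X (A.rot X ρ x) * A.omega X' (A.rot X ρ x) * ρ ^ k

/-- `I^ρ_{X,X'}(λ) = ∫_{C_X^ρ} e^{-λ f₀} Ω_{X'}`. -/
def rhoIntegral (α : Fin N → ℝ) (ρ : ℂ) (X X' : ArrVertex k N) (lam : ℂ) : ℂ :=
  ∫ x in A.cone X, A.integrand α ρ X X' lam x

/-- The directions `ρ` used for `I^±_X(λ)`, where `σ = ±1`:
`|ρ| = 1`, `∓ Im ρ > 0` and `Re (ρ λ) > 0`. -/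
def Admissible (σ : ℝ) (lam ρ : ℂ) : Prop :=
  ‖ρ‖ = 1 ∧ σ * ρ.im < 0 ∧ 0 < (ρ * lam).re

/-- `I^±_{X,X'}(λ)` (`σ = ±1`): the common value of the `I^ρ_{X,X'}(λ)` over admissible `ρ`;
as a function of `X'` this is the vector `I^±_X(λ)`. -/
def solution (α : Fin N → ℝ) (σ : ℝ) (X : ArrVertex k N) (lam : ℂ) : ArrVertex k N → ℂ :=
  fun X' => Classical.epsilon fun c : ℂ =>
    ∀ ρ, Admissible σ lam ρ → A.rhoIntegral α ρ X X' lam = c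

/-- The diagonal matrix with entries `f₀(X)`. -/
def matA : Matrix (ArrVertex k N) (ArrVertex k N) ℂ :=
  Matrix.diagonal fun X => (A.f0 (A.point X) : ℂ)

/-- The residue matrix: `α_X` on the diagonal, `sgn (l_j(e_U) l_r(e_U)) α_r` if `U = X ∩ Y` has
`k - 1` elements, `X ∖ Y = {j}` and `Y ∖ X = {r}`, and `0` otherwise. -/
def matB (α : Fin N → ℝ) : Matrix (ArrVertex k N) (ArrVertex k N) ℂ :=
  Matrix.of fun X Y =>
    if X = Y then (weight α X.1 : ℂ)
    else if (X.1 ∩ Y.1).card + 1 = k then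
      ∑ j ∈ X.1 \ Y.1, ∑ r ∈ Y.1 \ X.1,
        ((Real.sign (A.l j (A.edgeVec (X.1 ∩ Y.1)) * A.l r (A.edgeVec (X.1 ∩ Y.1))) * α r : ℝ) : ℂ)
    else 0

/-- `D_{X,X} = ∏_{j∈X} Γ(α_j) · ∏_{j∈X} |l_j(e_{X∖{j}})|^{α_j} · ∏_{j∉X} |f_j(X)|^{α_j}`. -/
def constD (α : Fin N → ℝ) (X : ArrVertex k N) : ℝ :=
  (∏ j ∈ X.1, Real.Gamma (α j)) * (∏ j ∈ X.1, |A.l j (A.edgeVec (X.1.erase j))| ^ α j) *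
    ∏ j ∈ X.1ᶜ, |A.f j (A.point X)| ^ α j

/-- `∏_{j∈X} sgn l_j(e_{X∖{j}})`, the sign of `∏_{j∈X} f_j` on `C_X^+`, i.e. the sign of the form
`ω_X` there. -/
def coneSign (X : ArrVertex k N) : ℝ :=
  ∏ j ∈ X.1, Real.sign (A.l j (A.edgeVec (X.1.erase j)))

end GenericArrangement

/-- For `σ = ±1`: `ℂ ∖ i ℝ_∓`, the plane cut along the closed imaginary half-axis. -/
def slitDomain (σ : ℝ) : Set ℂ := {lam | ¬ (lam.re = 0 ∧ σ * lam.im ≤ 0)}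

/-- For `σ = ±1`: the sector `S_± = {ε - π/2 < ± arg λ < 3π/2 - ε}`. -/
def stokesSector (σ ε : ℝ) : Set ℂ :=
  {lam | ∃ r θ : ℝ, 0 < r ∧ ε - Real.pi / 2 < σ * θ ∧ σ * θ < 3 * Real.pi / 2 - ε ∧
    lam = r * Complex.exp (θ * Complex.I)}

/-- For `σ = ±1`: the branch of the logarithm on `ℂ ∖ i ℝ_∓` with
`-π/2 < ± arg λ < 3π/2`. -/
def sectorLog (σ : ℝ) (lam : ℂ) : ℂ :=
  Complex.log (-(σ * Complex.I * lam)) + σ * (Real.pi / 2) * Complex.I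

/-- The power `λ^s` defined with this branch of the logarithm. -/
def sectorPow (σ : ℝ) (lam s : ℂ) : ℂ := Complex.exp (s * sectorLog σ lam)

end

/-! In the coordinates x = X + ∑ a_m e_m of the cone, each f_j with j ∈ X depends on a single a_m
and becomes a positive multiple of a_m ρ, up to the sign of f_j on Δ_X. Each other f_j becomes q_j +
ρ ∑ b_{j,m} a_m with q_j = |f_j(X)| > 0, up to sign. For nonreal ρ this never meets (-∞, 0], so
principal powers suffice, and the integral is of Laplace type over the positive orthant
(`laplaceCore`). Its modulus is bounded below by q_j times the sine of the angle of ρ with the real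
axis, independently of a and of the size of ρ. This yields absolute convergence, holomorphy in the
parameters and the passage to the limit (`exists_norm_laplaceCore_le`).

(a) No contour is deformed. The integral makes sense for every nonreal ρ with Re(λρ) > 0, not only
for |ρ| = 1. Rescaling a shows that it is constant along rays in ρ, and it is holomorphic in ρ. On a
convex cone of directions it is therefore constant (`coneIntegral_eq`).

(b) Differentiation in λ brings down -f₀. Writing f₀ = f₀(X') + ∑_{j ∈ X'} f_j / l_j(e_{X'∖{j}}),
the constant gives the matrix 𝒜, and each other term cancels one factor f_j in the denominator of
the form of X'. What remains is an integral attached to U = X'∖{j}. Since f₀ has derivative 1 along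
e_U and the f_i with i ∈ U have derivative 0, integration by parts along e_U
(`coneIntegral_by_parts`) expresses λ times this integral through the vertices U ∪ {r}. The
determinants and signs combine into the entries of ℬ (`exchange_coefficient`).

(c) Let 2ψ be the angle of λ from the middle of the sector. The choice ρ = -σ i e^{-iψ} gives λρ =
|λ| e^{iψ}, so one lower bound for cos ψ controls both Re(λρ) and the distance of ρ from the real
axis, uniformly in the sector. Replacing ρ by ρ/|λ|, the outer forms tend to their values q_j and a
product of Gamma integrals remains (`tendsto_integral_laplaceCore`). For X' ≠ X there is an extra
factor |λ|^{-|X∖X'|}, which makes the component negligible. -/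

open scoped Pointwise

noncomputable section

/-! ### Tools from complex analysis -/

/-- A holomorphic family of functions that is locally dominated by an integrable function may be
differentiated under the integral sign. -/
theorem hasDerivAt_integral_of_dominated_holomorphic {E : Type*} [MeasurableSpace E]
    {ν : Measure E} {F : ℂ → E → ℂ} {z₀ : ℂ} {r : ℝ} (hr : 0 < r) {bound : E → ℝ}
    (hmeas : ∀ z ∈ Metric.ball z₀ r, AEStronglyMeasurable (F z) ν)
    (hdiff : ∀ᵐ a ∂ν, DifferentiableOn ℂ (fun z => F z a) (Metric.ball z₀ r))
    (hbound : ∀ᵐ a ∂ν, ∀ z ∈ Metric.ball z₀ r, ‖F z a‖ ≤ bound a)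
    (hint : Integrable bound ν) :
    HasDerivAt (fun z => ∫ a, F z a ∂ν) (∫ a, deriv (fun z => F z a) z₀ ∂ν) z₀ := by
  have hmem : z₀ ∈ Metric.ball z₀ r := Metric.mem_ball_self hr
  -- The derivative is measurable as a pointwise limit of difference quotients along a sequence that
  -- tends to z₀ inside the ball.
  have hmeas' : AEStronglyMeasurable (fun a => deriv (fun z => F z a) z₀) ν := by
    have hu : Tendsto (fun n : ℕ => z₀ + ((r / 2 / (n + 1) : ℝ) : ℂ)) atTop (𝓝[≠] z₀) := by
      refine tendsto_nhdsWithin_iff.2 ⟨?_, Eventually.of_forall fun n => ?_⟩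
      · have h1 : Tendsto (fun n : ℕ => (r / 2 / (n + 1) : ℝ)) atTop (𝓝 0) := by
          have := (tendsto_one_div_add_atTop_nhds_zero_nat (𝕜 := ℝ)).const_mul (r / 2)
          simpa [div_eq_mul_inv] using this
        have h2 := (Complex.continuous_ofReal.tendsto 0).comp h1
        simpa using h2.const_add z₀
      · have : (0 : ℝ) < r / 2 / (n + 1) := by positivity
        simp only [Set.mem_compl_iff, Set.mem_singleton_iff, add_eq_left]
        exact_mod_cast this.ne'
    have hball : ∀ n : ℕ, z₀ + ((r / 2 / (n + 1) : ℝ) : ℂ) ∈ Metric.ball z₀ r := by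
      intro n
      have h0 : (0 : ℝ) < r / 2 / (n + 1) := by positivity
      have h1 : r / 2 / (n + 1 : ℝ) ≤ r / 2 :=
        div_le_self (by positivity) (by linarith [n.cast_nonneg (α := ℝ)])
      rw [mem_ball_iff_norm, add_sub_cancel_left, Complex.norm_real, Real.norm_of_nonneg h0.le]
      linarith
    refine aestronglyMeasurable_of_tendsto_ae atTop
      (f := fun (n : ℕ) a => slope (fun z => F z a) z₀ (z₀ + ((r / 2 / (n + 1) : ℝ) : ℂ)))
      (fun n => ?_) ?_
    · simp only [slope, vsub_eq_sub, smul_eq_mul]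
      exact ((hmeas _ (hball n)).sub (hmeas _ hmem)).const_mul _
    · filter_upwards [hdiff] with a ha
      have := ((ha.differentiableAt (Metric.isOpen_ball.mem_nhds hmem)).hasDerivAt)
      exact (hasDerivAt_iff_tendsto_slope.1 this).comp hu
  -- On the ball of half the radius, Cauchy's estimate on circles of radius r/4 bounds the
  -- derivative by `bound a / (r / 4)`.
  refine (hasDerivAt_integral_of_dominated_loc_of_deriv_le (s := Metric.ball z₀ (r / 2))
    (bound := fun a => bound a / (r / 4)) (F' := fun z a => deriv (fun z => F z a) z)
    (Metric.ball_mem_nhds _ (by positivity))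
    ?_ ?_ hmeas' ?_ (hint.div_const _) ?_).2
  · filter_upwards [Metric.ball_mem_nhds z₀ hr] with z hz using hmeas z hz
  · exact hint.mono' (hmeas _ hmem) (hbound.mono fun a ha => ha _ hmem)
  · filter_upwards [hdiff, hbound] with a ha hb z hz
    have hsub : Metric.closedBall z (r / 4) ⊆ Metric.ball z₀ r := by
      intro w hw
      rw [Metric.mem_closedBall] at hw
      rw [Metric.mem_ball] at hz ⊢
      linarith [dist_triangle w z z₀]
    refine Complex.norm_deriv_le_of_forall_mem_sphere_norm_le (by positivity) ?_
      fun w hw => hb w (hsub (Metric.sphere_subset_closedBall hw))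
    refine DifferentiableOn.diffContOnCl ?_
    rw [closure_ball _ (by positivity)]
    exact ha.mono hsub
  · filter_upwards [hdiff] with a ha z hz
    exact (ha.differentiableAt (Metric.isOpen_ball.mem_nhds
      (Metric.ball_subset_ball (by linarith) hz))).hasDerivAt

/-- A holomorphic function on a convex open set of `ℂ ∖ {0}` that is constant along rays is
constant. -/
theorem eq_of_differentiableOn_of_homogeneous {U : Set ℂ} (hU : IsOpen U) (hconv : Convex ℝ U)
    (h0 : (0 : ℂ) ∉ U) {F : ℂ → ℂ} (hF : DifferentiableOn ℂ F U)
    (hhom : ∀ z ∈ U, ∀ t : ℝ, 0 < t → F (t * z) = F z) {z w : ℂ} (hz : z ∈ U) (hw : w ∈ U) :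
    F z = F w := by
  refine hU.is_const_of_deriv_eq_zero hconv.isPreconnected hF (fun z hz => ?_) hz hw
  have hd : HasDerivAt F (deriv F z) (((1 : ℝ) : ℂ) * z) := by
    simpa using (hF.differentiableAt (hU.mem_nhds hz)).hasDerivAt
  have h1 : HasDerivAt (fun t : ℝ => (t : ℂ) * z) z 1 := by
    simpa using (Complex.ofRealCLM.hasDerivAt (x := (1 : ℝ))).mul_const z
  -- The derivative along the ray through z, taken at t = 1, is F'(z) z; constancy along the ray
  -- makes it zero.
  have h2 : HasDerivAt (fun t : ℝ => F ((t : ℂ) * z)) (deriv F z * z) 1 :=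
    hd.comp 1 h1
  have h3 : HasDerivAt (fun t : ℝ => F ((t : ℂ) * z)) 0 1 := by
    refine (hasDerivAt_const (1 : ℝ) (F z)).congr_of_eventuallyEq ?_
    filter_upwards [lt_mem_nhds zero_lt_one] with t ht using hhom z hz t ht
  have h4 := h2.unique h3
  have hz0 : z ≠ 0 := fun h => h0 (h ▸ hz)
  simpa [hz0] using h4

/-! ### Integration over the positive orthant -/

/-- The open positive orthant of `ℝ^k`. -/
def posOrthant (k : ℕ) : Set (Fin k → ℝ) := {a | ∀ m, 0 < a m}

theorem posOrthant_eq_pi (k : ℕ) : posOrthant k = Set.univ.pi fun _ => Set.Ioi 0 := by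
  ext; simp [posOrthant]

theorem isOpen_posOrthant (k : ℕ) : IsOpen (posOrthant k) := by
  rw [posOrthant_eq_pi]; exact isOpen_set_pi Set.finite_univ fun _ _ => isOpen_Ioi

theorem measurableSet_posOrthant (k : ℕ) : MeasurableSet (posOrthant k) :=
  (isOpen_posOrthant k).measurableSet

theorem volume_restrict_posOrthant (k : ℕ) : (volume : Measure (Fin k → ℝ)).restrict (posOrthant k) =
    Measure.pi fun _ => volume.restrict (Set.Ioi 0) := by
  rw [posOrthant_eq_pi, volume_pi, Measure.restrict_pi_pi]

theorem insertNth_mem_posOrthant {n : ℕ} (m : Fin (n + 1)) (t : ℝ) (y : Fin n → ℝ) :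
    m.insertNth (α := fun _ => ℝ) t y ∈ posOrthant (n + 1) ↔ 0 < t ∧ y ∈ posOrthant n := by
  simp [posOrthant, Fin.forall_iff_succAbove m]

/-- The integral over the orthant of a partial derivative vanishes for a function that vanishes
on the corresponding face and is integrable together with this partial derivative. -/
theorem setIntegral_posOrthant_partialDeriv_eq_zero {k : ℕ} (m : Fin k)
    {G G' : (Fin k → ℝ) → ℂ} (hG : IntegrableOn G (posOrthant k))
    (hG' : IntegrableOn G' (posOrthant k))
    (hderiv : ∀ a ∈ posOrthant k, HasDerivAt (fun t => G (Function.update a m t)) (G' a) (a m))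
    (hzero : ∀ a ∈ posOrthant k, Tendsto (fun t => G (Function.update a m t)) (𝓝[>] 0) (𝓝 0)) :
    ∫ a in posOrthant k, G' a = 0 := by
  obtain ⟨n, rfl⟩ : ∃ n, k = n + 1 := ⟨k - 1, by have := m.2; omega⟩
  let e := (MeasurableEquiv.piFinSuccAbove (fun _ : Fin (n + 1) => ℝ) m).symm
  have he : ∀ p : ℝ × (Fin n → ℝ), e p = m.insertNth (α := fun _ => ℝ) p.1 p.2 := fun p => rfl
  have hpres : MeasurePreserving e ((volume : Measure ℝ).prod (volume : Measure (Fin n → ℝ)))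
      volume := (volume_preserving_piFinSuccAbove (fun _ : Fin (n + 1) => ℝ) m).symm _
  have hpre : e ⁻¹' posOrthant (n + 1) = Set.Ioi 0 ×ˢ posOrthant n := by
    ext p
    rw [Set.mem_preimage, he, insertNth_mem_posOrthant]; rfl
  have hres := hpres.restrict_preimage (measurableSet_posOrthant (n + 1))
  rw [hpre, ← Measure.prod_restrict] at hres
  have hi : ∀ H : (Fin (n + 1) → ℝ) → ℂ, IntegrableOn H (posOrthant (n + 1)) →
      Integrable (fun p => H (e p)) (((volume : Measure ℝ).restrict (Set.Ioi 0)).prod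
        ((volume : Measure (Fin n → ℝ)).restrict (posOrthant n))) := fun H hH =>
    (hres.integrable_comp_emb e.measurableEmbedding).2 hH
  have hGi := (hi G hG).prod_left_ae
  have hGi' := (hi G' hG').prod_left_ae
  rw [← hres.integral_comp e.measurableEmbedding, integral_prod_symm _ (hi G' hG')]
  refine integral_eq_zero_of_ae ?_
  filter_upwards [hGi, hGi', ae_restrict_mem (measurableSet_posOrthant n)] with y h1 h2 hy
  simp only [he] at h1 h2 ⊢
  have hupd : ∀ s t : ℝ, Function.update (m.insertNth (α := fun _ => ℝ) s y) m t =
      m.insertNth (α := fun _ => ℝ) t y := fun s t => Fin.update_insertNth (α := fun _ => ℝ) m s t y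
  have hd : ∀ t ∈ Set.Ioi (0 : ℝ), HasDerivAt (fun t => G (m.insertNth (α := fun _ => ℝ) t y))
      (G' (m.insertNth (α := fun _ => ℝ) t y)) t := by
    intro t ht
    have := hderiv _ ((insertNth_mem_posOrthant m t y).2 ⟨ht, hy⟩)
    simpa only [hupd, Fin.insertNth_apply_same] using this
  have hz : Tendsto (fun t => G (m.insertNth (α := fun _ => ℝ) t y)) (𝓝[>] 0) (𝓝 0) := by
    have := hzero _ ((insertNth_mem_posOrthant m 1 y).2 ⟨one_pos, hy⟩)
    simpa only [hupd] using this
  -- An integrable function with integrable derivative tends to zero at infinity, so there is no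
  -- boundary term there.
  have hinf := tendsto_zero_of_hasDerivAt_of_integrableOn_Ioi hd h2 h1
  -- Only the one-sided limit at 0 is known; the value at 0 is reset to that limit to obtain
  -- continuity at the closed end.
  set g : ℝ → ℂ := Function.update (fun t => G (m.insertNth (α := fun _ => ℝ) t y)) 0 0 with hg
  have hge : ∀ t ∈ Set.Ioi (0 : ℝ), g =ᶠ[𝓝 t] fun t => G (m.insertNth (α := fun _ => ℝ) t y) := by
    intro t ht
    filter_upwards [isOpen_ne.mem_nhds (Set.mem_Ioi.1 ht).ne'] with s hs
    exact Function.update_of_ne hs _ _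
  have := integral_Ioi_of_hasDerivAt_of_tendsto (f := g) (m := 0) (a := 0) ?_
    (fun t ht => (hd t ht).congr_of_eventuallyEq (hge t ht)) h2
    (hinf.congr' ?_)
  · simpa [hg] using this
  · rw [hg, continuousWithinAt_update_same]
    refine hz.mono_left (nhdsWithin_mono _ ?_)
    intro t ht
    exact lt_of_le_of_ne ht.1 (Ne.symm ht.2)
  · filter_upwards [eventually_gt_atTop 0] with t ht
    exact ((hge t ht).eq_of_nhds).symm

/-! ### Laplace-type integrals on the orthant: bounds, holomorphy, homogeneity -/

/-- The affine form `q_i + ρ ∑_m b_{i,m} a_m`. -/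
def outerForm {ι : Type*} {k : ℕ} (q : ι → ℝ) (b : ι → Fin k → ℝ) (ρ : ℂ) (a : Fin k → ℝ) (i : ι) :
    ℂ := (q i : ℂ) + ρ * ((∑ m, b i m * a m : ℝ) : ℂ)

/-- The function `∏_m a_m^{γ_m} e^{-μ ∑ a_m} ∏_{i ∈ S} (q_i + ρ ∑_m b_{i,m} a_m)^{β_i}` on the
positive orthant. -/
def laplaceCore {ι : Type*} {k : ℕ} (S : Finset ι) (q : ι → ℝ) (b : ι → Fin k → ℝ)
    (γ : Fin k → ℝ) (β : ι → ℝ) (μ ρ : ℂ) (a : Fin k → ℝ) : ℂ :=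
  ((∏ m, a m ^ γ m : ℝ) : ℂ) * Complex.exp (-μ * ((∑ m, a m : ℝ) : ℂ)) *
    ∏ i ∈ S, outerForm q b ρ a i ^ (β i : ℂ)

section

variable {ι : Type*} {k : ℕ} {S : Finset ι} {q : ι → ℝ} {b : ι → Fin k → ℝ}
  {γ : Fin k → ℝ} {β : ι → ℝ}

/-- A nonreal ρ moves the value off the real axis unless the linear part vanishes, and then the
value is q_i > 0. Principal powers are thus holomorphic on all the cones. -/
theorem outerForm_mem_slitPlane {ρ : ℂ} {i : ι} (hq : 0 < q i) (hρ : ρ.im ≠ 0) (a : Fin k → ℝ) :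
    outerForm q b ρ a i ∈ Complex.slitPlane := by
  rw [Complex.mem_slitPlane_iff, outerForm]
  rcases eq_or_ne (∑ m, b i m * a m) 0 with h | h
  · left; simpa [h] using hq
  · right
    rw [Complex.add_im, Complex.ofReal_im, zero_add, Complex.im_mul_ofReal]
    exact mul_ne_zero hρ h

/-- Multiplication by the conjugate of ρ makes the linear part real, so the imaginary part of the
product is -q_i Im ρ for every a. The bound involves only the angle of ρ with the real axis and
survives the limit ρ → 0. -/
theorem le_norm_outerForm {ρ : ℂ} {i : ι} {δ : ℝ} (hq : 0 ≤ q i) (hρ : ρ ≠ 0)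
    (hδ : δ * ‖ρ‖ ≤ |ρ.im|) (a : Fin k → ℝ) : q i * δ ≤ ‖outerForm q b ρ a i‖ := by
  have h1 : (outerForm q b ρ a i * (starRingEnd ℂ) ρ).im = -(q i * ρ.im) := by
    simp [outerForm]; ring
  have h2 := Complex.abs_im_le_norm (outerForm q b ρ a i * (starRingEnd ℂ) ρ)
  rw [h1, abs_neg, abs_mul, abs_of_nonneg hq, norm_mul, RCLike.norm_conj] at h2
  have h3 : 0 < ‖ρ‖ := norm_pos_iff.2 hρ
  refine le_of_mul_le_mul_right ?_ h3
  calc q i * δ * ‖ρ‖ = q i * (δ * ‖ρ‖) := by ring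
    _ ≤ q i * |ρ.im| := mul_le_mul_of_nonneg_left hδ hq
    _ ≤ _ := h2

theorem norm_outerForm_le {ρ : ℂ} {i : ι} {R : ℝ} (hq : 0 ≤ q i) (hR : ‖ρ‖ ≤ R)
    {a : Fin k → ℝ} (ha : ∀ m, 0 ≤ a m) :
    ‖outerForm q b ρ a i‖ ≤ q i + R * (∑ m, |b i m|) * ∑ m, a m := by
  have h1 : |∑ m, b i m * a m| ≤ (∑ m, |b i m|) * ∑ m, a m := by
    refine (Finset.abs_sum_le_sum_abs _ _).trans ?_
    rw [Finset.sum_mul]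
    refine Finset.sum_le_sum fun m _ => ?_
    rw [abs_mul, abs_of_nonneg (ha m)]
    exact mul_le_mul_of_nonneg_left
      (Finset.single_le_sum (fun m _ => ha m) (Finset.mem_univ m)) (abs_nonneg _)
  have hR0 : 0 ≤ R := (norm_nonneg _).trans hR
  refine (norm_add_le _ _).trans ?_
  rw [norm_mul, Complex.norm_real, Complex.norm_real, Real.norm_of_nonneg hq, Real.norm_eq_abs,
    mul_assoc]
  gcongr

/-- Linear growth is absorbed by an arbitrarily small exponential when p ≥ 0; for p < 0 the lower
bound κ makes the power bounded. -/
theorem exists_rpow_le_mul_exp {κ A B η : ℝ} (hκ : 0 < κ) (hA : 0 < A) (hB : 0 ≤ B) (hη : 0 < η)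
    (p : ℝ) : ∃ C, 0 < C ∧ ∀ σ x : ℝ, 0 ≤ σ → κ ≤ x → x ≤ A + B * σ → x ^ p ≤ C * Real.exp (η * σ) := by
  rcases le_or_gt 0 p with hp | hp
  -- Any θ > 0 with p θ ≤ η works; the denominator p + 1 also covers p = 0.
  · set θ := η / (p + 1) with hθ
    have hθ0 : 0 < θ := by positivity
    have hpθ : p * θ ≤ η := by
      rw [hθ, mul_div_assoc', div_le_iff₀ (by positivity)]; nlinarith
    refine ⟨(A + B / θ) ^ p, by positivity, fun σ x hσ hx hxle => ?_⟩
    have h1 : x ≤ (A + B / θ) * Real.exp (θ * σ) := by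
      have h2 := Real.add_one_le_exp (θ * σ)
      have h3 : (1 : ℝ) ≤ Real.exp (θ * σ) := Real.one_le_exp (by positivity)
      have h4 : B * σ = B / θ * (θ * σ) := by field_simp
      have h5 : 0 ≤ B / θ := by positivity
      rw [add_mul]
      nlinarith
    calc x ^ p ≤ ((A + B / θ) * Real.exp (θ * σ)) ^ p :=
          Real.rpow_le_rpow (hκ.le.trans hx) h1 hp
      _ = (A + B / θ) ^ p * Real.exp (p * θ * σ) := by
          rw [Real.mul_rpow (by positivity) (Real.exp_pos _).le, ← Real.exp_mul]; ring_nf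
      _ ≤ _ := by gcongr
  · refine ⟨κ ^ p, by positivity, fun σ x hσ hx _ => ?_⟩
    have h1 : x ^ p ≤ κ ^ p := Real.rpow_le_rpow_of_nonpos hκ hx hp.le
    have h2 : (1 : ℝ) ≤ Real.exp (η * σ) := Real.one_le_exp (by positivity)
    have : 0 < κ ^ p := by positivity
    nlinarith

theorem integrableOn_prod_rpow_mul_exp (hγ : ∀ m, -1 < γ m) {s : ℝ} (hs : 0 < s) :
    IntegrableOn (fun a : Fin k → ℝ => ∏ m, (a m ^ γ m * Real.exp (-s * a m))) (posOrthant k) := by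
  rw [IntegrableOn, volume_restrict_posOrthant]
  refine Integrable.fintype_prod_dep (f := fun m (t : ℝ) => t ^ γ m * Real.exp (-s * t)) fun m => ?_
  have := integrableOn_rpow_mul_exp_neg_mul_rpow (hγ m) one_pos hs
  simpa only [Real.rpow_one, IntegrableOn] using this

theorem norm_laplaceCore {μ ρ : ℂ} {a : Fin k → ℝ} (ha : a ∈ posOrthant k) :
    ‖laplaceCore S q b γ β μ ρ a‖ = (∏ m, a m ^ γ m) * Real.exp (-μ.re * ∑ m, a m) *
      ∏ i ∈ S, ‖outerForm q b ρ a i‖ ^ β i := by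
  rw [laplaceCore, norm_mul, norm_mul, Complex.norm_real, Complex.norm_exp,
    norm_prod S, Real.norm_of_nonneg (Finset.prod_nonneg fun m _ => Real.rpow_nonneg (ha m).le _)]
  simp only [Complex.norm_cpow_real, Complex.re_mul_ofReal, Complex.neg_re]

/-- A uniform bound for `laplaceCore`. -/
theorem exists_norm_laplaceCore_le (hq : ∀ i ∈ S, 0 < q i) {s δ R : ℝ} (hs : 0 < s) (hδ : 0 < δ)
    (hR : 0 ≤ R) (γ : Fin k → ℝ) (β : ι → ℝ) :
    ∃ C, 0 < C ∧ ∀ μ ρ : ℂ, s ≤ μ.re → ρ ≠ 0 → ‖ρ‖ ≤ R → δ * ‖ρ‖ ≤ |ρ.im| → ∀ a ∈ posOrthant k,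
      ‖laplaceCore S q b γ β μ ρ a‖ ≤ C * ∏ m, (a m ^ γ m * Real.exp (-(s / 2) * a m)) := by
  -- All outer factors together may use up half of the decay rate s; the added 1 covers an empty S.
  set η := s / 2 / (S.card + 1) with hη
  have hη0 : 0 < η := by positivity
  have hex : ∀ i, ∃ C, 0 < C ∧ (i ∈ S → ∀ σ x : ℝ, 0 ≤ σ → q i * δ ≤ x →
      x ≤ q i + R * (∑ m, |b i m|) * σ → x ^ β i ≤ C * Real.exp (η * σ)) := by
    intro i
    by_cases hi : i ∈ S
    · obtain ⟨C, hC, h⟩ := exists_rpow_le_mul_exp (mul_pos (hq i hi) hδ) (hq i hi)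
        (mul_nonneg hR (Finset.sum_nonneg fun m _ => abs_nonneg (b i m))) hη0 (β i)
      exact ⟨C, hC, fun _ => h⟩
    · exact ⟨1, one_pos, fun h => absurd h hi⟩
  choose C hC hCb using hex
  refine ⟨∏ i ∈ S, C i, Finset.prod_pos fun i _ => hC i, fun μ ρ hμ hρ hρR hρδ a ha => ?_⟩
  have hσ : 0 ≤ ∑ m, a m := Finset.sum_nonneg fun m _ => (ha m).le
  have h1 : ∏ i ∈ S, ‖outerForm q b ρ a i‖ ^ β i ≤ (∏ i ∈ S, C i) * Real.exp (s / 2 * ∑ m, a m) := by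
    calc ∏ i ∈ S, ‖outerForm q b ρ a i‖ ^ β i ≤ ∏ i ∈ S, (C i * Real.exp (η * ∑ m, a m)) := by
          refine Finset.prod_le_prod (fun i _ => Real.rpow_nonneg (norm_nonneg _) _) fun i hi => ?_
          exact hCb i hi _ _ hσ (le_norm_outerForm (hq i hi).le hρ hρδ a)
            (norm_outerForm_le (hq i hi).le hρR fun m => (ha m).le)
      _ = (∏ i ∈ S, C i) * Real.exp (S.card * η * ∑ m, a m) := by
          rw [Finset.prod_mul_distrib, Finset.prod_const, ← Real.exp_nat_mul]; ring_nf
      _ ≤ _ := by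
          have : S.card * η ≤ s / 2 := by
            rw [hη, mul_div_assoc', div_le_iff₀ (by positivity)]; nlinarith
          have hp : 0 < ∏ i ∈ S, C i := Finset.prod_pos fun i _ => hC i
          gcongr
  have hprod : 0 ≤ ∏ m, a m ^ γ m := Finset.prod_nonneg fun m _ => Real.rpow_nonneg (ha m).le _
  rw [norm_laplaceCore ha, Finset.prod_mul_distrib, ← Real.exp_sum, ← Finset.mul_sum]
  calc _ ≤ (∏ m, a m ^ γ m) * Real.exp (-s * ∑ m, a m) *
        ((∏ i ∈ S, C i) * Real.exp (s / 2 * ∑ m, a m)) := by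
        gcongr
    _ = (∏ i ∈ S, C i) * ((∏ m, a m ^ γ m) *
          (Real.exp (-s * ∑ m, a m) * Real.exp (s / 2 * ∑ m, a m))) := by ring
    _ = _ := by rw [← Real.exp_add]; ring_nf

theorem continuous_outerForm (ρ : ℂ) (i : ι) : Continuous fun a => outerForm q b ρ a i := by
  unfold outerForm; fun_prop

theorem continuousOn_laplaceCore (hq : ∀ i ∈ S, 0 < q i) (μ : ℂ) {ρ : ℂ} (hρ : ρ.im ≠ 0) :
    ContinuousOn (laplaceCore S q b γ β μ ρ) (posOrthant k) := by
  unfold laplaceCore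
  refine ContinuousOn.mul (ContinuousOn.mul ?_ ?_) ?_
  · refine Complex.continuous_ofReal.comp_continuousOn (continuousOn_finsetProd _ fun m _ => ?_)
    exact (continuous_apply m).continuousOn.rpow_const fun a ha => Or.inl (ha m).ne'
  · fun_prop
  · exact continuousOn_finsetProd _ fun i hi =>
      (continuous_outerForm ρ i).continuousOn.cpow_const fun a _ =>
        outerForm_mem_slitPlane (hq i hi) hρ a

theorem aestronglyMeasurable_laplaceCore (hq : ∀ i ∈ S, 0 < q i) (μ : ℂ) {ρ : ℂ} (hρ : ρ.im ≠ 0) :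
    AEStronglyMeasurable (laplaceCore S q b γ β μ ρ) (volume.restrict (posOrthant k)) :=
  (continuousOn_laplaceCore hq μ hρ).aestronglyMeasurable (measurableSet_posOrthant k)

theorem integrableOn_laplaceCore (hq : ∀ i ∈ S, 0 < q i) (hγ : ∀ m, -1 < γ m) {μ ρ : ℂ}
    (hμ : 0 < μ.re) (hρ : ρ.im ≠ 0) :
    IntegrableOn (laplaceCore S q b γ β μ ρ) (posOrthant k) := by
  have hρ0 : ρ ≠ 0 := by rintro rfl; simp at hρ
  have hn : 0 < ‖ρ‖ := norm_pos_iff.2 hρ0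
  obtain ⟨C, hC, h⟩ := exists_norm_laplaceCore_le (b := b) hq hμ
    (div_pos (abs_pos.2 hρ) hn) hn.le γ β
  refine ((integrableOn_prod_rpow_mul_exp hγ (half_pos hμ)).const_mul C).mono'
    (aestronglyMeasurable_laplaceCore hq μ hρ) ?_
  filter_upwards [ae_restrict_mem (measurableSet_posOrthant k)] with a ha
  exact h μ ρ le_rfl hρ0 le_rfl (div_mul_cancel₀ _ hn.ne').le a ha

theorem differentiableAt_laplaceCore (hq : ∀ i ∈ S, 0 < q i) {u v : ℂ → ℂ} {z : ℂ}
    (hu : DifferentiableAt ℂ u z) (hv : DifferentiableAt ℂ v z) (hz : (v z).im ≠ 0)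
    (a : Fin k → ℝ) : DifferentiableAt ℂ (fun z => laplaceCore S q b γ β (u z) (v z) a) z := by
  unfold laplaceCore
  refine ((differentiableAt_const _).mul (by fun_prop)).mul ?_
  refine DifferentiableAt.fun_finsetProd fun i hi => ?_
  have hd : DifferentiableAt ℂ (fun z => outerForm q b (v z) a i) z := by
    unfold outerForm; fun_prop
  exact hd.cpow_const (outerForm_mem_slitPlane (hq i hi) hz a)

/-- The integral of `laplaceCore` depends holomorphically on the parameters. -/
theorem hasDerivAt_integral_laplaceCore (hq : ∀ i ∈ S, 0 < q i) (hγ : ∀ m, -1 < γ m)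
    {u v : ℂ → ℂ} {z₀ : ℂ} (hu : Differentiable ℂ u) (hv : Differentiable ℂ v)
    (hu0 : 0 < (u z₀).re) (hv0 : (v z₀).im ≠ 0) :
    HasDerivAt (fun z => ∫ a in posOrthant k, laplaceCore S q b γ β (u z) (v z) a)
      (∫ a in posOrthant k, deriv (fun z => laplaceCore S q b γ β (u z) (v z) a) z₀) z₀ := by
  have hv0' : v z₀ ≠ 0 := by intro h; simp [h] at hv0
  have hn : 0 < ‖v z₀‖ := norm_pos_iff.2 hv0'
  -- Near z₀ half of Re u(z₀) and half of the ratio |Im v| / ‖v‖ at z₀ remain lower bounds, so one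
  -- dominating function serves a whole ball.
  set s := (u z₀).re / 2
  set R := ‖v z₀‖ + 1
  set δ := |(v z₀).im| / ‖v z₀‖ / 2 with hδ
  have hδ0 : 0 < δ := by have := abs_pos.2 hv0; positivity
  have hev : ∀ᶠ z in 𝓝 z₀, s < (u z).re ∧ ‖v z‖ < R ∧ δ * ‖v z‖ < |(v z).im| := by
    refine Filter.Eventually.and ?_ (Filter.Eventually.and ?_ ?_)
    · exact (Complex.continuous_re.comp hu.continuous).continuousAt.eventually_const_lt
        (half_lt_self hu0)
    · exact hv.continuous.norm.continuousAt.eventually_lt_const (lt_add_one _)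
    · refine (continuous_const.mul hv.continuous.norm).continuousAt.eventually_lt
        (Complex.continuous_im.comp hv.continuous).abs.continuousAt ?_
      have : δ * ‖v z₀‖ = |(v z₀).im| / 2 := by rw [hδ]; field_simp
      have h2 := abs_pos.2 hv0
      show δ * ‖v z₀‖ < |(v z₀).im|
      linarith
  obtain ⟨r, hr, hball⟩ := Metric.eventually_nhds_iff_ball.1 hev
  obtain ⟨C, hC, h⟩ := exists_norm_laplaceCore_le (b := b) hq (half_pos hu0) hδ0
    (by positivity : 0 ≤ R) γ β
  have him : ∀ z ∈ Metric.ball z₀ r, (v z).im ≠ 0 ∧ v z ≠ 0 := by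
    intro z hz
    have h1 := (hball z hz).2.2
    have h2 : (v z).im ≠ 0 := abs_pos.1 (lt_of_le_of_lt (by positivity) h1)
    exact ⟨h2, fun h0 => h2 (by simp [h0])⟩
  refine hasDerivAt_integral_of_dominated_holomorphic hr
    (bound := fun a => C * ∏ m, (a m ^ γ m * Real.exp (-(s / 2) * a m)))
    (fun z hz => aestronglyMeasurable_laplaceCore hq _ (him z hz).1)
    (Eventually.of_forall fun a z hz => (differentiableAt_laplaceCore hq hu.differentiableAt
      hv.differentiableAt (him z hz).1 a).differentiableWithinAt) ?_
    ((integrableOn_prod_rpow_mul_exp hγ (half_pos (half_pos hu0))).const_mul C)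
  filter_upwards [ae_restrict_mem (measurableSet_posOrthant k)] with a ha z hz
  obtain ⟨h1, h2, h3⟩ := hball z hz
  exact h _ _ h1.le (him z hz).2 h2.le h3.le a ha

theorem hasDerivAt_integral_laplaceCore_left (hq : ∀ i ∈ S, 0 < q i) (hγ : ∀ m, -1 < γ m)
    {μ ρ : ℂ} (hμ : 0 < μ.re) (hρ : ρ.im ≠ 0) :
    HasDerivAt (fun μ => ∫ a in posOrthant k, laplaceCore S q b γ β μ ρ a)
      (∫ a in posOrthant k, -((∑ m, a m : ℝ) : ℂ) * laplaceCore S q b γ β μ ρ a) μ := by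
  have h := hasDerivAt_integral_laplaceCore (b := b) (β := β) hq hγ (u := fun z => z)
    (v := fun _ => ρ) differentiable_id (differentiable_const _) hμ hρ
  have heq : ∀ a : Fin k → ℝ, deriv (fun z => laplaceCore S q b γ β z ρ a) μ =
      -((∑ m, a m : ℝ) : ℂ) * laplaceCore S q b γ β μ ρ a := by
    intro a
    refine HasDerivAt.deriv ?_
    unfold laplaceCore
    have h1 : HasDerivAt (fun z : ℂ => Complex.exp (-z * ((∑ m, a m : ℝ) : ℂ)))
        (Complex.exp (-μ * ((∑ m, a m : ℝ) : ℂ)) * (-1 * ((∑ m, a m : ℝ) : ℂ))) μ :=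
      ((hasDerivAt_neg μ).mul_const _).cexp
    convert! (h1.const_mul ((∏ m, a m ^ γ m : ℝ) : ℂ)).mul_const
      (∏ i ∈ S, outerForm q b ρ a i ^ (β i : ℂ)) using 1
    ring
  simpa only [heq] using h

/-- The exponential and the outer forms see a dilation of a only through tμ and tρ; the monomial
contributes the power of t. -/
theorem laplaceCore_smul {t : ℝ} (ht : 0 < t) (μ ρ : ℂ) {a : Fin k → ℝ} (ha : a ∈ posOrthant k) :
    laplaceCore S q b γ β μ ρ (t • a) =
      ((t ^ (∑ m, γ m) : ℝ) : ℂ) * laplaceCore S q b γ β (t * μ) (t * ρ) a := by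
  have h1 : ∑ m, (t • a) m = t * ∑ m, a m := by simp [Finset.mul_sum]
  have h2 : ∀ i, outerForm q b ρ (t • a) i = outerForm q b (t * ρ) a i := by
    intro i
    have : ∑ m, b i m * (t • a) m = t * ∑ m, b i m * a m := by
      rw [Finset.mul_sum]; exact Finset.sum_congr rfl fun m _ => by simp; ring
    rw [outerForm, this, outerForm]; push_cast; ring
  have h3 : ∏ m, (t • a) m ^ γ m = t ^ (∑ m, γ m) * ∏ m, a m ^ γ m := by
    rw [Real.rpow_sum_of_pos ht, ← Finset.prod_mul_distrib]
    exact Finset.prod_congr rfl fun m _ => by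
      rw [Pi.smul_apply, smul_eq_mul, Real.mul_rpow ht.le (ha m).le]
  simp only [laplaceCore, h1, h2, h3]
  push_cast
  ring_nf

theorem smul_posOrthant {t : ℝ} (ht : 0 < t) : t • posOrthant k = posOrthant k := by
  ext x
  constructor
  · rintro ⟨a, ha, rfl⟩ m
    exact mul_pos ht (ha m)
  · intro hx
    refine ⟨t⁻¹ • x, fun m => mul_pos (inv_pos.2 ht) (hx m), ?_⟩
    simp only [smul_smul, mul_inv_cancel₀ ht.ne', one_smul]

/-- The dilation has Jacobian t^k, which accounts for the 1 added to each γ_m. This homogeneity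
serves both the independence of ρ and the rescaling by |λ|. -/
theorem integral_laplaceCore_smul {t : ℝ} (ht : 0 < t) (μ ρ : ℂ) :
    ∫ a in posOrthant k, laplaceCore S q b γ β (t * μ) (t * ρ) a =
      ((t ^ (-(∑ m, (γ m + 1))) : ℝ) : ℂ) *
        ∫ a in posOrthant k, laplaceCore S q b γ β μ ρ a := by
  have h := Measure.setIntegral_comp_smul_of_pos (volume : Measure (Fin k → ℝ))
    (laplaceCore S q b γ β μ ρ) (posOrthant k) ht
  rw [smul_posOrthant ht, setIntegral_congr_fun (measurableSet_posOrthant k)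
    (fun a ha => laplaceCore_smul ht μ ρ ha), integral_const_mul] at h
  have hp : (t ^ (∑ m, γ m) : ℝ) ≠ 0 := (Real.rpow_pos_of_pos ht _).ne'
  have hp' : ((t ^ (∑ m, γ m) : ℝ) : ℂ) ≠ 0 := by exact_mod_cast hp
  refine mul_left_cancel₀ hp' (h.trans ?_)
  rw [← mul_assoc, ← Complex.ofReal_mul, ← Real.rpow_add ht, Complex.real_smul]
  congr 2
  rw [Finset.sum_add_distrib, neg_add, add_neg_cancel_left, Real.rpow_neg ht.le]
  simp

end

/-! ### Integration by parts, the Gamma integral and the limit ρ → 0 -/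

section

variable {ι : Type*} {k : ℕ} {S : Finset ι} {q : ι → ℝ} {b : ι → Fin k → ℝ}
  {γ : Fin k → ℝ} {β : ι → ℝ}

theorem hasDerivAt_outerForm_update (ρ : ℂ) (i : ι) (a : Fin k → ℝ) (m : Fin k) (t : ℝ) :
    HasDerivAt (fun t => outerForm q b ρ (Function.update a m t) i) (ρ * b i m) t := by
  have h1 : HasDerivAt (fun t : ℝ => ∑ n, b i n * Function.update a m t n) (b i m) t := by
    have h := HasDerivAt.fun_sum (u := Finset.univ) (x := t) fun n _ =>
      ((hasDerivAt_pi.1 (hasDerivAt_update a m t)) n).const_mul (b i n)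
    simpa [Pi.single_apply] using h
  simpa [outerForm] using ((h1.ofReal_comp).const_mul ρ).const_add (q i : ℂ)

theorem laplaceCore_update (μ ρ : ℂ) (a : Fin k → ℝ) (m : Fin k) (t : ℝ) :
    laplaceCore S q b γ β μ ρ (Function.update a m t) =
      ((t ^ γ m * ∏ n ∈ Finset.univ.erase m, a n ^ γ n : ℝ) : ℂ) *
      (Complex.exp (-μ * ((t + ∑ n ∈ Finset.univ.erase m, a n : ℝ) : ℂ)) *
        ∏ i ∈ S, outerForm q b ρ (Function.update a m t) i ^ (β i : ℂ)) := by
  have h1 : ∏ n, Function.update a m t n ^ γ n =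
      t ^ γ m * ∏ n ∈ Finset.univ.erase m, a n ^ γ n := by
    rw [← Finset.mul_prod_erase _ _ (Finset.mem_univ m), Function.update_self]
    congr 1
    exact Finset.prod_congr rfl fun n hn => by
      rw [Function.update_of_ne (Finset.ne_of_mem_erase hn)]
  have h2 : ∑ n, Function.update a m t n = t + ∑ n ∈ Finset.univ.erase m, a n := by
    rw [← Finset.add_sum_erase _ _ (Finset.mem_univ m), Function.update_self]
    congr 1
    exact Finset.sum_congr rfl fun n hn => by
      rw [Function.update_of_ne (Finset.ne_of_mem_erase hn)]
  rw [laplaceCore, h1, h2, mul_assoc]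

/-- Product rule over the three kinds of factors: the monomial and each outer power lose 1 in one
exponent, and the exponential contributes -μ. All terms are again of the type `laplaceCore`, so the
family is closed under differentiation. -/
theorem hasDerivAt_laplaceCore_update [DecidableEq ι] (hq : ∀ i ∈ S, 0 < q i) {μ ρ : ℂ}
    (hρ : ρ.im ≠ 0) (m : Fin k) {a : Fin k → ℝ} (ha : a ∈ posOrthant k) :
    HasDerivAt (fun t => laplaceCore S q b γ β μ ρ (Function.update a m t))
      (γ m * laplaceCore S q b (γ - Pi.single m 1) β μ ρ a - μ * laplaceCore S q b γ β μ ρ a +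
        ∑ i ∈ S, β i * ρ * b i m * laplaceCore S q b γ (β - Pi.single i 1) μ ρ a) (a m) := by
  have e1 : ∏ n, a n ^ γ n = a m ^ γ m * ∏ n ∈ Finset.univ.erase m, a n ^ γ n :=
    (Finset.mul_prod_erase _ _ (Finset.mem_univ m)).symm
  have e2 : ∏ n, a n ^ (γ - Pi.single m 1 : Fin k → ℝ) n =
      a m ^ (γ m - 1) * ∏ n ∈ Finset.univ.erase m, a n ^ γ n := by
    rw [← Finset.mul_prod_erase _ _ (Finset.mem_univ m)]
    congr 1
    · simp
    · exact Finset.prod_congr rfl fun n hn => by simp [Finset.ne_of_mem_erase hn]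
  have e3 : a m + ∑ n ∈ Finset.univ.erase m, a n = ∑ n, a n :=
    Finset.add_sum_erase _ _ (Finset.mem_univ m)
  have e4 : ∀ i ∈ S, ∏ j ∈ S, outerForm q b ρ a j ^ ((β - Pi.single i 1 : ι → ℝ) j : ℂ) =
      outerForm q b ρ a i ^ ((β i : ℂ) - 1) *
        ∏ j ∈ S.erase i, outerForm q b ρ a j ^ (β j : ℂ) := by
    intro i hi
    rw [← Finset.mul_prod_erase _ _ hi]
    congr 1
    · simp
    · exact Finset.prod_congr rfl fun j hj => by simp [Finset.ne_of_mem_erase hj]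
  have h1 : HasDerivAt (fun t : ℝ => t ^ γ m * ∏ n ∈ Finset.univ.erase m, a n ^ γ n)
      (γ m * a m ^ (γ m - 1) * ∏ n ∈ Finset.univ.erase m, a n ^ γ n) (a m) := by
    have := ((hasDerivAt_id (a m)).rpow_const (p := γ m) (Or.inl (ha m).ne')).mul_const
      (∏ n ∈ Finset.univ.erase m, a n ^ γ n)
    simpa using this
  have h2 : HasDerivAt (fun t : ℝ =>
      Complex.exp (-μ * ((t + ∑ n ∈ Finset.univ.erase m, a n : ℝ) : ℂ)))
      (Complex.exp (-μ * ((∑ n, a n : ℝ) : ℂ)) * (-μ)) (a m) := by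
    have h := ((((hasDerivAt_id (a m)).add_const
      (∑ n ∈ Finset.univ.erase m, a n)).ofReal_comp).const_mul (-μ)).cexp
    simp only [id, e3] at h
    simpa using h
  have h3 : HasDerivAt (fun t : ℝ => ∏ i ∈ S, outerForm q b ρ (Function.update a m t) i ^ (β i : ℂ))
      (∑ i ∈ S, (∏ j ∈ S.erase i, outerForm q b ρ a j ^ (β j : ℂ)) *
        (β i * outerForm q b ρ a i ^ ((β i : ℂ) - 1) * (ρ * b i m))) (a m) := by
    have h := HasDerivAt.fun_finsetProd (u := S) (x := a m)
      (f := fun i t => outerForm q b ρ (Function.update a m t) i ^ (β i : ℂ))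
      (f' := fun i => β i * outerForm q b ρ a i ^ ((β i : ℂ) - 1) * (ρ * b i m)) fun i hi => by
        have := (hasDerivAt_outerForm_update (q := q) (b := b) ρ i a m (a m))
        have h := (Complex.hasStrictDerivAt_cpow_const (c := (β i : ℂ))
          (outerForm_mem_slitPlane (q := q) (b := b) (hq i hi) hρ
            (Function.update a m (a m)))).hasDerivAt.comp (a m) this
        simpa [Function.comp_def] using h
    simpa using h
  set T : ℂ := ∑ i ∈ S, (∏ j ∈ S.erase i, outerForm q b ρ a j ^ (β j : ℂ)) *
    (β i * outerForm q b ρ a i ^ ((β i : ℂ) - 1) * (ρ * b i m)) with hT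
  have h := (h1.ofReal_comp).fun_mul (h2.fun_mul h3)
  simp only [Function.update_eq_self, e3] at h
  refine (h.congr_of_eventuallyEq
    (Eventually.of_forall fun t => laplaceCore_update μ ρ a m t)).congr_deriv ?_
  have hsum : ∑ i ∈ S, β i * ρ * b i m * laplaceCore S q b γ (β - Pi.single i 1) μ ρ a =
      ((∏ n, a n ^ γ n : ℝ) : ℂ) * Complex.exp (-μ * ((∑ m, a m : ℝ) : ℂ)) * T := by
    rw [hT, Finset.mul_sum]
    refine Finset.sum_congr rfl fun i hi => ?_
    rw [laplaceCore, e4 i hi]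
    ring
  rw [hsum, laplaceCore, laplaceCore, e1, e2]
  clear_value T
  push_cast
  ring

/-- The factor a_m^{γ_m} with γ_m > 0 kills the boundary term on the face a_m = 0; the other factors
stay continuous there because q_i > 0. -/
theorem tendsto_laplaceCore_update (hq : ∀ i ∈ S, 0 < q i) {μ ρ : ℂ}
    (hρ : ρ.im ≠ 0) {m : Fin k} (hm : 0 < γ m) (a : Fin k → ℝ) :
    Tendsto (fun t => laplaceCore S q b γ β μ ρ (Function.update a m t)) (𝓝[>] 0) (𝓝 0) := by
  have h1 : Tendsto (fun t : ℝ => ((t ^ γ m * ∏ n ∈ Finset.univ.erase m, a n ^ γ n : ℝ) : ℂ))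
      (𝓝 0) (𝓝 0) := by
    have h := (((continuous_id.rpow_const (p := γ m) fun _ => Or.inr hm.le).mul_const
      (∏ n ∈ Finset.univ.erase m, a n ^ γ n)).tendsto 0)
    have h' := (Complex.continuous_ofReal.tendsto _).comp h
    simpa [Function.comp_def, Real.zero_rpow hm.ne'] using h'
  have h2 : Continuous fun t : ℝ =>
      (Complex.exp (-μ * ((t + ∑ n ∈ Finset.univ.erase m, a n : ℝ) : ℂ)) *
        ∏ i ∈ S, outerForm q b ρ (Function.update a m t) i ^ (β i : ℂ)) := by
    refine Continuous.mul (by fun_prop) (continuous_finsetProd _ fun i hi => ?_)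
    exact ((continuous_outerForm ρ i).comp (by fun_prop)).cpow continuous_const
      fun t => outerForm_mem_slitPlane (hq i hi) hρ _
  have h := h1.mul (h2.tendsto 0)
  rw [zero_mul] at h
  refine Tendsto.mono_left ?_ nhdsWithin_le_nhds
  simpa only [laplaceCore_update] using h

/-- Integration by parts in the coordinate `m`. -/
theorem integral_laplaceCore_by_parts [DecidableEq ι] (hq : ∀ i ∈ S, 0 < q i)
    (hγ : ∀ m, -1 < γ m) {μ ρ : ℂ} (hμ : 0 < μ.re) (hρ : ρ.im ≠ 0) {m : Fin k} (hm : 0 < γ m) :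
    γ m * (∫ a in posOrthant k, laplaceCore S q b (γ - Pi.single m 1) β μ ρ a) -
      μ * (∫ a in posOrthant k, laplaceCore S q b γ β μ ρ a) +
      ∑ i ∈ S, β i * ρ * b i m *
        ∫ a in posOrthant k, laplaceCore S q b γ (β - Pi.single i 1) μ ρ a = 0 := by
  -- The hypothesis γ_m > 0 has a second use: the lowered exponent γ_m - 1 is still integrable at 0.
  have hγ' : ∀ n, -1 < (γ - Pi.single m 1 : Fin k → ℝ) n := by
    intro n
    rcases eq_or_ne n m with rfl | h
    · simp; linarith
    · simpa [h] using hγ n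
  have i1 := (integrableOn_laplaceCore (b := b) (β := β) hq hγ' hμ hρ).const_mul (γ m : ℂ)
  have i2 := (integrableOn_laplaceCore (b := b) (β := β) hq hγ hμ hρ)
  have i2' := i2.const_mul μ
  have i3 : ∀ i ∈ S, IntegrableOn (fun a => β i * ρ * b i m *
      laplaceCore S q b γ (β - Pi.single i 1) μ ρ a) (posOrthant k) := fun i _ =>
    (integrableOn_laplaceCore (b := b) hq hγ hμ hρ).const_mul _
  have i12 := i1.sub i2'
  have i3' := integrable_finsetSum S i3
  have h := setIntegral_posOrthant_partialDeriv_eq_zero m i2 (i12.add i3')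
    (fun a ha => hasDerivAt_laplaceCore_update hq hρ m ha)
    (fun a _ => tendsto_laplaceCore_update hq hρ hm a)
  rw [integral_add' i12 i3', integral_sub' i1 i2', integral_const_mul, integral_const_mul,
    integral_finsetSum _ i3] at h
  simpa only [integral_const_mul] using h

theorem laplaceCore_empty (μ ρ : ℂ) (a : Fin k → ℝ) : laplaceCore ∅ q b γ β μ ρ a =
    ((∏ m, a m ^ γ m : ℝ) : ℂ) * Complex.exp (-μ * ((∑ m, a m : ℝ) : ℂ)) := by
  simp [laplaceCore]

/-- The integral is holomorphic in μ on the right half-plane and homogeneous of degree -∑(γ_m + 1)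
under positive dilations. Multiplied by the corresponding power of μ it is constant, and at μ = 1 it
is a product of Gamma integrals. -/
theorem integral_laplaceCore_empty (hγ : ∀ m, -1 < γ m) {μ : ℂ} (hμ : 0 < μ.re) (ρ : ℂ) :
    ∫ a in posOrthant k, laplaceCore ∅ q b γ β μ ρ a =
      ((∏ m, Real.Gamma (γ m + 1) : ℝ) : ℂ) *
        Complex.exp (-((∑ m, (γ m + 1) : ℝ) : ℂ) * Complex.log μ) := by
  set F : ℂ → ℂ := fun μ => Complex.exp (((∑ m, (γ m + 1) : ℝ) : ℂ) * Complex.log μ) *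
    ∫ a in posOrthant k, laplaceCore ∅ q b γ β μ Complex.I a with hF
  have hslit : ∀ μ : ℂ, 0 < μ.re → μ ∈ Complex.slitPlane := fun μ h =>
    Complex.mem_slitPlane_iff.2 (Or.inl h)
  -- Without outer forms ρ does not occur. It can be set to the nonreal value I to apply the
  -- holomorphy result and rescaled at will in the scaling law.
  have hind : ∀ μ ρ ρ' : ℂ, ∫ a in posOrthant k, laplaceCore ∅ q b γ β μ ρ a =
      ∫ a in posOrthant k, laplaceCore ∅ q b γ β μ ρ' a := by
    intro μ ρ ρ'; simp only [laplaceCore_empty]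
  have hconst : F μ = F 1 := by
    refine eq_of_differentiableOn_of_homogeneous (U := {μ : ℂ | 0 < μ.re})
      (isOpen_lt continuous_const Complex.continuous_re) (convex_halfSpace_re_gt 0)
      (by simp) (fun μ hμ => ?_) (fun μ hμ t ht => ?_) hμ (by simp)
    · have h1 := (hasDerivAt_integral_laplaceCore_left (S := (∅ : Finset ι)) (q := q) (b := b)
        (β := β) (by simp) hγ (ρ := Complex.I) hμ (by simp)).differentiableAt
      have h2 : DifferentiableAt ℂ Complex.log μ := Complex.differentiableAt_log (hslit μ hμ)
      exact (DifferentiableAt.mul (by fun_prop) h1).differentiableWithinAt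
    · simp only [hF]
      have hμ0 : μ ≠ 0 := by rintro rfl; simp at hμ
      rw [hind _ Complex.I (t * Complex.I), integral_laplaceCore_smul ht,
        Complex.log_ofReal_mul ht hμ0, mul_add, Complex.exp_add, Real.rpow_neg ht.le]
      have h3 : Complex.exp (((∑ m, (γ m + 1) : ℝ) : ℂ) * (Real.log t : ℂ)) =
          ((t ^ (∑ m, (γ m + 1)) : ℝ) : ℂ) := by
        rw [Real.rpow_def_of_pos ht]; push_cast; ring_nf
      have h4 : ((t ^ (∑ m, (γ m + 1)) : ℝ) : ℂ) ≠ 0 := by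
        exact_mod_cast (Real.rpow_pos_of_pos ht _).ne'
      rw [h3]; push_cast at h4 ⊢; field_simp
  have hone : F 1 = ((∏ m, Real.Gamma (γ m + 1) : ℝ) : ℂ) := by
    have h1 : ∀ a : Fin k → ℝ, laplaceCore ∅ q b γ β 1 Complex.I a =
        ((∏ m, (a m ^ γ m * Real.exp (-a m)) : ℝ) : ℂ) := by
      intro a
      rw [laplaceCore_empty, Finset.prod_mul_distrib, ← Real.exp_sum]
      push_cast [Finset.sum_neg_distrib]
      ring_nf
    simp only [hF, h1, Complex.log_one, mul_zero, Complex.exp_zero, one_mul]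
    rw [integral_complex_ofReal, volume_restrict_posOrthant,
      integral_fintype_prod_eq_prod (f := fun m (t : ℝ) => t ^ γ m * Real.exp (-t))]
    congr 1
    refine Finset.prod_congr rfl fun m _ => ?_
    rw [Real.Gamma_eq_integral (by linarith [hγ m])]
    simp only [add_sub_cancel_right, mul_comm]
  rw [hone] at hconst
  rw [hind μ ρ Complex.I, ← hconst, hF]
  simp only
  rw [mul_right_comm, ← Complex.exp_add]
  simp

/-- The limit of the integral of `laplaceCore` when `ρ` tends to zero away from the real axis. -/
theorem tendsto_integral_laplaceCore {τ : Type*} {f : Filter τ} [f.IsCountablyGenerated]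
    (hq : ∀ i ∈ S, 0 < q i) (hγ : ∀ m, -1 < γ m) {u v : τ → ℂ} {s δ : ℝ} (hs : 0 < s) (hδ : 0 < δ)
    (hu : ∀ᶠ t in f, s ≤ (u t).re) (hv : ∀ᶠ t in f, v t ≠ 0 ∧ δ * ‖v t‖ ≤ |(v t).im|)
    (hv0 : Tendsto v f (𝓝 0)) :
    Tendsto (fun t => (∫ a in posOrthant k, laplaceCore S q b γ β (u t) (v t) a) -
      ((∏ i ∈ S, q i ^ β i : ℝ) : ℂ) * (((∏ m, Real.Gamma (γ m + 1) : ℝ) : ℂ) *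
        Complex.exp (-((∑ m, (γ m + 1) : ℝ) : ℂ) * Complex.log (u t)))) f (𝓝 0) := by
  set c : ℂ := ((∏ i ∈ S, q i ^ β i : ℝ) : ℂ) with hc
  obtain ⟨C₁, hC₁, hb₁⟩ := exists_norm_laplaceCore_le (b := b) hq hs hδ zero_le_one γ β
  obtain ⟨C₂, hC₂, hb₂⟩ := exists_norm_laplaceCore_le (S := (∅ : Finset ι)) (q := q) (b := b)
    (by simp) hs hδ zero_le_one γ β
  have hv1 : ∀ᶠ t in f, ‖v t‖ ≤ 1 := by
    have := (hv0.norm.eventually_lt_const (by simp : ‖(0 : ℂ)‖ < 1))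
    exact this.mono fun t h => h.le
  have him : ∀ t, v t ≠ 0 ∧ δ * ‖v t‖ ≤ |(v t).im| → (v t).im ≠ 0 := by
    rintro t ⟨h1, h2⟩
    have := norm_pos_iff.2 h1
    exact abs_pos.1 (lt_of_lt_of_le (by positivity) h2)
  have hI := integrableOn_prod_rpow_mul_exp hγ (half_pos hs)
  -- The parameter u need not converge, so neither integral need have a limit. Dominated convergence
  -- is applied to the difference, whose integrand has a bounded factor times a factor that tends to
  -- zero.
  have hlim : Tendsto (fun t => ∫ a in posOrthant k, (laplaceCore S q b γ β (u t) (v t) a -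
      c * laplaceCore ∅ q b γ β (u t) (v t) a)) f (𝓝 (∫ a in posOrthant k, (0 : ℂ))) := by
    refine tendsto_integral_filter_of_dominated_convergence
      (fun a => (C₁ + ‖c‖ * C₂) * ∏ m, (a m ^ γ m * Real.exp (-(s / 2) * a m))) ?_ ?_
      (hI.const_mul _) ?_
    · filter_upwards [hv] with t ht
      exact (aestronglyMeasurable_laplaceCore hq _ (him t ht)).sub
        ((aestronglyMeasurable_laplaceCore (by simp) _ (him t ht)).const_mul c)
    · filter_upwards [hu, hv, hv1] with t h1 h2 h3
      filter_upwards [ae_restrict_mem (measurableSet_posOrthant k)] with a ha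
      refine (norm_sub_le _ _).trans ?_
      rw [norm_mul, add_mul, mul_assoc]
      have hx := hb₁ _ _ h1 h2.1 h3 h2.2 a ha
      have hy := hb₂ _ _ h1 h2.1 h3 h2.2 a ha
      gcongr
    · filter_upwards [ae_restrict_mem (measurableSet_posOrthant k)] with a ha
      have hfac : ∀ t, laplaceCore S q b γ β (u t) (v t) a -
          c * laplaceCore ∅ q b γ β (u t) (v t) a = laplaceCore ∅ q b γ β (u t) (v t) a *
            ((∏ i ∈ S, outerForm q b (v t) a i ^ (β i : ℂ)) - c) := by
        intro t; rw [laplaceCore_empty, laplaceCore]; ring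
      have hprod : Tendsto (fun t => (∏ i ∈ S, outerForm q b (v t) a i ^ (β i : ℂ)) - c) f
          (𝓝 0) := by
        rw [← sub_self c, hc]
        refine Tendsto.sub_const ?_ _
        rw [Complex.ofReal_prod]
        refine tendsto_finsetProd _ fun i hi => ?_
        rw [Complex.ofReal_cpow (hq i hi).le]
        refine Tendsto.cpow ?_ tendsto_const_nhds
          (Complex.ofReal_mem_slitPlane.2 (hq i hi))
        have := (hv0.mul_const ((∑ m, b i m * a m : ℝ) : ℂ)).const_add (q i : ℂ)
        simpa only [outerForm, zero_mul, add_zero] using this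
      simp only [hfac]
      refine squeeze_zero_norm' (a := fun t =>
        (C₂ * ∏ m, (a m ^ γ m * Real.exp (-(s / 2) * a m))) *
          ‖(∏ i ∈ S, outerForm q b (v t) a i ^ (β i : ℂ)) - c‖) ?_ ?_
      · filter_upwards [hu, hv, hv1] with t h1 h2 h3
        rw [norm_mul]
        exact mul_le_mul_of_nonneg_right (hb₂ _ _ h1 h2.1 h3 h2.2 a ha) (norm_nonneg _)
      · simpa using (hprod.norm).const_mul (C₂ * ∏ m, (a m ^ γ m * Real.exp (-(s / 2) * a m)))
  rw [integral_zero] at hlim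
  refine hlim.congr' ?_
  filter_upwards [hu, hv] with t h1 h2
  have hre : 0 < (u t).re := hs.trans_le h1
  rw [integral_sub (integrableOn_laplaceCore hq hγ hre (him t h2))
    ((integrableOn_laplaceCore (by simp) hγ hre (him t h2)).const_mul c), integral_const_mul,
    integral_laplaceCore_empty hγ hre]

end

/-! ### Linear coordinates at a vertex, determinants and signs -/

theorem Complex.ofReal_mul_cpow {t : ℝ} (ht : 0 < t) {z : ℂ} (hz : z ≠ 0) (s : ℂ) :
    ((t : ℂ) * z) ^ s = (t : ℂ) ^ s * z ^ s := by
  have ht0 : (t : ℂ) ≠ 0 := by exact_mod_cast ht.ne'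
  rw [Complex.cpow_def_of_ne_zero (mul_ne_zero ht0 hz), Complex.cpow_def_of_ne_zero ht0,
    Complex.cpow_def_of_ne_zero hz, ← Complex.exp_add, Complex.log_ofReal_mul ht hz,
    Complex.ofReal_log ht.le, add_mul]

namespace GenericArrangement

variable {k N : ℕ} (A : GenericArrangement k N)

/-- The increasing enumeration of a vertex. -/
def idx (X : ArrVertex k N) (m : Fin k) : Fin N := X.1.orderEmbOfFin X.2 m

theorem idx_mem (X : ArrVertex k N) (m : Fin k) : idx X m ∈ X.1 := Finset.orderEmbOfFin_mem _ _ _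

theorem idx_injective (X : ArrVertex k N) : Function.Injective (idx X) :=
  (X.1.orderEmbOfFin X.2).injective

theorem image_idx (X : ArrVertex k N) : Finset.univ.map ⟨idx X, idx_injective X⟩ = X.1 := by
  ext j
  simp only [Finset.mem_map, Finset.mem_univ, true_and, Function.Embedding.coeFn_mk]
  exact Set.ext_iff.1 (Finset.range_orderEmbOfFin X.1 X.2) j

theorem prod_idx {M : Type*} [CommMonoid M] (X : ArrVertex k N) (g : Fin N → M) :
    ∏ m, g (idx X m) = ∏ j ∈ X.1, g j := by
  conv_rhs => rw [← image_idx X, Finset.prod_map]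
  rfl

theorem sum_idx {M : Type*} [AddCommMonoid M] (X : ArrVertex k N) (g : Fin N → M) :
    ∑ m, g (idx X m) = ∑ j ∈ X.1, g j := by
  conv_rhs => rw [← image_idx X, Finset.sum_map]
  rfl

/-- The direction `e_{X ∖ {j_m}}`. -/
def edge (X : ArrVertex k N) (m : Fin k) : Fin k → ℝ := A.edgeVec (X.1.erase (idx X m))

/-- The slope `l_{j_m}(e_{X ∖ {j_m}})`. -/
def slopeAt (X : ArrVertex k N) (m : Fin k) : ℝ := A.l (idx X m) (A.edge X m)

theorem slopeAt_ne (X : ArrVertex k N) (m : Fin k) : A.slopeAt X m ≠ 0 := A.l_edge_ne X (idx_mem X m)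

theorem card_erase_idx (X : ArrVertex k N) (m : Fin k) : (X.1.erase (idx X m)).card + 1 = k := by
  rw [Finset.card_erase_add_one (idx_mem X m), X.2]

theorem f0_edge_eq (X : ArrVertex k N) (m : Fin k) : A.f0 (A.edge X m) = 1 :=
  (A.edgeVec_spec _ (card_erase_idx X m)).2

theorem l_idx_edge (X : ArrVertex k N) (m n : Fin k) :
    A.l (idx X m) (A.edge X n) = if m = n then A.slopeAt X m else 0 := by
  split_ifs with h
  · subst h; rfl
  · exact (A.edgeVec_spec _ (card_erase_idx X n)).1 _
      (Finset.mem_erase.2 ⟨fun h' => h (idx_injective X h'), idx_mem X m⟩)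

/-- The linear coordinates `a ↦ ∑_m a_m e_{X ∖ {j_m}}` of the cone of a vertex. -/
def param (X : ArrVertex k N) : (Fin k → ℝ) →ₗ[ℝ] (Fin k → ℝ) := Fintype.linearCombination ℝ (A.edge X)

theorem map_param (X : ArrVertex k N) (g : (Fin k → ℝ) →ₗ[ℝ] ℝ) (a : Fin k → ℝ) :
    g (A.param X a) = ∑ m, g (A.edge X m) * a m := by
  simp [param, Fintype.linearCombination_apply, mul_comm]

theorem l_idx_param (X : ArrVertex k N) (m : Fin k) (a : Fin k → ℝ) :
    A.l (idx X m) (A.param X a) = A.slopeAt X m * a m := by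
  rw [map_param]
  simp [l_idx_edge]

theorem f0_param (X : ArrVertex k N) (a : Fin k → ℝ) : A.f0 (A.param X a) = ∑ m, a m := by
  rw [map_param]
  simp [f0_edge_eq]

/-- The expansion of a vector along the edges at a vertex. -/
theorem param_expand (X : ArrVertex k N) (v : Fin k → ℝ) :
    A.param X (fun m => A.l (idx X m) v / A.slopeAt X m) = v := by
  refine sub_eq_zero.1 (A.eq_zero_of_l X _ fun j hj => ?_)
  rw [← image_idx X] at hj
  obtain ⟨m, -, rfl⟩ := Finset.mem_map.1 hj
  have := A.slopeAt_ne X m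
  simp only [Function.Embedding.coeFn_mk, map_sub, l_idx_param]
  field_simp
  ring

theorem param_injective (X : ArrVertex k N) : Function.Injective (A.param X) := by
  intro a b h
  ext m
  have := congrArg (A.l (idx X m)) h
  rw [l_idx_param, l_idx_param] at this
  exact mul_left_cancel₀ (A.slopeAt_ne X m) this

theorem cone_eq_image (X : ArrVertex k N) :
    A.cone X = (fun a => A.point X + A.param X a) '' posOrthant k := by
  ext x
  constructor
  · rintro ⟨a, ha, rfl⟩
    refine ⟨fun m => a (idx X m), fun m => ha _ (idx_mem X m), ?_⟩
    simp only [param, Fintype.linearCombination_apply, edge]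
    rw [sum_idx X fun j => a j • A.edgeVec (X.1.erase j)]
  · rintro ⟨a, ha, rfl⟩
    -- Coefficients off X get the default value 0; the sum over X never reads them.
    have hinv : ∀ m, (Function.extend (idx X) a 0) (idx X m) = a m := fun m =>
      (idx_injective X).extend_apply _ _ _
    refine ⟨Function.extend (idx X) a 0, fun j hj => ?_, ?_⟩
    · rw [← image_idx X] at hj
      obtain ⟨m, -, rfl⟩ := Finset.mem_map.1 hj
      exact (hinv m).symm ▸ ha m
    · simp only [param, Fintype.linearCombination_apply, edge]
      rw [← sum_idx X fun j => Function.extend (idx X) a 0 j • A.edgeVec (X.1.erase j)]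
      simp only [hinv]

/-- The volume distortion of the linear coordinates of the cone. -/
def coneVolume (X : ArrVertex k N) : ℝ := |LinearMap.det (A.param X)|

theorem hasFDerivAt_param (X : ArrVertex k N) (a : Fin k → ℝ) :
    HasFDerivAt (fun a => A.point X + A.param X a) (LinearMap.toContinuousLinearMap (A.param X)) a :=
  (LinearMap.toContinuousLinearMap (A.param X)).hasFDerivAt.const_add _

theorem injective_point_add_param (X : ArrVertex k N) :
    Function.Injective fun a => A.point X + A.param X a :=
  (add_right_injective _).comp (A.param_injective X)

theorem setIntegral_cone (X : ArrVertex k N) (g : (Fin k → ℝ) → ℂ) :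
    ∫ x in A.cone X, g x =
      (A.coneVolume X : ℂ) * ∫ a in posOrthant k, g (A.point X + A.param X a) := by
  rw [cone_eq_image, integral_image_eq_integral_abs_det_fderiv_smul volume
    (measurableSet_posOrthant k) (fun a _ => (A.hasFDerivAt_param X a).hasFDerivWithinAt)
    (A.injective_point_add_param X).injOn]
  rw [integral_smul, LinearMap.det_toContinuousLinearMap, Complex.real_smul]
  rfl

theorem integrableOn_cone (X : ArrVertex k N) {g : (Fin k → ℝ) → ℂ}
    (hg : IntegrableOn (fun a => g (A.point X + A.param X a)) (posOrthant k)) :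
    IntegrableOn g (A.cone X) := by
  rw [cone_eq_image, integrableOn_image_iff_integrableOn_abs_det_fderiv_smul volume
    (measurableSet_posOrthant k) (fun a _ => (A.hasFDerivAt_param X a).hasFDerivWithinAt)
    (A.injective_point_add_param X).injOn]
  exact hg.smul _

/-- `|det (l_{j_1}, …, l_{j_k})|`. -/
def absDet (X : ArrVertex k N) : ℝ :=
  |(Matrix.of fun a b : Fin k => A.l (idx X a) (Pi.single b (1 : ℝ))).det|

theorem map_eq_sum_single (g : (Fin k → ℝ) →ₗ[ℝ] ℝ) (v : Fin k → ℝ) :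
    g v = ∑ b, g (Pi.single b 1) * v b := by
  conv_lhs => rw [← Finset.univ_sum_single v]
  rw [map_sum]
  refine Finset.sum_congr rfl fun i _ => ?_
  rw [mul_comm, ← smul_eq_mul, ← map_smul, ← Pi.single_smul]; simp

/-- The matrix of the l_j, j ∈ X, times the matrix of the edge vectors is diagonal, because l_j
vanishes on every edge at X except e_{X∖{j}}. -/
theorem absDet_mul_coneVolume (X : ArrVertex k N) :
    A.absDet X * A.coneVolume X = ∏ m, |A.slopeAt X m| := by
  rw [absDet, coneVolume, ← abs_mul, ← LinearMap.det_toMatrix', ← Matrix.det_mul, ← Finset.abs_prod]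
  congr 1
  rw [← Matrix.det_diagonal]
  congr 1
  ext m n
  rw [Matrix.mul_apply]
  simp only [Matrix.of_apply, LinearMap.toMatrix'_apply]
  rw [← map_eq_sum_single, l_idx_param, Matrix.diagonal_apply]
  split_ifs with h
  · simp [h]
  · rw [Pi.single_eq_of_ne h, mul_zero]

/-- Two enumerations of X differ by a permutation of the rows, which the absolute value ignores. -/
theorem absDet_eq_of_enum (X : ArrVertex k N) {φ : Fin k → Fin N} (hφ : Function.Injective φ)
    (hX : ∀ a, φ a ∈ X.1) :
    |(Matrix.of fun a b : Fin k => A.l (φ a) (Pi.single b (1 : ℝ))).det| = A.absDet X := by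
  have hs : ∀ a, ∃ m, idx X m = φ a := by
    intro a
    have := hX a
    rw [← image_idx X] at this
    obtain ⟨m, -, h⟩ := Finset.mem_map.1 this
    exact ⟨m, h⟩
  choose p hp using hs
  have hinj : Function.Injective p := fun a b h => hφ (by rw [← hp a, ← hp b, h])
  let e : Fin k ≃ Fin k := Equiv.ofBijective p (Finite.injective_iff_bijective.1 hinj)
  rw [absDet, ← Matrix.abs_det_submatrix_equiv_equiv e (Equiv.refl _)
    (Matrix.of fun a b : Fin k => A.l (idx X a) (Pi.single b (1 : ℝ)))]
  congr 2
  ext a b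
  simp [e, hp]

/-- Exchange of one element of a vertex `X` by `r`. -/
def exchange (X : ArrVertex k N) (m : Fin k) (r : Fin N) (hr : r ∉ X.1.erase (idx X m)) :
    ArrVertex k N :=
  ⟨insert r (X.1.erase (idx X m)), by rw [Finset.card_insert_of_notMem hr, card_erase_idx]⟩

/-- Cramer's rule: l_r expands in the l_j, j ∈ X, with coefficient l_r(e) / l_{j_m}(e) at the
exchanged row, e being the edge at index m, and only this row contributes to the determinant. The
trivial exchange r = j_m is allowed. -/
theorem absDet_exchange (X : ArrVertex k N) (m : Fin k) (r : Fin N)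
    (hr : r ∉ X.1.erase (idx X m)) :
    A.absDet (exchange X m r hr) * |A.slopeAt X m| = A.absDet X * |A.l r (A.edge X m)| := by
  have hφ : Function.Injective (Function.update (idx X) m r) := by
    intro a b h
    by_contra hab
    have key : ∀ a, a ≠ m → idx X a ≠ r := fun a ha h => hr (h ▸ Finset.mem_erase.2
      ⟨fun h' => ha (idx_injective X h'), idx_mem X a⟩)
    rcases eq_or_ne a m with rfl | ha
    · rw [Function.update_self, Function.update_of_ne (Ne.symm hab)] at h
      exact key b (Ne.symm hab) h.symm
    · rcases eq_or_ne b m with rfl | hb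
      · rw [Function.update_self, Function.update_of_ne ha] at h
        exact key a ha h
      · rw [Function.update_of_ne ha, Function.update_of_ne hb] at h
        exact hab (idx_injective X h)
  rw [← A.absDet_eq_of_enum (exchange X m r hr) hφ ?_]
  · have hmat : (Matrix.of fun a b : Fin k => A.l (Function.update (idx X) m r a)
        (Pi.single b (1 : ℝ))) = Matrix.updateRow (Matrix.of fun a b : Fin k =>
          A.l (idx X a) (Pi.single b (1 : ℝ))) m (∑ n, (A.l r (A.edge X n) / A.slopeAt X n) •
            (Matrix.of fun a b : Fin k => A.l (idx X a) (Pi.single b (1 : ℝ))) n) := by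
      ext a b
      rcases eq_or_ne a m with rfl | ha
      · rw [Matrix.updateRow_self, Matrix.of_apply, Function.update_self]
        conv_lhs => rw [← A.param_expand X (Pi.single b 1)]
        rw [map_param]
        simp only [Finset.sum_apply, Pi.smul_apply, Matrix.of_apply, smul_eq_mul]
        exact Finset.sum_congr rfl fun n _ => by ring
      · rw [Matrix.updateRow_ne ha, Matrix.of_apply, Function.update_of_ne ha, Matrix.of_apply]
    have hne := abs_ne_zero.2 (A.slopeAt_ne X m)
    rw [hmat, Matrix.det_updateRow_sum, smul_eq_mul, abs_mul, abs_div]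
    change _ / _ * A.absDet X * _ = _
    field_simp
  · intro a
    rcases eq_or_ne a m with rfl | ha
    · rw [Function.update_self]; exact Finset.mem_insert_self _ _
    · rw [Function.update_of_ne ha]
      exact Finset.mem_insert_of_mem (Finset.mem_erase.2
        ⟨fun h' => ha (idx_injective X h'), idx_mem X a⟩)

theorem abs_domainSign (X : ArrVertex k N) (j : Fin N) : |A.domainSign X j| = 1 := by
  have hs : ∀ a : ℝ, a ≠ 0 → |Real.sign a| = 1 := by
    intro a ha
    rcases lt_or_gt_of_ne ha with h | h
    · simp [Real.sign_of_neg h]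
    · simp [Real.sign_of_pos h]
  rw [domainSign]
  split_ifs with hj
  · exact hs _ (A.l_edge_ne X hj)
  · exact hs _ (A.f_point_ne X hj)

theorem domainSign_mul_self (X : ArrVertex k N) (j : Fin N) :
    A.domainSign X j * A.domainSign X j = 1 := by
  rw [← abs_mul_abs_self, abs_domainSign, one_mul]

theorem sign_mul_self_eq_abs (a : ℝ) : Real.sign a * a = |a| := by
  rcases lt_trichotomy a 0 with h | h | h
  · rw [Real.sign_of_neg h, abs_of_neg h]; ring
  · simp [h]
  · rw [Real.sign_of_pos h, abs_of_pos h]; ring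

theorem domainSign_idx_mul_slopeAt (X : ArrVertex k N) (m : Fin k) :
    A.domainSign X (idx X m) * A.slopeAt X m = |A.slopeAt X m| := by
  rw [domainSign, if_pos (idx_mem X m)]
  exact sign_mul_self_eq_abs _

theorem domainSign_mul_f (X : ArrVertex k N) {j : Fin N} (hj : j ∉ X.1) :
    A.domainSign X j * A.f j (A.point X) = |A.f j (A.point X)| := by
  rw [domainSign, if_neg hj]
  exact sign_mul_self_eq_abs _

end GenericArrangement

/-! ### The integrals in cone coordinates and their independence of ρ -/

namespace GenericArrangement

variable {k N : ℕ} (A : GenericArrangement k N)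

theorem complexifyForm_rot_param (X : ArrVertex k N) (g : (Fin k → ℝ) →ᵃ[ℝ] ℝ) (ρ : ℂ)
    (a : Fin k → ℝ) : complexifyForm g (A.rot X ρ (A.point X + A.param X a)) =
      (g (A.point X) : ℂ) + ρ * (g.linear (A.param X a) : ℂ) := by
  have hre : (fun i => (A.rot X ρ (A.point X + A.param X a) i).re) =
      A.point X + ρ.re • A.param X a := by
    ext i; simp [rot]
  have him : (fun i => (A.rot X ρ (A.point X + A.param X a) i).im) = ρ.im • A.param X a := by
    ext i; simp [rot]
  have hg : g (A.point X + ρ.re • A.param X a) =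
      g (A.point X) + ρ.re * g.linear (A.param X a) := by
    have := g.map_vadd (A.point X) (ρ.re • A.param X a)
    rw [vadd_eq_add, vadd_eq_add, add_comm] at this
    rw [this, map_smul, smul_eq_mul, add_comm]
  rw [complexifyForm, hre, him, hg, map_smul, smul_eq_mul]
  push_cast
  conv_rhs => rw [← Complex.re_add_im ρ]
  ring

/-- The values `|f_j(X)|`. -/
def absAt (X : ArrVertex k N) (j : Fin N) : ℝ := |A.f j (A.point X)|

/-- The signed slopes of the `f_j` along the edges at `X`. -/
def signedSlope (X : ArrVertex k N) (j : Fin N) (m : Fin k) : ℝ :=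
  A.domainSign X j * A.l j (A.edge X m)

theorem absAt_pos (X : ArrVertex k N) : ∀ j ∈ X.1ᶜ, 0 < A.absAt X j := fun _ hj =>
  abs_pos.2 (A.f_point_ne X (Finset.mem_compl.1 hj))

/-- The forms `f_j`, with the signs that make them positive on `Δ_X`, in the linear coordinates of
the cone. -/
def signedForm (X : ArrVertex k N) (ρ : ℂ) (a : Fin k → ℝ) (j : Fin N) : ℂ :=
  (A.domainSign X j : ℂ) * complexifyForm (A.f j) (A.rot X ρ (A.point X + A.param X a))

theorem complexifyForm_eq_signedForm (X : ArrVertex k N) (ρ : ℂ) (a : Fin k → ℝ) (j : Fin N) :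
    complexifyForm (A.f j) (A.rot X ρ (A.point X + A.param X a)) =
      (A.domainSign X j : ℂ) * A.signedForm X ρ a j := by
  rw [signedForm, ← mul_assoc, ← Complex.ofReal_mul, domainSign_mul_self, Complex.ofReal_one,
    one_mul]

theorem signedForm_of_notMem (X : ArrVertex k N) (ρ : ℂ) (a : Fin k → ℝ) {j : Fin N}
    (hj : j ∉ X.1) :
    A.signedForm X ρ a j = outerForm (A.absAt X) (A.signedSlope X) ρ a j := by
  have h : ∑ m, A.signedSlope X j m * a m = A.domainSign X j * A.l j (A.param X a) := by
    rw [map_param, Finset.mul_sum]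
    exact Finset.sum_congr rfl fun m _ => by rw [signedSlope]; ring
  rw [signedForm, complexifyForm_rot_param, outerForm, h, absAt, ← A.domainSign_mul_f X hj]
  push_cast
  rw [l]
  ring

/-- A form through X sees one coordinate only, and the sign of f_j on Δ_X makes its coefficient
positive. The principal power therefore splits into a positive power of a_m and a power of ρ. -/
theorem signedForm_idx (X : ArrVertex k N) (ρ : ℂ) (a : Fin k → ℝ) (m : Fin k) :
    A.signedForm X ρ a (idx X m) = ((|A.slopeAt X m| * a m : ℝ) : ℂ) * ρ := by
  have h := A.l_idx_param X m a
  rw [l] at h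
  rw [signedForm, complexifyForm_rot_param, h, A.point_spec X (idx_mem X m),
    ← A.domainSign_idx_mul_slopeAt X m]
  push_cast
  ring

theorem signedForm_ne_zero (X : ArrVertex k N) {ρ : ℂ} (hρ : ρ.im ≠ 0) {a : Fin k → ℝ}
    (ha : a ∈ posOrthant k) (j : Fin N) : A.signedForm X ρ a j ≠ 0 := by
  by_cases hj : j ∈ X.1
  · rw [← image_idx X] at hj
    obtain ⟨m, -, rfl⟩ := Finset.mem_map.1 hj
    rw [Function.Embedding.coeFn_mk, signedForm_idx]
    refine mul_ne_zero ?_ (by rintro rfl; simp at hρ)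
    exact_mod_cast (mul_pos (abs_pos.2 (A.slopeAt_ne X m)) (ha m)).ne'
  · rw [A.signedForm_of_notMem X ρ a hj]
    exact Complex.slitPlane_ne_zero
      (outerForm_mem_slitPlane (A.absAt_pos X j (Finset.mem_compl.2 hj)) hρ a)

/-- `e^{-λ (f₀ - f₀(X))} ∏_j |f_j|^{β_j}` in the linear coordinates of the cone. -/
def pullback (β : Fin N → ℝ) (X : ArrVertex k N) (lam ρ : ℂ) (a : Fin k → ℝ) : ℂ :=
  Complex.exp (-(lam * ρ) * ((∑ m, a m : ℝ) : ℂ)) * ∏ j, A.signedForm X ρ a j ^ (β j : ℂ)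

/-- The factor that relates `pullback` and `laplaceCore`. -/
def coneFactor (β : Fin N → ℝ) (X : ArrVertex k N) (ρ : ℂ) : ℂ :=
  Complex.exp (((∑ m, (β (idx X m) + 1) : ℝ) : ℂ) * Complex.log ρ) *
    ((∏ m, |A.slopeAt X m| ^ β (idx X m) : ℝ) : ℂ)

/-- `laplaceCore` with the data of the arrangement at `X`. -/
def core (β : Fin N → ℝ) (X : ArrVertex k N) (μ ρ : ℂ) : (Fin k → ℝ) → ℂ :=
  laplaceCore X.1ᶜ (A.absAt X) (A.signedSlope X) (β ∘ idx X) β μ ρ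

/-- The forms through X supply the monomial in a and a power of ρ that leaves the integral; together
with the Jacobian ρ^k this power has exponent ∑(β + 1). -/
theorem pow_mul_pullback (β : Fin N → ℝ) (X : ArrVertex k N) (lam : ℂ) {ρ : ℂ} (hρ : ρ ≠ 0)
    {a : Fin k → ℝ} (ha : a ∈ posOrthant k) :
    ρ ^ k * A.pullback β X lam ρ a = A.coneFactor β X ρ * A.core β X (lam * ρ) ρ a := by
  have h1 : ∏ j ∈ X.1, A.signedForm X ρ a j ^ (β j : ℂ) =
      ((∏ m, |A.slopeAt X m| ^ β (idx X m) : ℝ) : ℂ) * ((∏ m, a m ^ β (idx X m) : ℝ) : ℂ) *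
        Complex.exp (((∑ m, β (idx X m) : ℝ) : ℂ) * Complex.log ρ) := by
    rw [← prod_idx X fun j => A.signedForm X ρ a j ^ (β j : ℂ)]
    push_cast
    rw [Finset.sum_mul, Complex.exp_sum, ← Finset.prod_mul_distrib, ← Finset.prod_mul_distrib]
    refine Finset.prod_congr rfl fun m _ => ?_
    have hs := abs_pos.2 (A.slopeAt_ne X m)
    rw [signedForm_idx, Complex.ofReal_mul_cpow (mul_pos hs (ha m)) hρ,
      ← Complex.ofReal_cpow (mul_pos hs (ha m)).le, Real.mul_rpow hs.le (ha m).le,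
      Complex.cpow_def_of_ne_zero hρ, mul_comm (Complex.log ρ)]
    push_cast
    ring
  have h2 : ∏ j ∈ X.1ᶜ, A.signedForm X ρ a j ^ (β j : ℂ) =
      ∏ j ∈ X.1ᶜ, outerForm (A.absAt X) (A.signedSlope X) ρ a j ^ (β j : ℂ) :=
    Finset.prod_congr rfl fun j hj => by rw [A.signedForm_of_notMem X ρ a (Finset.mem_compl.1 hj)]
  have h3 : Complex.exp (((∑ m, (β (idx X m) + 1) : ℝ) : ℂ) * Complex.log ρ) =
      ρ ^ k * Complex.exp (((∑ m, β (idx X m) : ℝ) : ℂ) * Complex.log ρ) := by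
    rw [Finset.sum_add_distrib]
    simp only [Finset.sum_const, Finset.card_univ, Fintype.card_fin, nsmul_eq_mul, mul_one]
    push_cast
    rw [add_mul, Complex.exp_add, mul_comm, Complex.exp_nat_mul, Complex.exp_log hρ]
  rw [pullback, ← Finset.prod_mul_prod_compl X.1, h1, h2, coneFactor, h3, core, laplaceCore]
  simp only [Function.comp_apply]
  ring

/-- The exponents `α_j - 1` for `j ∈ U` and `α_j` for `j ∉ U`. -/
def lower (α : Fin N → ℝ) (U : Finset (Fin N)) (j : Fin N) : ℝ := if j ∈ U then α j - 1 else α j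

theorem neg_one_lt_lower {α : Fin N → ℝ} (hα : ∀ j, 0 < α j) (U : Finset (Fin N)) (j : Fin N) :
    -1 < lower α U j := by
  have := hα j
  rw [lower]; split_ifs <;> linarith

/-- The sign of `∏_{j ∈ U} f_j` on `Δ_X`. -/
def signOn (X : ArrVertex k N) (U : Finset (Fin N)) : ℝ := ∏ j ∈ U, A.domainSign X j

/-- Division by f_j lowers the exponent of f_j by 1. Each f_j is ±1 times its signed form, and the
signs, being their own inverses, collect in `signOn`. -/
theorem prod_signedForm_lower (α : Fin N → ℝ) (X : ArrVertex k N) (U : Finset (Fin N)) {ρ : ℂ}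
    (hρ : ρ.im ≠ 0) {a : Fin k → ℝ} (ha : a ∈ posOrthant k) :
    (∏ j, A.signedForm X ρ a j ^ (α j : ℂ)) /
      ∏ j ∈ U, complexifyForm (A.f j) (A.rot X ρ (A.point X + A.param X a)) =
    (A.signOn X U : ℂ) * ∏ j, A.signedForm X ρ a j ^ (lower α U j : ℂ) := by
  have h1 : ∏ j, A.signedForm X ρ a j ^ (α j : ℂ) =
      (∏ j, A.signedForm X ρ a j ^ (lower α U j : ℂ)) * ∏ j ∈ U, A.signedForm X ρ a j := by
    have hU : ∏ j ∈ U, A.signedForm X ρ a j ^ (α j : ℂ) =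
        (∏ j ∈ U, A.signedForm X ρ a j ^ (lower α U j : ℂ)) * ∏ j ∈ U, A.signedForm X ρ a j := by
      rw [← Finset.prod_mul_distrib]
      refine Finset.prod_congr rfl fun j hj => ?_
      have hne := A.signedForm_ne_zero X hρ ha j
      rw [lower, if_pos hj]
      push_cast
      rw [Complex.cpow_sub _ _ hne, Complex.cpow_one, div_mul_cancel₀ _ hne]
    have hUc : ∏ j ∈ Uᶜ, A.signedForm X ρ a j ^ (α j : ℂ) =
        ∏ j ∈ Uᶜ, A.signedForm X ρ a j ^ (lower α U j : ℂ) :=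
      Finset.prod_congr rfl fun j hj => by rw [lower, if_neg (Finset.mem_compl.1 hj)]
    rw [← Finset.prod_mul_prod_compl U, hU, hUc,
      ← Finset.prod_mul_prod_compl U fun j => A.signedForm X ρ a j ^ (lower α U j : ℂ)]
    ring
  have h2 : ∏ j ∈ U, complexifyForm (A.f j) (A.rot X ρ (A.point X + A.param X a)) =
      (A.signOn X U : ℂ) * ∏ j ∈ U, A.signedForm X ρ a j := by
    rw [signOn, Complex.ofReal_prod, ← Finset.prod_mul_distrib]
    exact Finset.prod_congr rfl fun j _ => A.complexifyForm_eq_signedForm X ρ a j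
  have hs : A.signOn X U * A.signOn X U = 1 := by
    rw [signOn, ← Finset.prod_mul_distrib]
    exact Finset.prod_eq_one fun j _ => A.domainSign_mul_self X j
  have hs' : (A.signOn X U : ℂ) * (A.signOn X U : ℂ) = 1 := by exact_mod_cast hs
  have hne : ∏ j ∈ U, A.signedForm X ρ a j ≠ 0 :=
    Finset.prod_ne_zero_iff.2 fun j _ => A.signedForm_ne_zero X hρ ha j
  have hs0 : (A.signOn X U : ℂ) ≠ 0 := left_ne_zero_of_mul_eq_one hs'
  rw [h1, h2, div_eq_iff (mul_ne_zero hs0 hne)]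
  linear_combination (-(∏ j, A.signedForm X ρ a j ^ (lower α U j : ℂ)) *
    ∏ j ∈ U, A.signedForm X ρ a j) * hs'

/-- The constant that relates `rhoIntegral` and `coneIntegral`. -/
def prefactor (X X' : ArrVertex k N) (lam : ℂ) : ℂ :=
  (A.coneVolume X : ℂ) * (Complex.exp (-lam * (A.f0 (A.point X) : ℂ)) * (A.absDet X' : ℂ) *
    (A.signOn X X'.1 : ℂ))

theorem integrand_param (α : Fin N → ℝ) {ρ : ℂ} (hρ : ρ.im ≠ 0) (X X' : ArrVertex k N) (lam : ℂ)
    {a : Fin k → ℝ} (ha : a ∈ posOrthant k) :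
    A.integrand α ρ X X' lam (A.point X + A.param X a) =
      (Complex.exp (-lam * (A.f0 (A.point X) : ℂ)) * (A.absDet X' : ℂ) * (A.signOn X X'.1 : ℂ)) *
        (ρ ^ k * A.pullback (lower α X'.1) X lam ρ a) := by
  have hexp : Complex.exp (-lam * complexifyForm A.f0.toAffineMap
      (A.rot X ρ (A.point X + A.param X a))) = Complex.exp (-lam * (A.f0 (A.point X) : ℂ)) *
        Complex.exp (-(lam * ρ) * ((∑ m, a m : ℝ) : ℂ)) := by
    rw [complexifyForm_rot_param, LinearMap.toAffineMap_linear, f0_param, ← Complex.exp_add,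
      LinearMap.coe_toAffineMap]
    ring_nf
  have hb : A.branch α X (A.rot X ρ (A.point X + A.param X a)) =
      ∏ j, A.signedForm X ρ a j ^ (α j : ℂ) := rfl
  have hom : A.omega X' (A.rot X ρ (A.point X + A.param X a)) = (A.absDet X' : ℂ) /
      ∏ j ∈ X'.1, complexifyForm (A.f j) (A.rot X ρ (A.point X + A.param X a)) := rfl
  have h := A.prod_signedForm_lower α X X'.1 hρ ha
  rw [integrand, hexp, hb, hom, pullback]
  calc _ = Complex.exp (-lam * (A.f0 (A.point X) : ℂ)) *
        Complex.exp (-(lam * ρ) * ((∑ m, a m : ℝ) : ℂ)) * (A.absDet X' : ℂ) * ρ ^ k *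
        ((∏ j, A.signedForm X ρ a j ^ (α j : ℂ)) /
      ∏ j ∈ X'.1, complexifyForm (A.f j) (A.rot X ρ (A.point X + A.param X a))) := by ring
    _ = _ := by rw [h]; ring

/-- `∫ e^{-λ (f₀ - f₀(X))} ∏_j |f_j|^{β_j}` over the orthant of the linear coordinates. -/
def coneIntegral (β : Fin N → ℝ) (X : ArrVertex k N) (lam ρ : ℂ) : ℂ :=
  A.coneFactor β X ρ * ∫ a in posOrthant k, A.core β X (lam * ρ) ρ a

theorem integrableOn_core {β : Fin N → ℝ} (hβ : ∀ j, -1 < β j) (X : ArrVertex k N) {μ ρ : ℂ}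
    (hμ : 0 < μ.re) (hρ : ρ.im ≠ 0) : IntegrableOn (A.core β X μ ρ) (posOrthant k) :=
  integrableOn_laplaceCore (A.absAt_pos X) (fun _ => hβ _) hμ hρ

theorem ne_zero_of_im_ne_zero {ρ : ℂ} (hρ : ρ.im ≠ 0) : ρ ≠ 0 := by rintro rfl; simp at hρ

theorem integrableOn_pow_mul_pullback {β : Fin N → ℝ} (hβ : ∀ j, -1 < β j) (X : ArrVertex k N)
    {lam ρ : ℂ} (hl : 0 < (lam * ρ).re) (hρ : ρ.im ≠ 0) :
    IntegrableOn (fun a => ρ ^ k * A.pullback β X lam ρ a) (posOrthant k) :=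
  IntegrableOn.congr_fun ((A.integrableOn_core hβ X hl hρ).const_mul (A.coneFactor β X ρ))
    (fun _ ha => (A.pow_mul_pullback β X lam (ne_zero_of_im_ne_zero hρ) ha).symm)
    (measurableSet_posOrthant k)

theorem integral_pow_mul_pullback (β : Fin N → ℝ) (X : ArrVertex k N) (lam : ℂ) {ρ : ℂ}
    (hρ : ρ.im ≠ 0) :
    ∫ a in posOrthant k, ρ ^ k * A.pullback β X lam ρ a = A.coneIntegral β X lam ρ := by
  rw [setIntegral_congr_fun (measurableSet_posOrthant k)
    (fun _ ha => A.pow_mul_pullback β X lam (ne_zero_of_im_ne_zero hρ) ha), integral_const_mul,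
    coneIntegral]

theorem rhoIntegral_eq (α : Fin N → ℝ) {ρ : ℂ} (hρ : ρ.im ≠ 0) (X X' : ArrVertex k N) (lam : ℂ) :
    A.rhoIntegral α ρ X X' lam =
      A.prefactor X X' lam * A.coneIntegral (lower α X'.1) X lam ρ := by
  rw [rhoIntegral, setIntegral_cone, setIntegral_congr_fun (measurableSet_posOrthant k)
    (fun _ ha => A.integrand_param α hρ X X' lam ha), integral_const_mul,
    A.integral_pow_mul_pullback _ _ _ hρ, prefactor]
  ring

theorem integrableOn_integrand {α : Fin N → ℝ} (hα : ∀ j, 0 < α j) {ρ : ℂ} (hρ : ρ.im ≠ 0)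
    (X X' : ArrVertex k N) {lam : ℂ} (hl : 0 < (lam * ρ).re) :
    IntegrableOn (A.integrand α ρ X X' lam) (A.cone X) := by
  refine A.integrableOn_cone X ?_
  exact IntegrableOn.congr_fun
    ((A.integrableOn_pow_mul_pullback (neg_one_lt_lower hα X'.1) X hl hρ).const_mul _) (fun _ ha => (A.integrand_param α hρ X X' lam ha).symm) (measurableSet_posOrthant k)

/-- A positive dilation of ρ is a change of variables in the cone: the power of t from `coneFactor`
cancels the one from the integral. -/
theorem coneIntegral_smul (β : Fin N → ℝ) (X : ArrVertex k N) (lam : ℂ) {ρ : ℂ} (hρ : ρ ≠ 0)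
    {t : ℝ} (ht : 0 < t) : A.coneIntegral β X lam (t * ρ) = A.coneIntegral β X lam ρ := by
  have h1 : A.coneFactor β X (t * ρ) =
      ((t ^ (∑ m, (β (idx X m) + 1)) : ℝ) : ℂ) * A.coneFactor β X ρ := by
    rw [coneFactor, Complex.log_ofReal_mul ht hρ, mul_add, Complex.exp_add, coneFactor,
      Real.rpow_def_of_pos ht]
    push_cast
    ring_nf
  have h2 : (t ^ (∑ m, (β (idx X m) + 1)) : ℝ) * t ^ (-(∑ m, (β (idx X m) + 1))) = 1 := by
    rw [← Real.rpow_add ht, add_neg_cancel, Real.rpow_zero]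
  have h2' : ((t ^ (∑ m, (β (idx X m) + 1)) : ℝ) : ℂ) *
      ((t ^ (-(∑ m, (β (idx X m) + 1))) : ℝ) : ℂ) = 1 := by exact_mod_cast h2
  have h3 : lam * (t * ρ) = t * (lam * ρ) := by ring
  have h4 := integral_laplaceCore_smul (S := X.1ᶜ) (q := A.absAt X) (b := A.signedSlope X)
    (γ := β ∘ idx X) (β := β) ht (lam * ρ) ρ
  simp only [Function.comp_apply] at h4
  rw [coneIntegral, h1, h3, core, h4, coneIntegral, core]
  linear_combination (A.coneFactor β X ρ * ∫ a in posOrthant k, laplaceCore X.1ᶜ (A.absAt X)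
    (A.signedSlope X) (β ∘ idx X) β (lam * ρ) ρ a) * h2'

/-- This replaces Cauchy's theorem for the rotation of the cone. The conditions on ρ cut out an open
convex cone without 0, on which the integral is holomorphic in ρ and constant along rays. -/
theorem coneIntegral_eq {β : Fin N → ℝ} (hβ : ∀ j, -1 < β j) (X : ArrVertex k N) (lam : ℂ) {σ : ℝ}
    {ρ ρ' : ℂ} (h : σ * ρ.im < 0 ∧ 0 < (lam * ρ).re) (h' : σ * ρ'.im < 0 ∧ 0 < (lam * ρ').re) :
    A.coneIntegral β X lam ρ = A.coneIntegral β X lam ρ' := by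
  have him : ∀ ρ : ℂ, σ * ρ.im < 0 → ρ.im ≠ 0 := fun ρ h h0 => by simp [h0] at h
  refine eq_of_differentiableOn_of_homogeneous (U := {ρ | σ * ρ.im < 0 ∧ 0 < (lam * ρ).re})
    ?_ ?_ (by simp) (fun ρ hρ => ?_) (fun ρ hρ t ht => ?_) h h'
  · exact (isOpen_lt (continuous_const.mul Complex.continuous_im) continuous_const).inter
      (isOpen_lt continuous_const (Complex.continuous_re.comp (continuous_const_mul lam)))
  · intro x hx y hy s t hs ht hst
    simp only [Set.mem_ofPred_eq, Complex.add_im, Complex.real_smul, Complex.im_ofReal_mul, mul_add,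
      mul_left_comm lam, Complex.add_re, Complex.re_ofReal_mul] at hx hy ⊢
    constructor
    · rcases hs.eq_or_lt with rfl | hs
      · have : t = 1 := by linarith
        subst this; linarith [hy.1]
      · nlinarith [mul_pos_of_neg_of_neg hx.1 (neg_lt_zero.2 hs), mul_nonneg ht (neg_nonneg.2 hy.1.le)]
    · rcases hs.eq_or_lt with rfl | hs
      · have : t = 1 := by linarith
        subst this; linarith [hy.2]
      · have := mul_pos hs hx.2
        have := mul_nonneg ht hy.2.le
        linarith
  · have hne := him ρ hρ.1
    have h1 := (hasDerivAt_integral_laplaceCore (β := β) (A.absAt_pos X) (b := A.signedSlope X)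
      (γ := β ∘ idx X) (fun m => hβ _) (u := fun z => lam * z) (v := fun z => z)
      (by fun_prop) (by fun_prop) hρ.2 hne).differentiableAt
    have h2 : DifferentiableAt ℂ Complex.log ρ :=
      Complex.differentiableAt_log (Complex.mem_slitPlane_iff.2 (Or.inr hne))
    refine (DifferentiableAt.mul ?_ h1).differentiableWithinAt
    unfold coneFactor
    fun_prop
  · exact A.coneIntegral_smul β X lam (ne_zero_of_im_ne_zero (him ρ hρ.1)) ht

/-- Independence of ρ provides a common value for `Classical.epsilon`, and a single admissible ρ
determines it. -/
theorem solution_eq {α : Fin N → ℝ} (hα : ∀ j, 0 < α j) {σ : ℝ} (X X' : ArrVertex k N) {lam ρ : ℂ}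
    (h : Admissible σ lam ρ) : A.solution α σ X lam X' = A.rhoIntegral α ρ X X' lam := by
  have him : ∀ ρ : ℂ, σ * ρ.im < 0 → ρ.im ≠ 0 := fun ρ h h0 => by simp [h0] at h
  have key : ∀ ρ', Admissible σ lam ρ' →
      A.rhoIntegral α ρ' X X' lam = A.rhoIntegral α ρ X X' lam := by
    intro ρ' h'
    rw [A.rhoIntegral_eq α (him _ h.2.1), A.rhoIntegral_eq α (him _ h'.2.1),
      A.coneIntegral_eq (neg_one_lt_lower hα X'.1) X lam (σ := σ) (ρ := ρ') (ρ' := ρ)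
        ⟨h'.2.1, by rw [mul_comm]; exact h'.2.2⟩ ⟨h.2.1, by rw [mul_comm]; exact h.2.2⟩]
  have hex : ∃ c : ℂ, ∀ ρ, Admissible σ lam ρ → A.rhoIntegral α ρ X X' lam = c := ⟨_, key⟩
  exact (Classical.epsilon_spec hex ρ h).symm

end GenericArrangement

/-! ### Integration by parts along an edge direction -/

theorem laplaceCore_congr {ι : Type*} {k : ℕ} {S : Finset ι} {q : ι → ℝ} {b : ι → Fin k → ℝ}
    {γ γ' : Fin k → ℝ} {β β' : ι → ℝ} (hγ : γ = γ') (hβ : ∀ i ∈ S, β i = β' i) (μ ρ : ℂ) :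
    laplaceCore S q b γ β μ ρ = laplaceCore S q b γ' β' μ ρ := by
  ext a
  rw [laplaceCore, laplaceCore, hγ]
  congr 1
  exact Finset.prod_congr rfl fun i hi => by rw [hβ i hi]

namespace GenericArrangement

variable {k N : ℕ} (A : GenericArrangement k N)

theorem coneFactor_insert_of_notMem (α : Fin N → ℝ) (X : ArrVertex k N) (U : Finset (Fin N)) (ρ : ℂ)
    {i : Fin N} (hi : i ∉ X.1) :
    A.coneFactor (lower α (insert i U)) X ρ = A.coneFactor (lower α U) X ρ := by
  have h : ∀ m, lower α (insert i U) (idx X m) = lower α U (idx X m) := by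
    intro m
    have : idx X m ≠ i := fun h => hi (h ▸ idx_mem X m)
    simp [lower, this]
  simp only [coneFactor, h]

theorem lower_insert_idx (α : Fin N → ℝ) (X : ArrVertex k N) {U : Finset (Fin N)} {m : Fin k}
    (hm : idx X m ∉ U) :
    lower α (insert (idx X m) U) ∘ idx X = lower α U ∘ idx X - Pi.single m 1 := by
  ext n
  rcases eq_or_ne n m with rfl | hn
  · simp [lower, hm]
  · have : idx X n ≠ idx X m := fun h => hn (idx_injective X h)
    simp [lower, hn, this]

/-- One more factor of the signed form |l_{j_m}(e)| a_m ρ in the integrand: its constant part goes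
into `coneFactor`, and a_m goes into the monomial. -/
theorem coneFactor_insert_idx (α : Fin N → ℝ) (X : ArrVertex k N) {U : Finset (Fin N)} {ρ : ℂ}
    (hρ : ρ ≠ 0) {m : Fin k} (hm : idx X m ∉ U) :
    A.coneFactor (lower α U) X ρ =
      ρ * (|A.slopeAt X m| : ℝ) * A.coneFactor (lower α (insert (idx X m) U)) X ρ := by
  have h : ∀ n, lower α U (idx X n) =
      lower α (insert (idx X m) U) (idx X n) + if n = m then 1 else 0 := by
    intro n
    have := congrFun (lower_insert_idx α X hm) n
    simp only [Function.comp_apply, Pi.sub_apply, Pi.single_apply] at this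
    rw [this]; ring
  have h1 : ∑ n, (lower α U (idx X n) + 1) =
      1 + ∑ n, (lower α (insert (idx X m) U) (idx X n) + 1) := by
    simp only [h]
    rw [show (1 : ℝ) = ∑ n, if n = m then 1 else 0 by simp, ← Finset.sum_add_distrib]
    exact Finset.sum_congr rfl fun n _ => by simp; ring
  have h2 : ∏ n, |A.slopeAt X n| ^ lower α U (idx X n) =
      |A.slopeAt X m| * ∏ n, |A.slopeAt X n| ^ lower α (insert (idx X m) U) (idx X n) := by
    have h3 : ∀ n, |A.slopeAt X n| ^ lower α U (idx X n) =
        (if n = m then |A.slopeAt X m| else 1) *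
          |A.slopeAt X n| ^ lower α (insert (idx X m) U) (idx X n) := by
      intro n
      rw [h n, Real.rpow_add (abs_pos.2 (A.slopeAt_ne X n)), mul_comm]
      split_ifs with hn
      · rw [hn, Real.rpow_one]
      · rw [Real.rpow_zero]
    simp only [h3, Finset.prod_mul_distrib]
    simp
  rw [coneFactor, h1, h2, coneFactor]
  push_cast
  rw [add_mul, Complex.exp_add, one_mul, Complex.exp_log hρ]
  ring

/-- The integral of the derivative of e^{-λ f₀} ∏ f_j^β along e_U vanishes. Here f₀ has derivative
1, the forms in U have derivative 0, and any other f_r contributes its logarithmic derivative α_r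
l_r(e_U) / f_r. The direction e_U is decomposed along the edges at X, and
`integral_laplaceCore_by_parts` is used for each coordinate. -/
theorem coneIntegral_by_parts {α : Fin N → ℝ} (hα : ∀ j, 0 < α j) {U : Finset (Fin N)}
    (hU : U.card + 1 = k) (X : ArrVertex k N) {lam ρ : ℂ} (hl : 0 < (lam * ρ).re)
    (hρ : ρ.im ≠ 0) :
    lam * A.coneIntegral (lower α U) X lam ρ =
      ∑ r, ((α r * (A.domainSign X r * A.l r (A.edgeVec U)) : ℝ) : ℂ) *
        A.coneIntegral (lower α (insert r U)) X lam ρ := by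
  have hρ0 := ne_zero_of_im_ne_zero hρ
  obtain ⟨hlU, hf0⟩ := A.edgeVec_spec U hU
  set e := A.edgeVec U
  set τ : Fin k → ℝ := fun m => A.l (idx X m) e / A.slopeAt X m with hτ
  have hpar : A.param X τ = e := A.param_expand X e
  have hsum : ∑ m, τ m = 1 := by rw [← f0_param, hpar, hf0]
  have hslope : ∀ i, ∑ m, A.signedSlope X i m * τ m = A.domainSign X i * A.l i e := by
    intro i
    rw [← hpar, map_param, Finset.mul_sum]
    exact Finset.sum_congr rfl fun m _ => by rw [signedSlope]; ring
  set V : Finset (Fin N) → ℂ := fun T =>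
    ∫ a in posOrthant k, A.core (lower α T) X (lam * ρ) ρ a with hV
  set W : Fin N → ℂ := fun i => ∫ a in posOrthant k, laplaceCore X.1ᶜ (A.absAt X) (A.signedSlope X)
    (lower α U ∘ idx X) (lower α U - Pi.single i 1) (lam * ρ) ρ a with hW
  have hm : ∀ m, (τ m : ℂ) * (α (idx X m) * V (insert (idx X m) U) - lam * ρ * V U +
      ∑ i ∈ X.1ᶜ, lower α U i * ρ * A.signedSlope X i m * W i) = 0 := by
    intro m
    -- On a face where the exponent is α - 1, integration by parts could fail; but then j_m ∈ U and
    -- e_U has no component τ_m. The remaining faces have exponent α > 0.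
    by_cases hmU : idx X m ∈ U
    · have : τ m = 0 := by simp [hτ, hlU _ hmU]
      simp [this]
    · have hg : lower α U (idx X m) = α (idx X m) := if_neg hmU
      have h := integral_laplaceCore_by_parts (β := lower α U) (γ := lower α U ∘ idx X)
        (A.absAt_pos X) (b := A.signedSlope X) (fun m => neg_one_lt_lower hα U _) hl hρ (m := m)
        (by rw [Function.comp_apply, hg]; exact hα _)
      rw [Function.comp_apply, hg, ← lower_insert_idx α X hmU] at h
      have hc : laplaceCore X.1ᶜ (A.absAt X) (A.signedSlope X)
          (lower α (insert (idx X m) U) ∘ idx X) (lower α U) (lam * ρ) ρ =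
          A.core (lower α (insert (idx X m) U)) X (lam * ρ) ρ := by
        refine laplaceCore_congr rfl (fun i hi => ?_) _ _
        have : i ≠ idx X m := fun h => (Finset.mem_compl.1 hi) (h ▸ idx_mem X m)
        simp [lower, this]
      rw [hc] at h
      rw [mul_eq_zero]
      exact Or.inr h
  have hVW : ∀ i ∈ X.1ᶜ, i ∉ U → W i = V (insert i U) := by
    intro i hi hiU
    have hc : laplaceCore X.1ᶜ (A.absAt X) (A.signedSlope X) (lower α U ∘ idx X)
        (lower α U - Pi.single i 1) (lam * ρ) ρ = A.core (lower α (insert i U)) X (lam * ρ) ρ := by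
      refine laplaceCore_congr ?_ (fun j hj => ?_) _ _
      · ext m
        have : idx X m ≠ i := fun h => (Finset.mem_compl.1 hi) (h ▸ idx_mem X m)
        simp [lower, this]
      · rcases eq_or_ne j i with rfl | hji
        · simp [lower, hiU]
        · simp [lower, hji]
    simp only [hW, hc, hV]
  have htot := Finset.sum_eq_zero fun m (_ : m ∈ Finset.univ) => hm m
  simp only [mul_add, mul_sub, Finset.sum_add_distrib, Finset.sum_sub_distrib] at htot
  have h2 : ∑ m, (τ m : ℂ) * (lam * ρ * V U) = lam * ρ * V U := by
    rw [← Finset.sum_mul, ← Complex.ofReal_sum, hsum, Complex.ofReal_one, one_mul]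
  have h3 : ∑ m, (τ m : ℂ) * ∑ i ∈ X.1ᶜ, lower α U i * ρ * A.signedSlope X i m * W i =
      ∑ i ∈ X.1ᶜ, ((α i * (A.domainSign X i * A.l i e) : ℝ) : ℂ) * ρ * V (insert i U) := by
    simp only [Finset.mul_sum]
    rw [Finset.sum_comm]
    refine Finset.sum_congr rfl fun i hi => ?_
    have h4 : ∑ m, (τ m : ℂ) * (lower α U i * ρ * A.signedSlope X i m * W i) =
        ((lower α U i * (A.domainSign X i * A.l i e) : ℝ) : ℂ) * ρ * W i := by
      rw [← hslope i]
      push_cast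
      rw [Finset.mul_sum, Finset.sum_mul, Finset.sum_mul]
      exact Finset.sum_congr rfl fun m _ => by ring
    rw [h4]
    -- For i ∈ U the exponent in `W i` has been lowered twice, so it is no `V`; the coefficient
    -- l_i(e_U) = 0 removes the term.
    by_cases hiU : i ∈ U
    · simp [hlU i hiU]
    · rw [hVW i hi hiU, lower, if_neg hiU]
  rw [h2, h3] at htot
  have h5 : ∀ m, A.coneFactor (lower α U) X ρ * ((τ m : ℂ) * (α (idx X m) * V (insert (idx X m) U))) =
      ρ * (((α (idx X m) * (A.domainSign X (idx X m) * A.l (idx X m) e) : ℝ) : ℂ) *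
        A.coneIntegral (lower α (insert (idx X m) U)) X lam ρ) := by
    intro m
    by_cases hmU : idx X m ∈ U
    · simp [hτ, hlU _ hmU]
    · have hd : τ m * |A.slopeAt X m| = A.domainSign X (idx X m) * A.l (idx X m) e := by
        have := A.slopeAt_ne X m
        rw [← domainSign_idx_mul_slopeAt, hτ]
        field_simp
      rw [A.coneFactor_insert_idx α X hρ0 hmU, ← hd, coneIntegral]
      push_cast
      ring
  have h6 : ∀ i ∈ X.1ᶜ, A.coneFactor (lower α U) X ρ *
      (((α i * (A.domainSign X i * A.l i e) : ℝ) : ℂ) * ρ * V (insert i U)) =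
      ρ * (((α i * (A.domainSign X i * A.l i e) : ℝ) : ℂ) *
        A.coneIntegral (lower α (insert i U)) X lam ρ) := by
    intro i hi
    rw [coneIntegral, A.coneFactor_insert_of_notMem α X U ρ (Finset.mem_compl.1 hi)]
    ring
  have h7 := congrArg (fun z => A.coneFactor (lower α U) X ρ * z) htot
  simp only [mul_add, mul_sub, mul_zero] at h7
  rw [Finset.mul_sum, Finset.mul_sum, Finset.sum_congr rfl fun m _ => h5 m,
    Finset.sum_congr rfl h6, ← Finset.mul_sum, ← Finset.mul_sum,
    sum_idx X fun r => ((α r * (A.domainSign X r * A.l r e) : ℝ) : ℂ) *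
        A.coneIntegral (lower α (insert r U)) X lam ρ] at h7
  rw [← Finset.sum_add_sum_compl X.1]
  refine mul_left_cancel₀ hρ0 ?_
  rw [coneIntegral]
  linear_combination -h7

end GenericArrangement

/-! ### The differential equation -/

namespace GenericArrangement

variable {k N : ℕ} (A : GenericArrangement k N)

theorem sign_mul_self_eq_one {a : ℝ} (ha : a ≠ 0) : Real.sign (a * a) = 1 :=
  Real.sign_of_pos (mul_self_pos.2 ha)

/-- The entries of `matB` by the exchanges of one element. -/
theorem matB_apply (α : Fin N → ℝ) (X Y : ArrVertex k N) :
    A.matB α X Y = ∑ j ∈ X.1, ∑ r ∈ (X.1.erase j)ᶜ, if insert r (X.1.erase j) = Y.1 then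
      ((Real.sign (A.l j (A.edgeVec (X.1.erase j)) * A.l r (A.edgeVec (X.1.erase j))) * α r : ℝ) : ℂ)
      else 0 := by
  rw [matB, Matrix.of_apply]
  split_ifs with hXY hcard
  · subst hXY
    rw [weight, Complex.ofReal_sum]
    refine Finset.sum_congr rfl fun j hj => ?_
    rw [Finset.sum_eq_single j, if_pos (Finset.insert_erase hj),
      sign_mul_self_eq_one (A.l_edge_ne X hj), one_mul]
    · intro r hr hrj
      refine if_neg fun h => ?_
      have h1 : r ∈ X.1 := h ▸ Finset.mem_insert_self _ _
      exact (Finset.mem_compl.1 hr) (Finset.mem_erase.2 ⟨hrj, h1⟩)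
    · intro h
      exact absurd (Finset.mem_compl.2 (Finset.notMem_erase j X.1)) h
  · have hc1 := Finset.card_sdiff_add_card_inter X.1 Y.1
    have hc2 := Finset.card_sdiff_add_card_inter Y.1 X.1
    rw [Finset.inter_comm] at hc2
    rw [X.2] at hc1
    rw [Y.2] at hc2
    obtain ⟨j₀, hj₀⟩ := Finset.card_eq_one.1 (show (X.1 \ Y.1).card = 1 by omega)
    obtain ⟨r₀, hr₀⟩ := Finset.card_eq_one.1 (show (Y.1 \ X.1).card = 1 by omega)
    have hj : ∀ x, (x ∈ X.1 ∧ x ∉ Y.1) ↔ x = j₀ := fun x => by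
      rw [← Finset.mem_sdiff, hj₀, Finset.mem_singleton]
    have hr : ∀ x, (x ∈ Y.1 ∧ x ∉ X.1) ↔ x = r₀ := fun x => by
      rw [← Finset.mem_sdiff, hr₀, Finset.mem_singleton]
    have hjm := (hj j₀).2 rfl
    have hrm := (hr r₀).2 rfl
    have hint : X.1 ∩ Y.1 = X.1.erase j₀ := by
      ext x
      have := hj x
      simp only [Finset.mem_inter, Finset.mem_erase]
      tauto
    have hins : insert r₀ (X.1.erase j₀) = Y.1 := by
      ext x
      have h1 := hj x
      have h2 := hr x
      simp only [Finset.mem_insert, Finset.mem_erase]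
      tauto
    rw [hj₀, hr₀, Finset.sum_singleton, Finset.sum_singleton, hint,
      Finset.sum_eq_single_of_mem j₀ hjm.1, Finset.sum_eq_single_of_mem r₀, if_pos hins]
    · exact Finset.mem_compl.2 fun h => hrm.2 (Finset.mem_of_mem_erase h)
    · intro r _ hne
      refine if_neg fun h => ?_
      have := h ▸ hrm.1
      rcases Finset.mem_insert.1 this with h' | h'
      · exact hne h'.symm
      · exact hrm.2 (Finset.mem_of_mem_erase h')
    · intro j _ hne
      refine Finset.sum_eq_zero fun r _ => if_neg fun h => hjm.2 ?_
      rw [← h]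
      exact Finset.mem_insert_of_mem (Finset.mem_erase.2 ⟨hne.symm, hjm.1⟩)
  · symm
    refine Finset.sum_eq_zero fun j hj => Finset.sum_eq_zero fun r hr => if_neg fun h => hcard ?_
    have hrj : r ≠ j := by
      rintro rfl
      rw [Finset.insert_erase hj] at h
      exact hXY (Subtype.ext h)
    have hrX : r ∉ X.1 := fun h' => (Finset.mem_compl.1 hr) (Finset.mem_erase.2 ⟨hrj, h'⟩)
    have hint : X.1 ∩ Y.1 = X.1.erase j := by
      rw [← h]
      ext x
      simp only [Finset.mem_inter, Finset.mem_insert, Finset.mem_erase]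
      constructor
      · rintro ⟨h1, rfl | h2⟩
        · exact absurd h1 hrX
        · exact h2
      · exact fun h => ⟨h.2, Or.inr h⟩
    rw [hint, Finset.card_erase_add_one hj, X.2]

/-- A pair (j, r) determines the vertex Y, so the sum over Y collapses. The extension `G` to all
finite sets spares a cardinality proof inside the sum. -/
theorem matB_mulVec (α : Fin N → ℝ) (X : ArrVertex k N) (g : ArrVertex k N → ℂ)
    (G : Finset (Fin N) → ℂ) (hG : ∀ Y, g Y = G Y.1) :
    (A.matB α).mulVec g X = ∑ m, ∑ r ∈ (X.1.erase (idx X m))ᶜ,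
      ((Real.sign (A.slopeAt X m * A.l r (A.edge X m)) * α r : ℝ) : ℂ) *
        G (insert r (X.1.erase (idx X m))) := by
  rw [Matrix.mulVec, dotProduct]
  simp only [matB_apply, Finset.sum_mul]
  rw [Finset.sum_comm, ← sum_idx X]
  refine Finset.sum_congr rfl fun m _ => ?_
  rw [Finset.sum_comm]
  refine Finset.sum_congr rfl fun r hr => ?_
  rw [Finset.sum_eq_single (exchange X m r (Finset.mem_compl.1 hr))]
  · rw [hG, exchange, if_pos rfl]; rfl
  · intro Y _ hY
    rw [if_neg fun h => hY (Subtype.ext h.symm), zero_mul]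
  · exact fun h => absurd (Finset.mem_univ _) h

theorem f0_sub_point (X : ArrVertex k N) (x : Fin k → ℝ) :
    A.f0 x = A.f0 (A.point X) + ∑ m, A.f (idx X m) x / A.slopeAt X m := by
  have h := A.param_expand X (x - A.point X)
  have h1 := A.f0_param X (fun m => A.l (idx X m) (x - A.point X) / A.slopeAt X m)
  rw [h, map_sub] at h1
  have h2 : ∀ m, A.f (idx X m) x = A.l (idx X m) (x - A.point X) := fun m => by
    rw [A.f_eq _ x (A.point X), A.point_spec X (idx_mem X m), zero_add]
  simp only [h2]
  linarith

/-- On the rotated cone at X, f₀ is expanded about the other vertex X', in the forms f_j with j ∈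
X'. These are the forms in the denominator of the differential form of X'. -/
theorem f0_complex_expand (X X' : ArrVertex k N) (ρ : ℂ) (a : Fin k → ℝ) :
    (A.f0 (A.point X) : ℂ) + ρ * ((∑ m, a m : ℝ) : ℂ) = A.f0 (A.point X') +
      ∑ m, ((A.domainSign X (idx X' m) / A.slopeAt X' m : ℝ) : ℂ) *
        A.signedForm X ρ a (idx X' m) := by
  have h1 : ∀ m, ((A.domainSign X (idx X' m) / A.slopeAt X' m : ℝ) : ℂ) *
      A.signedForm X ρ a (idx X' m) = ((A.f (idx X' m) (A.point X) / A.slopeAt X' m : ℝ) : ℂ) +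
        ρ * ((A.l (idx X' m) (A.param X a) / A.slopeAt X' m : ℝ) : ℂ) := by
    intro m
    have h := A.complexifyForm_eq_signedForm X ρ a (idx X' m)
    rw [complexifyForm_rot_param] at h
    push_cast
    rw [l]
    linear_combination (-1 / (A.slopeAt X' m : ℂ)) * h
  have h2 := A.f0_sub_point X' (A.point X)
  have h3 : ∑ m, a m = ∑ m, A.l (idx X' m) (A.param X a) / A.slopeAt X' m := by
    have h := A.f0_param X' (fun m => A.l (idx X' m) (A.param X a) / A.slopeAt X' m)
    rw [A.param_expand X', f0_param] at h
    exact h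
  simp only [h1, Finset.sum_add_distrib, ← Finset.mul_sum]
  rw [h3, h2]
  push_cast
  ring

theorem signedForm_mul_pullback (α : Fin N → ℝ) (X : ArrVertex k N) {U : Finset (Fin N)} {j : Fin N}
    (hj : j ∈ U) (lam : ℂ) {ρ : ℂ} (hρ : ρ.im ≠ 0) {a : Fin k → ℝ} (ha : a ∈ posOrthant k) :
    A.signedForm X ρ a j * A.pullback (lower α U) X lam ρ a =
      A.pullback (lower α (U.erase j)) X lam ρ a := by
  have hne := A.signedForm_ne_zero X hρ ha j
  have h : ∏ i, A.signedForm X ρ a i ^ (lower α (U.erase j) i : ℂ) =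
      A.signedForm X ρ a j * ∏ i, A.signedForm X ρ a i ^ (lower α U i : ℂ) := by
    rw [← Finset.mul_prod_erase _ _ (Finset.mem_univ j),
      ← Finset.mul_prod_erase _ (fun i => A.signedForm X ρ a i ^ (lower α U i : ℂ))
        (Finset.mem_univ j), ← mul_assoc]
    congr 1
    · have : (lower α (U.erase j) j : ℂ) = 1 + lower α U j := by
        simp [lower, hj]
      rw [this, Complex.cpow_add _ _ hne, Complex.cpow_one]
    · refine Finset.prod_congr rfl fun i hi => ?_
      simp [lower, Finset.ne_of_mem_erase hi]
  rw [pullback, pullback, h]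
  ring

/-- Differentiation brings down -(f₀ - f₀(X)). After expansion about X', the constant part
multiplies the same integral, and each f_j with j ∈ X' cancels one denominator and raises the
exponent α_j - 1 back to α_j. -/
theorem hasDerivAt_coneIntegral {α : Fin N → ℝ} (hα : ∀ j, 0 < α j) (X X' : ArrVertex k N)
    {lam ρ : ℂ} (hl : 0 < (lam * ρ).re) (hρ : ρ.im ≠ 0) :
    HasDerivAt (fun lam => A.coneIntegral (lower α X'.1) X lam ρ)
      ((A.f0 (A.point X) - A.f0 (A.point X')) * A.coneIntegral (lower α X'.1) X lam ρ -
        ∑ m, ((A.domainSign X (idx X' m) / A.slopeAt X' m : ℝ) : ℂ) *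
          A.coneIntegral (lower α (X'.1.erase (idx X' m))) X lam ρ) lam := by
  have hβ := neg_one_lt_lower hα X'.1
  have h1 := hasDerivAt_integral_laplaceCore_left (b := A.signedSlope X) (β := lower α X'.1)
    (γ := lower α X'.1 ∘ idx X) (A.absAt_pos X) (fun m => hβ _) hl hρ
  have h2 : HasDerivAt (fun lam : ℂ => lam * ρ) ρ lam := by
    simpa using (hasDerivAt_id lam).mul_const ρ
  have h3 := (h1.comp lam h2).const_mul (A.coneFactor (lower α X'.1) X ρ)
  refine h3.congr_deriv ?_
  set P : Finset (Fin N) → (Fin k → ℝ) → ℂ := fun U a => ρ ^ k * A.pullback (lower α U) X lam ρ a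
  have hP : ∀ U, IntegrableOn (P U) (posOrthant k) := fun U =>
    A.integrableOn_pow_mul_pullback (neg_one_lt_lower hα U) X hl hρ
  have hPi : ∀ U, ∫ a in posOrthant k, P U a = A.coneIntegral (lower α U) X lam ρ := fun U =>
    A.integral_pow_mul_pullback _ X lam hρ
  have hpt : ∀ a ∈ posOrthant k, A.coneFactor (lower α X'.1) X ρ *
      (-((∑ m, a m : ℝ) : ℂ) * laplaceCore X.1ᶜ (A.absAt X) (A.signedSlope X)
        (lower α X'.1 ∘ idx X) (lower α X'.1) (lam * ρ) ρ a * ρ) =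
      (A.f0 (A.point X) - A.f0 (A.point X')) * P X'.1 a -
        ∑ m, ((A.domainSign X (idx X' m) / A.slopeAt X' m : ℝ) : ℂ) *
          P (X'.1.erase (idx X' m)) a := by
    intro a ha
    have e1 := A.pow_mul_pullback (lower α X'.1) X lam (ne_zero_of_im_ne_zero hρ) ha
    rw [core] at e1
    have e2 := A.f0_complex_expand X X' ρ a
    have e3 : ∑ m, ((A.domainSign X (idx X' m) / A.slopeAt X' m : ℝ) : ℂ) *
        P (X'.1.erase (idx X' m)) a =
        (∑ m, ((A.domainSign X (idx X' m) / A.slopeAt X' m : ℝ) : ℂ) *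
          A.signedForm X ρ a (idx X' m)) * P X'.1 a := by
      rw [Finset.sum_mul]
      refine Finset.sum_congr rfl fun m _ => ?_
      simp only [P]
      rw [← A.signedForm_mul_pullback α X (idx_mem X' m) lam hρ ha]
      ring
    rw [e3]
    change P X'.1 a = _ at e1
    linear_combination ρ * ((∑ m, a m : ℝ) : ℂ) * e1 - P X'.1 a * e2
  rw [← integral_mul_const, ← integral_const_mul,
    setIntegral_congr_fun (measurableSet_posOrthant k) hpt,
    integral_sub ((hP _).const_mul _) (integrable_finsetSum _ fun m _ => (hP _).const_mul _),
    integral_finsetSum _ fun m _ => (hP _).const_mul _]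
  simp only [integral_const_mul, hPi]

theorem signOn_insert (X : ArrVertex k N) {U : Finset (Fin N)} {r : Fin N} (hr : r ∉ U) :
    A.signOn X (insert r U) = A.domainSign X r * A.signOn X U := Finset.prod_insert hr

theorem div_eq_sign_mul (a b : ℝ) : b / a = Real.sign (a * b) * (|b| / |a|) := by
  rcases lt_trichotomy a 0 with ha | rfl | ha
  · rcases lt_trichotomy b 0 with hb | rfl | hb
    · rw [Real.sign_of_pos (mul_pos_of_neg_of_neg ha hb), abs_of_neg ha, abs_of_neg hb]; ring
    · simp
    · rw [Real.sign_of_neg (mul_neg_of_neg_of_pos ha hb), abs_of_neg ha, abs_of_pos hb]; ring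
  · simp
  · rcases lt_trichotomy b 0 with hb | rfl | hb
    · rw [Real.sign_of_neg (mul_neg_of_pos_of_neg ha hb), abs_of_pos ha, abs_of_neg hb]; ring
    · simp
    · rw [Real.sign_of_pos (mul_pos ha hb), abs_of_pos ha, abs_of_pos hb]; ring

/-- The coefficient 1 / l_j(e) from f₀ meets l_r(e) from the integration by parts. The modulus of
the quotient is the ratio of the two determinants and the signs on Δ_X turn one `signOn` into the
other, so only the sign of l_j(e) l_r(e) is left. -/
theorem exchange_coefficient (X X' : ArrVertex k N) (lam : ℂ) (m : Fin k) {r : Fin N}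
    (hr : r ∉ X'.1.erase (idx X' m)) :
    A.prefactor X X' lam * (((A.domainSign X (idx X' m) / A.slopeAt X' m) *
      (A.domainSign X r * A.l r (A.edge X' m)) : ℝ) : ℂ) =
    ((Real.sign (A.slopeAt X' m * A.l r (A.edge X' m)) : ℝ) : ℂ) *
      A.prefactor X (exchange X' m r hr) lam := by
  have h1 := A.absDet_exchange X' m r hr
  have h2 : A.signOn X X'.1 =
      A.domainSign X (idx X' m) * A.signOn X (X'.1.erase (idx X' m)) := by
    rw [← signOn_insert _ _ (Finset.notMem_erase _ _), Finset.insert_erase (idx_mem X' m)]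
  have h3 : A.signOn X (exchange X' m r hr).1 =
      A.domainSign X r * A.signOn X (X'.1.erase (idx X' m)) := A.signOn_insert X hr
  have h4 := div_eq_sign_mul (A.slopeAt X' m) (A.l r (A.edge X' m))
  have h5 := A.domainSign_mul_self X (idx X' m)
  have hs := abs_ne_zero.2 (A.slopeAt_ne X' m)
  have h6 : A.absDet X' * A.signOn X X'.1 * ((A.domainSign X (idx X' m) / A.slopeAt X' m) *
      (A.domainSign X r * A.l r (A.edge X' m))) =
      Real.sign (A.slopeAt X' m * A.l r (A.edge X' m)) *
        (A.absDet (exchange X' m r hr) * A.signOn X (exchange X' m r hr).1) := by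
    have h7 : A.absDet (exchange X' m r hr) =
        A.absDet X' * (|A.l r (A.edge X' m)| / |A.slopeAt X' m|) := by
      field_simp
      exact h1
    rw [h2, h3, h7]
    calc _ = A.absDet X' * A.signOn X (X'.1.erase (idx X' m)) * A.domainSign X r *
          (A.domainSign X (idx X' m) * A.domainSign X (idx X' m)) *
          (A.l r (A.edge X' m) / A.slopeAt X' m) := by ring
      _ = _ := by rw [h4, h5]; ring
  have h7 := congrArg (fun x : ℝ => (x : ℂ)) h6
  simp only [Complex.ofReal_mul (A.absDet X' * A.signOn X X'.1)] at h7
  rw [prefactor, prefactor]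
  push_cast at h7 ⊢
  linear_combination (A.coneVolume X : ℂ) * Complex.exp (-lam * (A.f0 (A.point X) : ℂ)) * h7

/-- The exponential in `prefactor` contributes -f₀(X), which cancels the f₀(X) from
`hasDerivAt_coneIntegral` and leaves -f₀(X'). The integrals with one denominator removed give the
term with ℬ/λ. -/
theorem hasDerivAt_rhoIntegral {α : Fin N → ℝ} (hα : ∀ j, 0 < α j) (X X' : ArrVertex k N)
    {lam ρ : ℂ} (hl : 0 < (lam * ρ).re) (hρ : ρ.im ≠ 0) :
    HasDerivAt (fun lam => A.rhoIntegral α ρ X X' lam)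
      ((-((A.matA + lam⁻¹ • A.matB α).mulVec fun X' => A.rhoIntegral α ρ X X' lam)) X') lam := by
  have hlam : lam ≠ 0 := by rintro rfl; simp at hl
  have h1 : HasDerivAt (fun lam => A.prefactor X X' lam)
      (-(A.f0 (A.point X) : ℂ) * A.prefactor X X' lam) lam := by
    have h := ((hasDerivAt_neg lam).mul_const (A.f0 (A.point X) : ℂ)).cexp
    have h' := ((h.mul_const (A.absDet X' : ℂ)).mul_const (A.signOn X X'.1 : ℂ)).const_mul
      (A.coneVolume X : ℂ)
    refine h'.congr_deriv ?_
    rw [prefactor]; ring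
  have h2 := h1.fun_mul (A.hasDerivAt_coneIntegral hα X X' hl hρ)
  simp only [← A.rhoIntegral_eq α hρ] at h2
  refine h2.congr_deriv ?_
  -- The value 0 on sets without k elements is never used: every exchange of one element is again a
  -- vertex.
  set G : Finset (Fin N) → ℂ := fun T => if h : T.card = k then
    A.rhoIntegral α ρ X ⟨T, h⟩ lam else 0 with hG
  have hGY : ∀ Y : ArrVertex k N, A.rhoIntegral α ρ X Y lam = G Y.1 := fun Y => by
    simp only [hG]; rw [dif_pos Y.2]
  have hmat : (-((A.matA + lam⁻¹ • A.matB α).mulVec fun X' => A.rhoIntegral α ρ X X' lam)) X' =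
      -((A.f0 (A.point X') : ℂ) * A.rhoIntegral α ρ X X' lam + lam⁻¹ *
        (A.matB α).mulVec (fun X' => A.rhoIntegral α ρ X X' lam) X') := by
    rw [Pi.neg_apply, Matrix.add_mulVec, Pi.add_apply, Matrix.smul_mulVec, Pi.smul_apply, matA,
      Matrix.mulVec_diagonal, smul_eq_mul]
  have hB : (A.matB α).mulVec (fun X' => A.rhoIntegral α ρ X X' lam) X' =
      lam * (A.prefactor X X' lam *
        ∑ m, ((A.domainSign X (idx X' m) / A.slopeAt X' m : ℝ) : ℂ) *
          A.coneIntegral (lower α (X'.1.erase (idx X' m))) X lam ρ) := by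
    rw [A.matB_mulVec α X' _ G hGY, Finset.mul_sum, Finset.mul_sum]
    refine Finset.sum_congr rfl fun m _ => ?_
    have h3 := A.coneIntegral_by_parts hα (card_erase_idx X' m) X hl hρ
    have hz : ∀ r ∈ X'.1.erase (idx X' m), A.l r (A.edge X' m) = 0 := fun r hr =>
      (A.edgeVec_spec _ (card_erase_idx X' m)).1 r hr
    change _ = ∑ r, ((α r * (A.domainSign X r * A.l r (A.edge X' m)) : ℝ) : ℂ) * _ at h3
    rw [← Finset.sum_add_sum_compl (X'.1.erase (idx X' m)), Finset.sum_eq_zero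
      (fun r hr => by rw [hz r hr]; simp), zero_add] at h3
    calc _ = A.prefactor X X' lam * ((A.domainSign X (idx X' m) / A.slopeAt X' m : ℝ) : ℂ) *
          ∑ r ∈ (X'.1.erase (idx X' m))ᶜ,
            ((α r * (A.domainSign X r * A.l r (A.edge X' m)) : ℝ) : ℂ) *
              A.coneIntegral (lower α (insert r (X'.1.erase (idx X' m)))) X lam ρ := by
          rw [Finset.mul_sum]
          refine Finset.sum_congr rfl fun r hr => ?_
          have hr' := Finset.mem_compl.1 hr
          have h4 := A.exchange_coefficient X X' lam m hr'
          have h5 : G (insert r (X'.1.erase (idx X' m))) =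
              A.prefactor X (exchange X' m r hr') lam *
                A.coneIntegral (lower α (insert r (X'.1.erase (idx X' m)))) X lam ρ := by
            have := hGY (exchange X' m r hr')
            rw [A.rhoIntegral_eq α hρ] at this
            exact this.symm
          rw [h5]
          push_cast at h4 ⊢
          linear_combination (-(α r : ℂ) *
            A.coneIntegral (lower α (insert r (X'.1.erase (idx X' m)))) X lam ρ) * h4
      _ = _ := by rw [← h3]; ring
  rw [hmat, hB, inv_mul_cancel_left₀ hlam, A.rhoIntegral_eq α hρ]
  ring

end GenericArrangement

/-! ### Admissible directions and the branch of the logarithm -/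

/-- Half of the angle of `λ` from the middle of the sector. -/
def halfAngle (σ : ℝ) (lam : ℂ) : ℝ := Complex.arg (-(σ * Complex.I * lam)) / 2

/-- A direction that is admissible for `λ`, chosen halfway to the middle of the sector. -/
def midDirection (σ : ℝ) (lam : ℂ) : ℂ :=
  -(σ * Complex.I) * Complex.exp (-(halfAngle σ lam : ℂ) * Complex.I)

section

variable {σ : ℝ} {lam : ℂ}

theorem norm_midDirection (hσ : σ = 1 ∨ σ = -1) (lam : ℂ) : ‖midDirection σ lam‖ = 1 := by
  have h : ‖Complex.exp (-(halfAngle σ lam : ℂ) * Complex.I)‖ = 1 := by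
    rw [← Complex.ofReal_neg]; exact Complex.norm_exp_ofReal_mul_I _
  rw [midDirection, norm_mul, h]
  rcases hσ with rfl | rfl <;> simp

theorem midDirection_im (σ : ℝ) (lam : ℂ) :
    (midDirection σ lam).im = -(σ * Real.cos (halfAngle σ lam)) := by
  have h : ∀ z : ℂ, (-(σ * Complex.I) * z).im = -(σ * z.re) := fun z => by simp
  rw [midDirection, h, ← Complex.ofReal_neg, Complex.exp_ofReal_mul_I_re, Real.cos_neg]

/-- The direction takes away half of the angle of λ from the middle of the sector, so Re(λρ) / |λ|
and |Im ρ| both equal the cosine of `halfAngle` when λ ≠ 0. -/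
theorem mul_midDirection (hσ : σ = 1 ∨ σ = -1) (lam : ℂ) :
    lam * midDirection σ lam = ‖lam‖ * Complex.exp (halfAngle σ lam * Complex.I) := by
  have h := Complex.norm_mul_exp_arg_mul_I (-(σ * Complex.I * lam))
  have hn : ‖-(σ * Complex.I * lam)‖ = ‖lam‖ := by
    rcases hσ with rfl | rfl <;> simp
  have hexp : Complex.exp (Complex.arg (-(σ * Complex.I * lam)) * Complex.I) *
      Complex.exp (-(halfAngle σ lam : ℂ) * Complex.I) =
        Complex.exp (halfAngle σ lam * Complex.I) := by
    rw [← Complex.exp_add, halfAngle]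
    push_cast
    ring_nf
  rw [hn] at h
  rw [← hexp, midDirection]
  linear_combination (-Complex.exp (-(halfAngle σ lam : ℂ) * Complex.I)) * h

theorem abs_halfAngle_le (σ : ℝ) (lam : ℂ) : |halfAngle σ lam| ≤ Real.pi / 2 := by
  have := Complex.abs_arg_le_pi (-(σ * Complex.I * lam))
  rw [halfAngle, abs_div, abs_two]
  linarith

/-- The cut i ℝ_∓ is the ray where -σ i λ ≤ 0; off it the argument of -σ i λ lies strictly between
-π and π. -/
theorem cos_halfAngle_pos (hσ : σ = 1 ∨ σ = -1) (h : lam ∈ slitDomain σ) :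
    0 < Real.cos (halfAngle σ lam) := by
  have hs : -(σ * Complex.I * lam) ∈ Complex.slitPlane := by
    rw [Complex.mem_slitPlane_iff]
    simp only [slitDomain, Set.mem_ofPred_eq, not_and_or, not_le] at h
    have e1 : (-(σ * Complex.I * lam)).re = σ * lam.im := by simp
    have e2 : (-(σ * Complex.I * lam)).im = -(σ * lam.re) := by simp
    rw [e1, e2]
    rcases h with h | h
    · right
      rcases hσ with rfl | rfl <;> simpa using h
    · left; exact h
  have h1 := (Complex.mem_slitPlane_iff_arg.1 hs).1
  have h2 := Complex.neg_pi_lt_arg (-(σ * Complex.I * lam))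
  have h3 := lt_of_le_of_ne (Complex.arg_le_pi (-(σ * Complex.I * lam))) h1
  exact Real.cos_pos_of_mem_Ioo ⟨by rw [halfAngle]; linarith, by rw [halfAngle]; linarith⟩

theorem admissible_midDirection (hσ : σ = 1 ∨ σ = -1) (hlam : lam ≠ 0)
    (h : 0 < Real.cos (halfAngle σ lam)) :
    GenericArrangement.Admissible σ lam (midDirection σ lam) := by
  refine ⟨norm_midDirection hσ lam, ?_, ?_⟩
  · rw [midDirection_im]
    rcases hσ with rfl | rfl <;> linarith
  · rw [mul_comm, mul_midDirection hσ, Complex.re_ofReal_mul, Complex.exp_ofReal_mul_I_re]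
    exact mul_pos (norm_pos_iff.2 hlam) h

/-- The angle -(σπ/2 + ψ), with ψ = `halfAngle`, lies strictly between -π and π, so the principal
logarithm returns it. This matches the powers of ρ with the branch of λ^{-α_X} in the sector. -/
theorem log_midDirection (hσ : σ = 1 ∨ σ = -1) (lam : ℂ) (h : 0 < Real.cos (halfAngle σ lam)) :
    Complex.log (midDirection σ lam) =
      ((-(σ * (Real.pi / 2) + halfAngle σ lam) : ℝ) : ℂ) * Complex.I := by
  have hle := abs_le.1 (abs_halfAngle_le σ lam)
  have hlt : -(Real.pi / 2) < halfAngle σ lam := by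
    refine lt_of_le_of_ne hle.1 fun h0 => ?_
    rw [← h0, Real.cos_neg, Real.cos_pi_div_two] at h
    exact lt_irrefl _ h
  have hlt' : halfAngle σ lam < Real.pi / 2 := by
    refine lt_of_le_of_ne hle.2 fun h0 => ?_
    rw [h0, Real.cos_pi_div_two] at h
    exact lt_irrefl _ h
  have hexp : midDirection σ lam =
      Complex.exp (((-(σ * (Real.pi / 2) + halfAngle σ lam) : ℝ) : ℂ) * Complex.I) := by
    have : ((-(σ * (Real.pi / 2) + halfAngle σ lam) : ℝ) : ℂ) * Complex.I =
        -(σ * (Real.pi / 2) * Complex.I) + -(halfAngle σ lam : ℂ) * Complex.I := by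
      push_cast; ring
    rw [this, Complex.exp_add, midDirection]
    congr 1
    rcases hσ with rfl | rfl
    · rw [show -(((1 : ℝ) : ℂ) * (Real.pi / 2) * Complex.I) = -(Real.pi / 2 * Complex.I) by
        push_cast; ring, Complex.exp_neg, Complex.exp_pi_div_two_mul_I]
      simp
    · rw [show -(((-1 : ℝ) : ℂ) * (Real.pi / 2) * Complex.I) = Real.pi / 2 * Complex.I by
        push_cast; ring, Complex.exp_pi_div_two_mul_I]
      simp
  rw [hexp]
  have him : (((-(σ * (Real.pi / 2) + halfAngle σ lam) : ℝ) : ℂ) * Complex.I).im =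
      -(σ * (Real.pi / 2) + halfAngle σ lam) := by simp
  apply Complex.log_exp
  · rw [him]; rcases hσ with rfl | rfl <;> linarith
  · rw [him]; rcases hσ with rfl | rfl <;> linarith

theorem sectorLog_eq (hσ : σ = 1 ∨ σ = -1) (lam : ℂ) :
    sectorLog σ lam =
      Real.log ‖lam‖ + ((σ * (Real.pi / 2) + 2 * halfAngle σ lam : ℝ) : ℂ) * Complex.I := by
  have hn : ‖-(σ * Complex.I * lam)‖ = ‖lam‖ := by
    rcases hσ with rfl | rfl <;> simp
  rw [sectorLog, Complex.log, hn, halfAngle]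
  push_cast
  ring

/-- In the sector |ψ| ≤ π/2 - ε/2, whence cos ψ ≥ sin(ε/2). This constant is the source of all
uniformity. -/
theorem halfAngle_of_mem_stokesSector (hσ : σ = 1 ∨ σ = -1) {ε : ℝ} (hε : 0 < ε)
    (h : lam ∈ stokesSector σ ε) : lam ≠ 0 ∧ Real.sin (ε / 2) ≤ Real.cos (halfAngle σ lam) := by
  obtain ⟨r, θ, hr, h1, h2, rfl⟩ := h
  have hr0 : (r : ℂ) ≠ 0 := by exact_mod_cast hr.ne'
  refine ⟨mul_ne_zero hr0 (Complex.exp_ne_zero _), ?_⟩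
  have harg : Complex.arg (-(σ * Complex.I * (r * Complex.exp (θ * Complex.I)))) =
      θ - σ * (Real.pi / 2) := by
    have hexp : -(σ * Complex.I * (r * Complex.exp (θ * Complex.I))) =
        r * Complex.exp (((θ - σ * (Real.pi / 2) : ℝ) : ℂ) * Complex.I) := by
      rcases hσ with rfl | rfl
      · rw [show ((θ - 1 * (Real.pi / 2) : ℝ) : ℂ) * Complex.I =
          θ * Complex.I - Real.pi / 2 * Complex.I by push_cast; ring, Complex.exp_sub,
          Complex.exp_pi_div_two_mul_I]
        simp only [Complex.ofReal_one, one_mul, Complex.div_I]; ring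
      · rw [show ((θ - -1 * (Real.pi / 2) : ℝ) : ℂ) * Complex.I =
          θ * Complex.I + Real.pi / 2 * Complex.I by push_cast; ring, Complex.exp_add,
          Complex.exp_pi_div_two_mul_I]
        push_cast; ring
    rw [hexp, Complex.arg_real_mul _ hr, Complex.arg_exp_mul_I, toIocMod_eq_self]
    constructor <;> rcases hσ with rfl | rfl <;> linarith
  have habs : |halfAngle σ (r * Complex.exp (θ * Complex.I))| ≤ Real.pi / 2 - ε / 2 := by
    rw [halfAngle, harg, abs_le]
    constructor <;> rcases hσ with rfl | rfl <;> linarith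
  rw [← Real.cos_abs (halfAngle _ _), ← Real.cos_pi_div_two_sub]
  exact Real.cos_le_cos_of_nonneg_of_le_pi (abs_nonneg _) (by linarith [Real.pi_pos]) habs

end

/-! ### Solutions and their asymptotics -/

namespace GenericArrangement

variable {k N : ℕ} (A : GenericArrangement k N)

theorem hasDerivAt_solution {α : Fin N → ℝ} (hα : ∀ j, 0 < α j) {σ : ℝ} (hσ : σ = 1 ∨ σ = -1)
    (X : ArrVertex k N) {lam : ℂ} (hlam : lam ∈ slitDomain σ) :
    HasDerivAt (fun μ => A.solution α σ X μ)
      (-((A.matA + lam⁻¹ • A.matB α).mulVec (A.solution α σ X lam))) lam := by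
  have hlam0 : lam ≠ 0 := by rintro rfl; simp [slitDomain] at hlam
  set ρ := midDirection σ lam
  have hadm : Admissible σ lam ρ := admissible_midDirection hσ hlam0 (cos_halfAngle_pos hσ hlam)
  have him : ρ.im ≠ 0 := fun h0 => by have := hadm.2.1; simp [h0] at this
  -- A direction admissible at λ stays admissible nearby, so the derivative may be computed with ρ
  -- fixed.
  have hev : ∀ᶠ μ in 𝓝 lam, Admissible σ μ ρ := by
    have hc : ContinuousAt (fun μ : ℂ => (ρ * μ).re) lam :=
      (Complex.continuous_re.comp (continuous_const_mul ρ)).continuousAt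
    filter_upwards [hc.eventually_const_lt hadm.2.2] with μ hμ using ⟨hadm.1, hadm.2.1, hμ⟩
  have hsol : A.solution α σ X lam = fun X' => A.rhoIntegral α ρ X X' lam := by
    ext X'; exact A.solution_eq hα X X' hadm
  rw [hasDerivAt_pi]
  intro X'
  rw [hsol]
  refine (A.hasDerivAt_rhoIntegral hα X X' (by rw [mul_comm]; exact hadm.2.2)
    him).congr_of_eventuallyEq ?_
  filter_upwards [hev] with μ hμ using A.solution_eq hα X X' hμ

/-- The factor that turns the leading term at `X` into the integral with the form of `X'`. -/
def leadingFactor (α : Fin N → ℝ) (X X' : ArrVertex k N) : ℝ :=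
  A.coneVolume X * A.absDet X' * A.signOn X X'.1 *
    ∏ m, |A.slopeAt X m| ^ lower α X'.1 (idx X m)

/-- Each j ∈ X∖X' keeps its full exponent α_j and costs one extra power of λ. This is what makes the
components X' ≠ X negligible. -/
theorem sum_lower_add_one (α : Fin N → ℝ) (X X' : ArrVertex k N) :
    ∑ m, (lower α X'.1 (idx X m) + 1) = weight α X.1 + (X.1 \ X'.1).card := by
  rw [sum_idx X fun j => lower α X'.1 j + 1, weight, Finset.card_eq_sum_ones, Nat.cast_sum,
    Finset.sdiff_eq_filter, Finset.sum_filter, ← Finset.sum_add_distrib]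
  refine Finset.sum_congr rfl fun j _ => ?_
  rw [lower]
  split_ifs <;> simp_all

/-- The solution after rescaling of the integral by `|λ|`. -/
theorem solution_eq_rescaled {α : Fin N → ℝ} (hα : ∀ j, 0 < α j) {σ : ℝ} (hσ : σ = 1 ∨ σ = -1)
    (X X' : ArrVertex k N) {lam : ℂ} (hlam : lam ≠ 0) (hc : 0 < Real.cos (halfAngle σ lam)) :
    A.solution α σ X lam X' =
      (Complex.exp (-lam * (A.f0 (A.point X) : ℂ)) * sectorPow σ lam (-(weight α X.1 : ℂ))) *
        ((A.leadingFactor α X X' : ℂ) *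
          (((‖lam‖⁻¹ : ℝ) : ℂ) * midDirection σ lam) ^ (X.1 \ X'.1).card *
          Complex.exp ((weight α X.1 * halfAngle σ lam : ℝ) * Complex.I) *
          ∫ a in posOrthant k, A.core (lower α X'.1) X
            (Complex.exp (halfAngle σ lam * Complex.I))
            (((‖lam‖⁻¹ : ℝ) : ℂ) * midDirection σ lam) a) := by
  have hadm := admissible_midDirection hσ hlam hc
  have hn : 0 < ‖lam‖ := norm_pos_iff.2 hlam
  have him : (midDirection σ lam).im ≠ 0 := fun h0 => by have := hadm.2.1; simp [h0] at this
  have hρ0 := ne_zero_of_im_ne_zero him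
  have hn0 : ((‖lam‖⁻¹ : ℝ) : ℂ) ≠ 0 := by exact_mod_cast (inv_pos.2 hn).ne'
  have hu : lam * (((‖lam‖⁻¹ : ℝ) : ℂ) * midDirection σ lam) =
      Complex.exp (halfAngle σ lam * Complex.I) := by
    rw [mul_left_comm, mul_midDirection hσ, ← mul_assoc, ← Complex.ofReal_mul,
      inv_mul_cancel₀ hn.ne', Complex.ofReal_one, one_mul]
  -- With log λ of the sector equal to log |λ| + i(σπ/2 + 2ψ), the logarithm of ρ/|λ| is -log λ +
  -- iψ. Powers of ρ/|λ| become powers of λ times a unimodular phase.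
  have hlog : Complex.log (((‖lam‖⁻¹ : ℝ) : ℂ) * midDirection σ lam) =
      -sectorLog σ lam + (halfAngle σ lam : ℂ) * Complex.I := by
    rw [Complex.log_ofReal_mul (inv_pos.2 hn) hρ0, log_midDirection hσ lam hc, sectorLog_eq hσ,
      Real.log_inv]
    push_cast
    ring
  have hfac : A.coneFactor (lower α X'.1) X (((‖lam‖⁻¹ : ℝ) : ℂ) * midDirection σ lam) =
      sectorPow σ lam (-(weight α X.1 : ℂ)) *
        Complex.exp ((weight α X.1 * halfAngle σ lam : ℝ) * Complex.I) *
        (((‖lam‖⁻¹ : ℝ) : ℂ) * midDirection σ lam) ^ (X.1 \ X'.1).card *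
        ((∏ m, |A.slopeAt X m| ^ lower α X'.1 (idx X m) : ℝ) : ℂ) := by
    rw [coneFactor, sum_lower_add_one]
    congr 1
    have hpow : (((‖lam‖⁻¹ : ℝ) : ℂ) * midDirection σ lam) ^ (X.1 \ X'.1).card =
        Complex.exp (((X.1 \ X'.1).card : ℂ) *
          Complex.log (((‖lam‖⁻¹ : ℝ) : ℂ) * midDirection σ lam)) := by
      rw [Complex.exp_nat_mul, Complex.exp_log (mul_ne_zero hn0 hρ0)]
    rw [hpow, Complex.ofReal_add, add_mul, Complex.exp_add, Complex.ofReal_natCast]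
    congr 1
    rw [hlog, sectorPow, ← Complex.exp_add]
    push_cast
    ring_nf
  rw [A.solution_eq hα X X' hadm, A.rhoIntegral_eq α him,
    ← A.coneIntegral_smul _ X lam hρ0 (inv_pos.2 hn), coneIntegral, hu, hfac, prefactor,
    leadingFactor]
  push_cast
  ring

theorem coneSign_eq (X : ArrVertex k N) : A.coneSign X = A.signOn X X.1 :=
  Finset.prod_congr rfl fun j hj => by rw [domainSign, if_pos hj]

theorem leadingFactor_self (α : Fin N → ℝ) (X : ArrVertex k N) :
    A.leadingFactor α X X = A.coneSign X * ∏ j ∈ X.1, |A.l j (A.edgeVec (X.1.erase j))| ^ α j := by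
  have h1 := A.absDet_mul_coneVolume X
  have h2 : (∏ m, |A.slopeAt X m|) * ∏ m, |A.slopeAt X m| ^ lower α X.1 (idx X m) =
      ∏ j ∈ X.1, |A.l j (A.edgeVec (X.1.erase j))| ^ α j := by
    rw [← Finset.prod_mul_distrib, ← prod_idx X]
    refine Finset.prod_congr rfl fun m _ => ?_
    have hs := abs_pos.2 (A.slopeAt_ne X m)
    rw [lower, if_pos (idx_mem X m), Real.rpow_sub_one hs.ne', mul_div_cancel₀ _ hs.ne']
    rfl
  rw [leadingFactor, coneSign_eq, ← h2, ← h1]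
  ring

theorem abs_coneSign (X : ArrVertex k N) : |A.coneSign X| = 1 := by
  rw [coneSign_eq, signOn, Finset.abs_prod]
  exact Finset.prod_eq_one fun j _ => A.abs_domainSign X j

theorem constD_pos {α : Fin N → ℝ} (hα : ∀ j, 0 < α j) (X : ArrVertex k N) : 0 < A.constD α X := by
  refine mul_pos (mul_pos ?_ ?_) ?_
  · exact Finset.prod_pos fun j _ => Real.Gamma_pos_of_pos (hα j)
  · exact Finset.prod_pos fun j hj => Real.rpow_pos_of_pos (abs_pos.2 (A.l_edge_ne X hj)) _
  · exact Finset.prod_pos fun j hj => Real.rpow_pos_of_pos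
      (abs_pos.2 (A.f_point_ne X (Finset.mem_compl.1 hj))) _

/-- The limit value of the rescaled integral. -/
def leadingConst (α : Fin N → ℝ) (X X' : ArrVertex k N) : ℝ :=
  (∏ j ∈ X.1ᶜ, A.absAt X j ^ lower α X'.1 j) * ∏ m, Real.Gamma (lower α X'.1 (idx X m) + 1)

theorem leadingFactor_mul_leadingConst (α : Fin N → ℝ) (X : ArrVertex k N) :
    A.leadingFactor α X X * A.leadingConst α X X = A.coneSign X * A.constD α X := by
  have h1 : ∏ m, Real.Gamma (lower α X.1 (idx X m) + 1) = ∏ j ∈ X.1, Real.Gamma (α j) := by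
    rw [← prod_idx X]
    exact Finset.prod_congr rfl fun m _ => by rw [lower, if_pos (idx_mem X m), sub_add_cancel]
  have h2 : ∏ j ∈ X.1ᶜ, A.absAt X j ^ lower α X.1 j = ∏ j ∈ X.1ᶜ, |A.f j (A.point X)| ^ α j :=
    Finset.prod_congr rfl fun j hj => by rw [lower, if_neg (Finset.mem_compl.1 hj), absAt]
  rw [leadingFactor_self, leadingConst, h1, h2, constD]
  ring

/-- After rescaling, μ = e^{iψ} has real part at least sin(ε/2), while ρ/|λ| tends to 0 at a fixed
angular distance from the real axis. The exponential in the limit is a power of μ. -/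
theorem tendsto_rescaled {α : Fin N → ℝ} (hα : ∀ j, 0 < α j) {σ : ℝ} (hσ : σ = 1 ∨ σ = -1)
    (X X' : ArrVertex k N) {ε : ℝ} (hε : 0 < ε) (hε' : ε < Real.pi / 2) :
    Tendsto (fun lam => (∫ a in posOrthant k, A.core (lower α X'.1) X
        (Complex.exp (halfAngle σ lam * Complex.I))
        (((‖lam‖⁻¹ : ℝ) : ℂ) * midDirection σ lam) a) - (A.leadingConst α X X' : ℂ) *
          Complex.exp (((-(∑ m, (lower α X'.1 (idx X m) + 1)) * halfAngle σ lam : ℝ) : ℂ) *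
            Complex.I))
      (Bornology.cobounded ℂ ⊓ 𝓟 (stokesSector σ ε)) (𝓝 0) := by
  -- Dominated convergence along a filter needs a countable base; it comes from the norm.
  have hcg : (Bornology.cobounded ℂ).IsCountablyGenerated := by
    rw [← comap_norm_atTop]; infer_instance
  have hsin : 0 < Real.sin (ε / 2) := Real.sin_pos_of_pos_of_lt_pi (by linarith)
    (by linarith [Real.pi_pos])
  have hS : ∀ᶠ lam in Bornology.cobounded ℂ ⊓ 𝓟 (stokesSector σ ε), lam ∈ stokesSector σ ε :=
    mem_inf_of_right (mem_principal_self _)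
  have hnorm : ∀ lam : ℂ, ‖((‖lam‖⁻¹ : ℝ) : ℂ) * midDirection σ lam‖ = ‖lam‖⁻¹ := by
    intro lam
    rw [norm_mul, norm_midDirection hσ, mul_one, Complex.norm_real, Real.norm_of_nonneg
      (inv_nonneg.2 (norm_nonneg _))]
  have h := tendsto_integral_laplaceCore (f := Bornology.cobounded ℂ ⊓ 𝓟 (stokesSector σ ε))
    (A.absAt_pos X) (b := A.signedSlope X) (γ := lower α X'.1 ∘ idx X) (β := lower α X'.1)
    (fun m => neg_one_lt_lower hα X'.1 _)
    (u := fun lam => Complex.exp (halfAngle σ lam * Complex.I))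
    (v := fun lam => ((‖lam‖⁻¹ : ℝ) : ℂ) * midDirection σ lam) hsin hsin ?_ ?_ ?_
  · refine h.congr' ?_
    filter_upwards [hS] with lam _
    have hle := abs_le.1 (abs_halfAngle_le σ lam)
    rw [Complex.log_exp (by simp; linarith [Real.pi_pos]) (by simp; linarith [Real.pi_pos]), core,
      leadingConst]
    simp only [Function.comp_apply]
    push_cast
    ring_nf
  · filter_upwards [hS] with lam hlam
    rw [Complex.exp_ofReal_mul_I_re]
    exact (halfAngle_of_mem_stokesSector hσ hε hlam).2
  · filter_upwards [hS] with lam hlam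
    obtain ⟨h0, hc⟩ := halfAngle_of_mem_stokesSector hσ hε hlam
    have hn : 0 < ‖lam‖⁻¹ := inv_pos.2 (norm_pos_iff.2 h0)
    refine ⟨norm_pos_iff.1 (by rw [hnorm]; exact hn), ?_⟩
    rw [hnorm, Complex.im_ofReal_mul, abs_mul, abs_of_pos hn, midDirection_im, abs_neg, abs_mul,
      abs_of_pos (hsin.trans_le hc)]
    have : |σ| = 1 := by rcases hσ with rfl | rfl <;> simp
    rw [this, one_mul, mul_comm]
    gcongr
  · refine tendsto_zero_iff_norm_tendsto_zero.2 ?_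
    simp only [hnorm]
    exact tendsto_inv_atTop_zero.comp (tendsto_norm_cobounded_atTop.mono_left inf_le_left)

/-- For X' = X the phase e^{iα_X ψ} from ρ cancels the one from μ^{-α_X}, and the constants combine
to s_X D_{X,X}. For X' ≠ X the rescaled integral is bounded and is multiplied by a positive power of
|λ|⁻¹. -/
theorem isLittleO_solution_sub {α : Fin N → ℝ} (hα : ∀ j, 0 < α j) {σ : ℝ} (hσ : σ = 1 ∨ σ = -1)
    (X X' : ArrVertex k N) {ε : ℝ} (hε : 0 < ε) (hε' : ε < Real.pi / 2) :
    (fun lam => A.solution α σ X lam X' - (((A.coneSign X * A.constD α X : ℝ) : ℂ) *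
          Complex.exp (-lam * (A.f0 (A.point X) : ℂ)) *
          sectorPow σ lam (-(weight α X.1 : ℂ))) * (Pi.single X 1 : ArrVertex k N → ℂ) X')
      =o[Bornology.cobounded ℂ ⊓ 𝓟 (stokesSector σ ε)]
      fun lam => Complex.exp (-lam * (A.f0 (A.point X) : ℂ)) *
        sectorPow σ lam (-(weight α X.1 : ℂ)) := by
  have hS : ∀ᶠ lam in Bornology.cobounded ℂ ⊓ 𝓟 (stokesSector σ ε), lam ∈ stokesSector σ ε :=
    mem_inf_of_right (mem_principal_self _)
  have hsin : 0 < Real.sin (ε / 2) := Real.sin_pos_of_pos_of_lt_pi (by linarith)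
    (by linarith [Real.pi_pos])
  have hJ := A.tendsto_rescaled hα hσ X X' hε hε'
  set F := Bornology.cobounded ℂ ⊓ 𝓟 (stokesSector σ ε)
  set J : ℂ → ℂ := fun lam => ∫ a in posOrthant k, A.core (lower α X'.1) X
        (Complex.exp (halfAngle σ lam * Complex.I)) (((‖lam‖⁻¹ : ℝ) : ℂ) * midDirection σ lam) a
  set s := ∑ m, (lower α X'.1 (idx X m) + 1) with hs
  suffices H : ∃ η : ℂ → ℂ, Tendsto η F (𝓝 0) ∧ ∀ᶠ lam in F,
      A.solution α σ X lam X' - (((A.coneSign X * A.constD α X : ℝ) : ℂ) *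
          Complex.exp (-lam * (A.f0 (A.point X) : ℂ)) *
          sectorPow σ lam (-(weight α X.1 : ℂ))) * (Pi.single X 1 : ArrVertex k N → ℂ) X' =
      (Complex.exp (-lam * (A.f0 (A.point X) : ℂ)) *
        sectorPow σ lam (-(weight α X.1 : ℂ))) * η lam by
    obtain ⟨η, h1, h2⟩ := H
    have h3 := (isBigO_refl (fun lam => Complex.exp (-lam * (A.f0 (A.point X) : ℂ)) *
        sectorPow σ lam (-(weight α X.1 : ℂ))) F).mul_isLittleO ((isLittleO_one_iff ℂ).2 h1)
    simp only [mul_one] at h3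
    exact h3.congr' (h2.mono fun _ h => h.symm) EventuallyEq.rfl
  have hsol : ∀ᶠ lam in F, A.solution α σ X lam X' =
      (Complex.exp (-lam * (A.f0 (A.point X) : ℂ)) * sectorPow σ lam (-(weight α X.1 : ℂ))) *
        ((A.leadingFactor α X X' : ℂ) *
          (((‖lam‖⁻¹ : ℝ) : ℂ) * midDirection σ lam) ^ (X.1 \ X'.1).card *
          Complex.exp ((weight α X.1 * halfAngle σ lam : ℝ) * Complex.I) * J lam) := by
    filter_upwards [hS] with lam hlam
    obtain ⟨h0, hc⟩ := halfAngle_of_mem_stokesSector hσ hε hlam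
    exact A.solution_eq_rescaled hα hσ X X' h0 (hsin.trans_le hc)
  by_cases hXX : X' = X
  · subst hXX
    refine ⟨fun lam => (A.leadingFactor α X' X' : ℂ) *
      (Complex.exp ((weight α X'.1 * halfAngle σ lam : ℝ) * Complex.I) *
        (J lam - (A.leadingConst α X' X' : ℂ) *
          Complex.exp (((-s * halfAngle σ lam : ℝ) : ℂ) * Complex.I))), ?_, ?_⟩
    · rw [← mul_zero (A.leadingFactor α X' X' : ℂ)]
      refine Tendsto.const_mul _ (tendsto_zero_iff_norm_tendsto_zero.2 ?_)
      have h := hJ.norm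
      rw [norm_zero] at h
      refine h.congr fun lam => ?_
      rw [norm_mul, Complex.norm_exp_ofReal_mul_I, one_mul]
    · filter_upwards [hsol] with lam hlam
      have hsw : s = weight α X'.1 := by rw [hs, sum_lower_add_one]; simp
      have he : Complex.exp ((weight α X'.1 * halfAngle σ lam : ℝ) * Complex.I) *
          Complex.exp (((-s * halfAngle σ lam : ℝ) : ℂ) * Complex.I) = 1 := by
        rw [← Complex.exp_add, hsw]
        push_cast
        rw [show (weight α X'.1 : ℂ) * halfAngle σ lam * Complex.I +
          -(weight α X'.1 : ℂ) * halfAngle σ lam * Complex.I = 0 by ring, Complex.exp_zero]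
      have hD := congrArg (fun x : ℝ => (x : ℂ)) (A.leadingFactor_mul_leadingConst α X')
      rw [Complex.ofReal_mul] at hD
      rw [hlam, Pi.single_eq_same, Finset.sdiff_self, Finset.card_empty, pow_zero, ← hD]
      linear_combination (Complex.exp (-lam * (A.f0 (A.point X') : ℂ)) *
        sectorPow σ lam (-(weight α X'.1 : ℂ))) * (A.leadingFactor α X' X' : ℂ) *
          (A.leadingConst α X' X' : ℂ) * he
  · refine ⟨_, ?_, hsol.mono fun lam h => by
      rw [h, Pi.single_eq_of_ne hXX, mul_zero, sub_zero]⟩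
    -- Both vertices have k elements, so X ⊆ X' would force equality.
    have hcard : (X.1 \ X'.1).card ≠ 0 := by
      intro h0
      have hsub := Finset.sdiff_eq_empty_iff_subset.1 (Finset.card_eq_zero.1 h0)
      exact hXX (Subtype.ext (Finset.eq_of_subset_of_card_le hsub (by rw [X.2, X'.2])).symm)
    have hinv : Tendsto (fun lam : ℂ => ‖lam‖⁻¹) F (𝓝 0) :=
      tendsto_inv_atTop_zero.comp (tendsto_norm_cobounded_atTop.mono_left inf_le_left)
    have hb : ∀ᶠ lam in F, ‖J lam‖ ≤ 1 + |A.leadingConst α X X'| := by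
      filter_upwards [hJ.norm.eventually_lt_const (by simp : ‖(0 : ℂ)‖ < 1)] with lam hlam
      have h1 := norm_sub_norm_le (J lam) ((A.leadingConst α X X' : ℂ) *
          Complex.exp (((-s * halfAngle σ lam : ℝ) : ℂ) * Complex.I))
      rw [norm_mul, Complex.norm_exp_ofReal_mul_I, mul_one, Complex.norm_real,
        Real.norm_eq_abs] at h1
      linarith
    refine squeeze_zero_norm' (a := fun lam => |A.leadingFactor α X X'| *
      (‖lam‖⁻¹ ^ (X.1 \ X'.1).card) * (1 + |A.leadingConst α X X'|)) ?_ ?_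
    · filter_upwards [hb] with lam hlam
      rw [norm_mul, norm_mul, norm_mul, Complex.norm_exp_ofReal_mul_I, mul_one, norm_pow, norm_mul,
        norm_midDirection hσ, mul_one, Complex.norm_real, Complex.norm_real, Real.norm_eq_abs,
        Real.norm_of_nonneg (inv_nonneg.2 (norm_nonneg lam))]
      gcongr
    · have := ((hinv.pow (X.1 \ X'.1).card).const_mul |A.leadingFactor α X X'|).mul_const
        (1 + |A.leadingConst α X X'|)
      simpa [zero_pow hcard] using this

/-- The componentwise estimates combine because the index set is finite. Since s_X D_{X,X} ≠ 0, the
leading vector has norm comparable to |e^{-λ f₀(X)} λ^{-α_X}|. -/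
theorem isEquivalent_solution {α : Fin N → ℝ} (hα : ∀ j, 0 < α j) {σ : ℝ} (hσ : σ = 1 ∨ σ = -1)
    (X : ArrVertex k N) {ε : ℝ} (hε : 0 < ε) (hε' : ε < Real.pi / 2) :
    (fun lam => A.solution α σ X lam)
      ~[Bornology.cobounded ℂ ⊓ 𝓟 (stokesSector σ ε)]
      (fun lam => (((A.coneSign X * A.constD α X : ℝ) : ℂ) *
        Complex.exp (-lam * (A.f0 (A.point X) : ℂ)) *
        sectorPow σ lam (-(weight α X.1 : ℂ))) • (Pi.single X 1 : ArrVertex k N → ℂ)) := by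
  have hne : ((A.coneSign X * A.constD α X : ℝ) : ℂ) ≠ 0 := by
    refine Complex.ofReal_ne_zero.2 (mul_ne_zero (fun h => ?_) (A.constD_pos hα X).ne')
    have := A.abs_coneSign X
    simp [h] at this
  refine IsLittleO.trans_isBigO (isLittleO_pi.2 fun X' => A.isLittleO_solution_sub hα hσ X X' hε hε')
    ?_
  refine IsBigO.of_bound ‖((A.coneSign X * A.constD α X : ℝ) : ℂ)‖⁻¹ (Eventually.of_forall fun lam => ?_)
  have h1 : ‖(Pi.single X 1 : ArrVertex k N → ℂ)‖ = 1 := by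
    rw [Pi.norm_single, norm_one]
  rw [norm_smul, h1, mul_one, mul_assoc, norm_mul ((A.coneSign X * A.constD α X : ℝ) : ℂ),
    inv_mul_cancel_left₀ (norm_ne_zero_iff.2 hne)]

end GenericArrangement

theorem proposition2 {k N : ℕ} (A : GenericArrangement k N)
    (α : Fin N → ℝ) (hα : ∀ j, 0 < α j)
    (σ : ℝ) (hσ : σ = 1 ∨ σ = -1) (X : ArrVertex k N) :
    -- for admissible `ρ` the integrals converge and do not depend on `ρ`
    (∀ lam ρ : ℂ, GenericArrangement.Admissible σ lam ρ → ∀ X' : ArrVertex k N,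
      IntegrableOn (A.integrand α ρ X X' lam) (A.cone X) ∧
      A.solution α σ X lam X' = A.rhoIntegral α ρ X X' lam) ∧
    -- `I^±_X` solves `I' = -(𝒜 + ℬ/λ) I`
    (∀ lam ∈ slitDomain σ,
      HasDerivAt (fun μ => A.solution α σ X μ)
        (-((A.matA + lam⁻¹ • A.matB α).mulVec (A.solution α σ X lam))) lam) ∧
    -- asymptotics, uniformly in the sector `S_±`
    (∀ ε : ℝ, 0 < ε → ε < Real.pi / 2 →
      (fun lam => A.solution α σ X lam)
        ~[Bornology.cobounded ℂ ⊓ 𝓟 (stokesSector σ ε)]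
      (fun lam => (((A.coneSign X * A.constD α X : ℝ) : ℂ) *
          Complex.exp (-lam * (A.f0 (A.point X) : ℂ)) *
          sectorPow σ lam (-(GenericArrangement.weight α X.1 : ℂ))) •
        (Pi.single X 1 : ArrVertex k N → ℂ))) := by
  refine ⟨fun lam ρ h X' => ⟨?_, A.solution_eq hα X X' h⟩,
    fun lam hlam => A.hasDerivAt_solution hα hσ X hlam,
    fun ε hε hε' => A.isEquivalent_solution hα hσ X hε hε'⟩
  have him : ρ.im ≠ 0 := fun h0 => by have := h.2.1; simp [h0] at this
  exact A.integrableOn_integrand hα him X X' (by rw [mul_comm]; exact h.2.2)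

end
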